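/- Let $\Gamma_+=\{\lambda\in\mathbb{R}^n:\lambda_i>0 \text{ for all } i\}$ and let $f:\Gamma_+\to\mathbb{R}$ be an admissible underlying speed function, that is, a smooth function that is invariant under permutations of its variables, monotone increasing (in the weak sense: non-decreasing) in each variable, homogeneous of degree one, and positive. Suppose that $f$ is inverse-concave, i.e. the dual function $f_*(\mu_1,\dots,\mu_n):=f(\mu_1^{-1},\dots,\mu_n^{-1})^{-1}$ is concave on $\Gamma_+$. Let $\Psi:(0,\infty)\to\mathbb{R}$ be a $C^2$ function satisfying, for all $s>0$, $$\Psi'(s)>0,\qquad \Psi'(s)s-\Psi(s)\ge 0,\qquad \Psi''(s)\le 0,\qquad \Psi''(s)s+2\Psi'(s)\ge 0 .$$ Let $M^n$ be a closed (compact, without boundary), connected smooth $n$-manifold, let $0<T\le\infty$, and let $X:M\times[0,T)\to\mathbb{R}^{n+1}$ be a smooth family of embeddings $X(\cdot,t)$. Suppose that each $X(M,t)$ is the boundary of a bounded open set, with outward unit normal $\nu(\cdot,t)$, smooth in $(x,t)$, and that the principal curvatures $\kappa=(\kappa_1,\dots,\kappa_n)$ with respect to $\nu$ (with the sign for which round spheres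 have positive curvature) lie in $\Gamma_+$ everywhere. Suppose that $X$ solves $$\partial_t X(x,t)=-\Psi(F(x,t))\,\nu(x,t),\qquad F(x,t)=f(\kappa(x,t)),\qquad (x,t)\in M\times[0,T).$$ Let $$\underline{k}(x,t):=\inf_{y\in M\setminus\{x\}}\frac{2\langle X(x,t)-X(y,t),\nu(x,t)\rangle}{|X(x,t)-X(y,t)|^2}$$ be the exscribed curvature. Then $$C_0:=\inf_{x\in M}\frac{\underline{k}(x,0)}{F(x,0)}>0\qquad\text{and}\qquad \frac{\underline{k}(x,t)}{F(x,t)}\ge C_0\quad\text{for all }(x,t)\in M\times[0,T).$$ Moreover, the function $t\mapsto\inf_{x\in M}\frac{\underline{k}(x,t)}{F(x,t)}$ is non-decreasing on $[0,T)$. -/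

import Mathlib

open Set Filter Topology
open scoped Manifold ContDiff

noncomputable section

namespace CurvatureFlow

/-- The Euclidean space `ℝⁿ⁺¹` in which the hypersurfaces live. -/
abbrev Ambient (n : ℕ) : Type := EuclideanSpace ℝ (Fin (n + 1))

/-- The positive cone `Γ₊ ⊂ ℝⁿ`. -/
def positiveCone (n : ℕ) : Set (Fin n → ℝ) := {μ | ∀ i, 0 < μ i}

/-- Admissible underlying speed functions on `Γ₊`: smooth, symmetric, monotone in each variable,
homogeneous of degree one, and positive. -/
structure IsAdmissible {n : ℕ} (f : (Fin n → ℝ) → ℝ) : Prop where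
  smooth : ContDiffOn ℝ ∞ f (positiveCone n)
  symmetric : ∀ (σ : Equiv.Perm (Fin n)), ∀ μ ∈ positiveCone n, f (μ ∘ σ) = f μ
  monotone : MonotoneOn f (positiveCone n)
  homogeneous : ∀ (c : ℝ), 0 < c → ∀ μ ∈ positiveCone n, f (c • μ) = c * f μ
  positive : ∀ μ ∈ positiveCone n, 0 < f μ

/-- The dual function `f_*(μ₁, …, μₙ) = f(μ₁⁻¹, …, μₙ⁻¹)⁻¹`. -/
def dual {n : ℕ} (f : (Fin n → ℝ) → ℝ) (μ : Fin n → ℝ) : ℝ := (f fun i => (μ i)⁻¹)⁻¹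

/-- `f` is inverse-concave if its dual is concave on `Γ₊`. -/
def IsInverseConcave {n : ℕ} (f : (Fin n → ℝ) → ℝ) : Prop :=
  ConcaveOn ℝ (positiveCone n) (dual f)

/-- The structural conditions on the modulating function `Ψ : (0, ∞) → ℝ`: it is `C²` with
`Ψ' > 0`, `Ψ' s - Ψ ≥ 0`, `Ψ'' ≤ 0` and `Ψ'' s + 2 Ψ' ≥ 0`. -/
structure IsModulating (Ψ : ℝ → ℝ) : Prop where
  contDiff : ContDiffOn ℝ 2 Ψ (Ioi 0)
  deriv_pos : ∀ s, 0 < s → 0 < deriv Ψ s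
  deriv_mul_sub_nonneg : ∀ s, 0 < s → 0 ≤ deriv Ψ s * s - Ψ s
  deriv2_nonpos : ∀ s, 0 < s → deriv (deriv Ψ) s ≤ 0
  deriv2_mul_add_nonneg : ∀ s, 0 < s → 0 ≤ deriv (deriv Ψ) s * s + 2 * deriv Ψ s

section Hypersurface

variable {n : ℕ} {M : Type*} [TopologicalSpace M] [ChartedSpace (EuclideanSpace ℝ (Fin n)) M]

/-- `Y` is a smooth embedding: a smooth immersion which is a homeomorphism onto its image. -/
structure IsSmoothEmbedding (Y : M → Ambient n) : Prop where
  smooth : ContMDiff (𝓡 n) 𝓘(ℝ, Ambient n) ∞ Y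
  immersion : ∀ x, Function.Injective (mvfderiv (𝓡 n) Y x)
  embedding : IsEmbedding Y

/-- `N` is the outward unit normal field of the hypersurface `Y(M) = ∂Ω`, for a bounded
open set `Ω`. -/
def IsOutwardUnitNormal (Y N : M → Ambient n) : Prop :=
  ∃ Ω : Set (Ambient n), IsOpen Ω ∧ Bornology.IsBounded Ω ∧ frontier Ω = range Y ∧
    ∀ x, ‖N x‖ = 1 ∧ (∀ u, inner ℝ (mvfderiv (𝓡 n) Y x u) (N x) = 0) ∧
      ∀ᶠ s in 𝓝[>] (0 : ℝ), Y x - s • N x ∈ Ω ∧ Y x + s • N x ∉ closure Ω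

/-- `κ` is the increasingly ordered tuple of principal curvatures of `Y` at `x` with respect to the
unit normal `N`: there is a frame `e` of the tangent space, orthonormal for the induced metric,
of principal directions, `dN(eᵢ) = κᵢ dY(eᵢ)`. With this sign the unit sphere has principal
curvatures `1` with respect to its outward normal. -/
def IsPrincipalCurvatures (Y N : M → Ambient n) (x : M) (κ : Fin n → ℝ) : Prop :=
  Monotone κ ∧ ∃ e : Fin n → TangentSpace (𝓡 n) x,
    Orthonormal ℝ (fun i => mvfderiv (𝓡 n) Y x (e i)) ∧
      ∀ i, mvfderiv (𝓡 n) N x (e i) = κ i • mvfderiv (𝓡 n) Y x (e i)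

open Classical in
/-- The principal curvatures `κ₁ ≤ … ≤ κₙ` of `Y` at `x` with respect to `N`. For an immersion
with a smooth unit normal field, the tuple exists (the shape operator is symmetric) and is unique
(it lists the eigenvalues in increasing order). -/
def principalCurvatures (Y N : M → Ambient n) (x : M) : Fin n → ℝ :=
  if h : ∃ κ, IsPrincipalCurvatures Y N x κ then h.choose else 0

/-- The extrinsic ball curvature `k(x, y) = 2⟨Y(x) - Y(y), N(x)⟩ / |Y(x) - Y(y)|²`. -/
def ballCurvature (Y N : M → Ambient n) (x y : M) : ℝ :=
  2 * inner ℝ (Y x - Y y) (N x) / ‖Y x - Y y‖ ^ 2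

/-- The exscribed curvature `inf_{y ≠ x} k(x, y)`. -/
def exscribedCurvature (Y N : M → Ambient n) (x : M) : ℝ :=
  ⨅ y : {y : M // y ≠ x}, ballCurvature Y N x y

end Hypersurface

/-- The time interval `[0, T)`, where `T` may be `∞`. -/
def timeInterval (T : EReal) : Set ℝ := {t | 0 ≤ t ∧ (t : EReal) < T}

section Flow

variable {n : ℕ} {M : Type*} [TopologicalSpace M] [ChartedSpace (EuclideanSpace ℝ (Fin n)) M]

/-- The underlying speed `F(x, t) = f(κ(x, t))`. -/
def speed (f : (Fin n → ℝ) → ℝ) (X ν : M → ℝ → Ambient n) (x : M) (t : ℝ) : ℝ :=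
  f (principalCurvatures (fun y => X y t) (fun y => ν y t) x)

/-- The exscribed curvature of the hypersurface at time `t`. -/
def exscribed (X ν : M → ℝ → Ambient n) (x : M) (t : ℝ) : ℝ :=
  exscribedCurvature (fun y => X y t) (fun y => ν y t) x

/-- `X : M × [0, T) → ℝⁿ⁺¹`, with outward unit normal `ν`, is a smooth embedded solution of
`∂ₜ X = - Ψ(F) ν`, where `F = f(κ)` and `f` is defined on `Γ₊`, so that `κ` takes values there. -/
structure IsEmbeddedSolution (f : (Fin n → ℝ) → ℝ) (Ψ : ℝ → ℝ) (T : EReal)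
    (X ν : M → ℝ → Ambient n) : Prop where
  smooth : ContMDiffOn ((𝓡 n).prod 𝓘(ℝ, ℝ)) 𝓘(ℝ, Ambient n) ∞
    (fun p : M × ℝ => X p.1 p.2) (univ ×ˢ timeInterval T)
  smooth_normal : ContMDiffOn ((𝓡 n).prod 𝓘(ℝ, ℝ)) 𝓘(ℝ, Ambient n) ∞
    (fun p : M × ℝ => ν p.1 p.2) (univ ×ˢ timeInterval T)
  embedding : ∀ t ∈ timeInterval T, IsSmoothEmbedding fun x => X x t
  normal : ∀ t ∈ timeInterval T, IsOutwardUnitNormal (fun x => X x t) fun x => ν x t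
  curvature_mem : ∀ t ∈ timeInterval T, ∀ x,
    principalCurvatures (fun y => X y t) (fun y => ν y t) x ∈ positiveCone n
  flow : ∀ x, ∀ t ∈ timeInterval T,
    HasDerivWithinAt (fun s => X x s) (-(Ψ (speed f X ν x t)) • ν x t) (timeInterval T) t

end Flow

end CurvatureFlow

end

noncomputable section

namespace CurvatureFlow

/-! ### Symmetric concave functions -/

/-! The inequality `exscribed ≥ F / K` at `x` says that the ball of radius `K / F(x)`, tangent to
the hypersurface at `x` with the same outward normal, contains the whole hypersurface. The claim is
that this enclosure at all `x`, with constant `K`, persists in time; it is proved by a two-point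
maximum principle.

Positive curvature makes the Gauss map locally invertible, so near each point the flow is described
by the support function `h`, extended with homogeneity one, and the inverse speed `ρ = 1/F =
f_*(radii of curvature)`. It becomes `∂ₜh = |p| Φ(ρ)` with `Φ(s) = -Ψ(1/s)`. Comparing the support
functions of ball and hypersurface, enclosure reads `Kρ(z)(1 - ⟨z,w⟩) + Dh(z)w - h(w) ≥ 0` for unit
normals `z`, `w` (`twoPoint`). Passing between this and the chord form (`gap_nonneg_iff`) uses
global convexity, which `exists_chord_bounds` derives from local strict convexity.

With `K` replaced by `K(t) = K₀ + ε(1 + t - t₁)`, strictness can fail for the first time in two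
ways. The two-point function may vanish at some `z ≠ w`; `not_off_diagonal_zero` excludes this by
the first and second derivative tests, moving `z` along a principal direction and `w` along its
mirror image. Or a radius of curvature may reach `Kρ`; `not_diagonal_zero` excludes this by a tensor
maximum principle that also rotates the frame. Both computations leave the nonnegative term `(K Σ
∂ᵢf_* - 1)(Φ'ρ + Φ)`, up to a positive factor, and the strictly positive contribution of `K'`,
against an inequality `≤ 0`.

Inverse-concavity enters through `IsLocalSol.le_of_frame`: in any orthonormal frame `G` of the
tangent space, `ρ` is at most the tangent plane of `f_*` evaluated at the diagonal entries of the
inverse shape operator. The bound touches `ρ` at the base point when `G` is there an eigenframe, so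
comparing Taylor expansions gives the first derivatives of `ρ` exactly and its second derivatives as
inequalities, without ever differentiating eigenvalues.

Strict positivity at one time extends to slightly later times by compactness
(`eventually_gap_nonneg`), and `ε → 0` concludes. -/

theorem le_map_doublyStochastic_mulVec {n : ℕ} {C : Set (Fin n → ℝ)} {g : (Fin n → ℝ) → ℝ}
    (hg : ConcaveOn ℝ C g) (hC : ∀ (σ : Equiv.Perm (Fin n)), ∀ μ ∈ C, μ ∘ σ ∈ C)
    (hsymm : ∀ (σ : Equiv.Perm (Fin n)), ∀ μ ∈ C, g (μ ∘ σ) = g μ)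
    {S : Matrix (Fin n) (Fin n) ℝ} (hS : S ∈ doublyStochastic ℝ (Fin n))
    {μ : Fin n → ℝ} (hμ : μ ∈ C) : g μ ≤ g (S.mulVec μ) := by
  -- Birkhoff: `S` is a convex combination of permutation matrices. Jensen then bounds `g (S μ)`
  -- below by an average of values all equal to `g μ`.
  obtain ⟨w, hw0, hw1, rfl⟩ := exists_eq_sum_perm_of_mem_doublyStochastic hS
  have key : (∑ σ : Equiv.Perm (Fin n), w σ • σ.permMatrix ℝ).mulVec μ = ∑ σ, w σ • (μ ∘ σ) := by
    rw [Matrix.sum_mulVec]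
    refine Finset.sum_congr rfl fun σ _ => ?_
    rw [Matrix.smul_mulVec, Matrix.permMatrix_mulVec]
  rw [key]
  have := hg.le_map_sum (t := Finset.univ) (w := w) (p := fun σ : Equiv.Perm (Fin n) => μ ∘ σ)
    (fun σ _ => hw0 σ) hw1 (fun σ _ => hC σ μ hμ)
  refine le_trans (le_of_eq ?_) this
  simp only [hsymm _ μ hμ, smul_eq_mul]
  rw [← Finset.sum_mul, hw1, one_mul]

theorem positiveCone_comp {n : ℕ} (σ : Equiv.Perm (Fin n)) (μ : Fin n → ℝ)
    (hμ : μ ∈ positiveCone n) : μ ∘ σ ∈ positiveCone n := fun i => hμ (σ i)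

theorem isOpen_positiveCone (n : ℕ) : IsOpen (positiveCone n) := by
  have : positiveCone n = Set.pi univ fun _ => Ioi (0 : ℝ) := by
    ext μ; simp [positiveCone]
  rw [this]
  exact isOpen_set_pi finite_univ fun _ _ => isOpen_Ioi

theorem inv_mem_positiveCone {n : ℕ} {μ : Fin n → ℝ} (hμ : μ ∈ positiveCone n) :
    (fun i => (μ i)⁻¹) ∈ positiveCone n := fun i => inv_pos.2 (hμ i)

section Dual

variable {n : ℕ} {f : (Fin n → ℝ) → ℝ}

theorem dual_inv (μ : Fin n → ℝ) : dual f (fun i => (μ i)⁻¹) = (f μ)⁻¹ := by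
  simp [dual]

theorem dual_pos (hf : IsAdmissible f) {μ : Fin n → ℝ} (hμ : μ ∈ positiveCone n) :
    0 < dual f μ := inv_pos.2 (hf.positive _ (inv_mem_positiveCone hμ))

theorem dual_comp_perm (hf : IsAdmissible f) (σ : Equiv.Perm (Fin n)) (μ : Fin n → ℝ)
    (hμ : μ ∈ positiveCone n) : dual f (μ ∘ σ) = dual f μ := by
  unfold dual
  rw [← hf.symmetric σ _ (inv_mem_positiveCone hμ)]
  rfl

theorem dual_smul (hf : IsAdmissible f) {c : ℝ} (hc : 0 < c) {μ : Fin n → ℝ}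
    (hμ : μ ∈ positiveCone n) : dual f (c • μ) = c * dual f μ := by
  unfold dual
  have h := hf.homogeneous c⁻¹ (inv_pos.2 hc) _ (inv_mem_positiveCone hμ)
  have e : (fun i => ((c • μ) i)⁻¹) = c⁻¹ • fun i => (μ i)⁻¹ := by
    ext i; simp [mul_comm]
  rw [e, h, mul_inv, inv_inv]

theorem dual_mono (hf : IsAdmissible f) {μ ν : Fin n → ℝ} (hμ : μ ∈ positiveCone n)
    (hν : ν ∈ positiveCone n) (h : μ ≤ ν) : dual f μ ≤ dual f ν := by
  unfold dual
  refine inv_anti₀ (hf.positive _ (inv_mem_positiveCone hν)) ?_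
  exact hf.monotone (inv_mem_positiveCone hν) (inv_mem_positiveCone hμ)
    fun i => inv_anti₀ (hμ i) (h i)

theorem differentiableAt_dual (hf : IsAdmissible f) {μ : Fin n → ℝ} (hμ : μ ∈ positiveCone n) :
    DifferentiableAt ℝ (dual f) μ := by
  have h1 : DifferentiableAt ℝ f (fun i => (μ i)⁻¹) :=
    ((hf.smooth _ (inv_mem_positiveCone hμ)).contDiffAt
      ((isOpen_positiveCone n).mem_nhds (inv_mem_positiveCone hμ))).differentiableAt (by simp)
  have h2 : DifferentiableAt ℝ (fun ν : Fin n → ℝ => fun i => (ν i)⁻¹) μ := by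
    rw [differentiableAt_pi]
    exact fun i => (differentiableAt_apply i μ).inv (hμ i).ne'
  have h3 : DifferentiableAt ℝ (fun ν : Fin n → ℝ => f fun i => (ν i)⁻¹) μ :=
    DifferentiableAt.comp (g := f) μ h1 h2
  exact h3.inv (hf.positive _ (inv_mem_positiveCone hμ)).ne'

/-- The partial derivatives of the dual function. -/
def dualGrad (f : (Fin n → ℝ) → ℝ) (μ : Fin n → ℝ) (i : Fin n) : ℝ :=
  fderiv ℝ (dual f) μ (Pi.single i 1)

theorem fderiv_dual_apply (μ v : Fin n → ℝ) :
    fderiv ℝ (dual f) μ v = ∑ i, dualGrad f μ i * v i := by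
  have : v = ∑ i, v i • (Pi.single i (1 : ℝ) : Fin n → ℝ) := by
    ext j; simp [Finset.sum_apply, Pi.single_apply]
  conv_lhs => rw [this]
  simp [dualGrad, mul_comm]

theorem hasDerivAt_dual_line (hf : IsAdmissible f) {μ : Fin n → ℝ} (hμ : μ ∈ positiveCone n)
    (v : Fin n → ℝ) :
    HasDerivAt (fun t : ℝ => dual f (μ + t • v)) (∑ i, dualGrad f μ i * v i) 0 := by
  have h1 : HasDerivAt (fun t : ℝ => μ + t • v) v 0 := by
    simpa using ((hasDerivAt_id (0 : ℝ)).smul_const v).const_add μ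
  have h2 := (differentiableAt_dual hf hμ).hasFDerivAt
  rw [← fderiv_dual_apply]
  have h3 : HasFDerivAt (dual f) (fderiv ℝ (dual f) μ) (μ + (0 : ℝ) • v) := by simpa using h2
  exact h3.comp_hasDerivAt (0 : ℝ) h1

theorem nonneg_of_hasDerivAt_of_le {φ : ℝ → ℝ} {d c : ℝ} (h : HasDerivAt φ d 0)
    (hle : ∀ᶠ t in 𝓝[>] (0 : ℝ), φ 0 + c * t ≤ φ t) : c ≤ d := by
  have h1 := (hasDerivAt_iff_tendsto_slope.1 h).mono_left
    (nhdsWithin_mono (0 : ℝ) (show Ioi (0 : ℝ) ⊆ {0}ᶜ from fun x hx => ne_of_gt hx))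
  refine ge_of_tendsto h1 ?_
  filter_upwards [hle, self_mem_nhdsWithin] with t ht (ht0 : 0 < t)
  rw [slope_def_field, sub_zero, le_div_iff₀ ht0]
  linarith

theorem dualGrad_nonneg (hf : IsAdmissible f) {μ : Fin n → ℝ} (hμ : μ ∈ positiveCone n)
    (i : Fin n) : 0 ≤ dualGrad f μ i := by
  have h := hasDerivAt_dual_line hf hμ (Pi.single i 1)
  have e : ∑ j, dualGrad f μ j * (Pi.single i (1 : ℝ) : Fin n → ℝ) j = dualGrad f μ i := by
    simp [Pi.single_apply]
  rw [e] at h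
  refine nonneg_of_hasDerivAt_of_le h ?_
  filter_upwards [self_mem_nhdsWithin] with t (ht : 0 < t)
  have hle : μ ≤ μ + t • (Pi.single i (1 : ℝ) : Fin n → ℝ) := by
    intro j
    by_cases hj : j = i
    · subst hj; simp [ht.le]
    · simp [hj]
  simpa using dual_mono hf hμ (fun j => (hμ j).trans_le (hle j)) hle

theorem sum_dualGrad_mul (hf : IsAdmissible f) {μ : Fin n → ℝ} (hμ : μ ∈ positiveCone n) :
    ∑ i, dualGrad f μ i * μ i = dual f μ := by
  have h := hasDerivAt_dual_line hf hμ μ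
  have h2 : HasDerivAt (fun t : ℝ => (1 + t) * dual f μ) (dual f μ) 0 := by
    simpa using ((hasDerivAt_id (0 : ℝ)).const_add 1).mul_const (dual f μ)
  refine h.unique (h2.congr_of_eventuallyEq ?_)
  filter_upwards [lt_mem_nhds (show (-1 : ℝ) < 0 by norm_num)] with t ht
  rw [← dual_smul hf (by linarith) hμ, add_smul, one_smul]

theorem dual_le_tangent (hf : IsAdmissible f) (hfc : IsInverseConcave f) {μ ν : Fin n → ℝ}
    (hμ : μ ∈ positiveCone n) (hν : ν ∈ positiveCone n) :
    dual f ν ≤ dual f μ + ∑ i, dualGrad f μ i * (ν i - μ i) := by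
  have h := hasDerivAt_dual_line hf hμ (ν - μ)
  have key : dual f ν - dual f μ ≤ ∑ i, dualGrad f μ i * (ν - μ) i := by
    refine nonneg_of_hasDerivAt_of_le h ?_
    have h1 : ∀ᶠ t in 𝓝[>] (0 : ℝ), t < 1 :=
      mem_nhdsWithin_of_mem_nhds (gt_mem_nhds one_pos)
    filter_upwards [self_mem_nhdsWithin, h1] with t (ht : 0 < t) ht1
    have := hfc.2 hμ hν (sub_nonneg.2 ht1.le) ht.le (by ring)
    have e : μ + t • (ν - μ) = (1 - t) • μ + t • ν := by
      ext i; simp; ring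
    rw [e]
    simp only [smul_eq_mul] at this
    simp only [zero_smul, add_zero]
    linarith
  simp only [Pi.sub_apply] at key
  linarith

end Dual

/-! ### Orthonormal frames of hyperplanes -/

section Frames

variable {n : ℕ}

theorem inner_expand_frame {e : Fin n → Ambient n} {z : Ambient n} (he : Orthonormal ℝ e)
    (hz : ‖z‖ = 1) (hez : ∀ i, inner ℝ (e i) z = 0) (v w : Ambient n) :
    inner ℝ v w = inner ℝ z v * inner ℝ z w + ∑ i, inner ℝ (e i) v * inner ℝ (e i) w := by
  have ho : Orthonormal ℝ (Fin.cons z e : Fin (n + 1) → Ambient n) := by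
    rw [orthonormal_iff_ite]
    rw [orthonormal_iff_ite] at he
    intro i j
    refine Fin.cases ?_ (fun i => ?_) i <;> refine Fin.cases ?_ (fun j => ?_) j
    · simp [hz]
    · simpa [(Fin.succ_ne_zero _).symm] using (real_inner_comm z (e j)).symm.trans (hez j)
    · simp [hez, Fin.succ_ne_zero]
    · simp [he]
  have hc : Fintype.card (Fin (n + 1)) = Module.finrank ℝ (Ambient n) := by simp
  let b := basisOfOrthonormalOfCardEqFinrank ho hc
  let B : OrthonormalBasis (Fin (n + 1)) ℝ (Ambient n) :=
    b.toOrthonormalBasis (by simpa [b] using ho)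
  have hB : ∀ i, B i = (Fin.cons z e : Fin (n + 1) → Ambient n) i := by
    intro i; simp [B, b]
  have := B.sum_inner_mul_inner v w
  rw [← this, Fin.sum_univ_succ]
  simp only [hB, Fin.cons_zero, Fin.cons_succ]
  congr 1
  · rw [real_inner_comm]
  · exact Finset.sum_congr rfl fun i _ => by rw [real_inner_comm]

theorem expand_frame {e : Fin n → Ambient n} {z : Ambient n} (he : Orthonormal ℝ e)
    (hz : ‖z‖ = 1) (hez : ∀ i, inner ℝ (e i) z = 0) (v : Ambient n) :
    v = inner ℝ z v • z + ∑ i, inner ℝ (e i) v • e i := by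
  refine ext_inner_right ℝ fun w => ?_
  rw [inner_expand_frame he hz hez v w, inner_add_left, sum_inner, inner_smul_left]
  simp [inner_smul_left]

/-- The Schur–Horn principle: a symmetric form with eigenvalues `μ` in the frame `e` has in the
frame `g` the diagonal entries `S μ`, where `S i j = ⟨e j, g i⟩²` is doubly stochastic. This
transfers concavity in the eigenvalues to diagonal entries in arbitrary orthonormal frames. -/
theorem dual_le_dual_frame {f : (Fin n → ℝ) → ℝ} (hf : IsAdmissible f)
    (hfc : IsInverseConcave f) {e g : Fin n → Ambient n} {z : Ambient n} (he : Orthonormal ℝ e)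
    (hg : Orthonormal ℝ g) (hz : ‖z‖ = 1) (hez : ∀ i, inner ℝ (e i) z = 0)
    (hgz : ∀ i, inner ℝ (g i) z = 0) {μ : Fin n → ℝ} (hμ : μ ∈ positiveCone n) :
    (fun i => ∑ j, μ j * inner ℝ (e j) (g i) ^ 2) ∈ positiveCone n ∧
    dual f μ ≤ dual f fun i => ∑ j, μ j * inner ℝ (e j) (g i) ^ 2 := by
  let S : Matrix (Fin n) (Fin n) ℝ := fun i j => inner ℝ (e j) (g i) ^ 2
  have hrow : ∀ i, ∑ j, S i j = 1 := by
    intro i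
    have := inner_expand_frame he hz hez (g i) (g i)
    rw [(real_inner_comm _ _).trans (hgz i), real_inner_self_eq_norm_sq, hg.1 i] at this
    simp only [S, sq]
    linarith
  have hcol : ∀ j, ∑ i, S i j = 1 := by
    intro j
    have := inner_expand_frame hg hz hgz (e j) (e j)
    rw [(real_inner_comm _ _).trans (hez j), real_inner_self_eq_norm_sq, he.1 j] at this
    simp only [S, sq, real_inner_comm (g _) (e j)] at this ⊢
    linarith
  have hS : S ∈ doublyStochastic ℝ (Fin n) := by
    rw [mem_doublyStochastic_iff_sum]
    exact ⟨fun i j => sq_nonneg _, hrow, hcol⟩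
  have e1 : (fun i => ∑ j, μ j * inner ℝ (e j) (g i) ^ 2) = S.mulVec μ := by
    ext i
    simp only [Matrix.mulVec, dotProduct, S]
    exact Finset.sum_congr rfl fun j _ => mul_comm _ _
  refine ⟨fun i => ?_, ?_⟩
  · by_contra! h
    have h0 : ∀ j ∈ Finset.univ, 0 ≤ μ j * inner ℝ (e j) (g i) ^ 2 :=
      fun j _ => mul_nonneg (hμ j).le (sq_nonneg _)
    have h1 := (Finset.sum_eq_zero_iff_of_nonneg h0).1 (le_antisymm h (Finset.sum_nonneg h0))
    have h2 : ∑ j, S i j = 0 := Finset.sum_eq_zero fun j hj => by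
      rcases mul_eq_zero.1 (h1 j hj) with h | h
      · exact absurd h (hμ j).ne'
      · exact h
    rw [hrow i] at h2
    exact one_ne_zero h2
  · rw [e1]
    exact le_map_doublyStochastic_mulVec hfc positiveCone_comp (dual_comp_perm hf) hS hμ

end Frames

/-! ### Second order jets of functions of one real variable -/

/-- `φ(τ) = a + b τ + c τ² + o(τ²)` as `τ → 0`. -/
def HasJet (φ : ℝ → ℝ) (a b c : ℝ) : Prop :=
  (fun τ => φ τ - (a + b * τ + c * τ ^ 2)) =o[𝓝 0] fun τ : ℝ => τ ^ 2

theorem isLittleO_pow_three : (fun τ : ℝ => τ ^ 3) =o[𝓝 0] fun τ : ℝ => τ ^ 2 :=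
  Asymptotics.isLittleO_pow_pow (by norm_num)

theorem HasJet.isBigO_sub {φ : ℝ → ℝ} {a b c : ℝ} (h : HasJet φ a b c) :
    (fun τ => φ τ - a) =O[𝓝 0] fun τ : ℝ => τ := by
  have h2 : (fun τ : ℝ => τ ^ 2) =O[𝓝 0] fun τ : ℝ => τ := by
    simpa using (Asymptotics.isLittleO_pow_pow (𝕜 := ℝ) (show 1 < 2 by norm_num)).isBigO
  have h1 : (fun τ : ℝ => b * τ + c * τ ^ 2) =O[𝓝 0] fun τ : ℝ => τ :=
    ((Asymptotics.isBigO_refl _ _).const_mul_left b).add (h2.const_mul_left c)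
  refine ((h.isBigO.trans h2).add h1).congr_left fun τ => by ring

theorem HasJet.congr {φ ψ : ℝ → ℝ} {a b c : ℝ} (h : HasJet φ a b c) (he : ψ =ᶠ[𝓝 0] φ) :
    HasJet ψ a b c :=
  Asymptotics.IsLittleO.congr' h (he.mono fun τ hτ => by simp [hτ]) EventuallyEq.rfl

theorem HasJet.coeff {φ : ℝ → ℝ} {a b c a' b' c' : ℝ} (h : HasJet φ a b c) (ha : a = a')
    (hb : b = b') (hc : c = c') : HasJet φ a' b' c' := by
  subst ha hb hc; exact h

theorem HasJet.of_quadratic (a b c : ℝ) : HasJet (fun τ => a + b * τ + c * τ ^ 2) a b c := by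
  simp [HasJet]

theorem HasJet.const (a : ℝ) : HasJet (fun _ => a) a 0 0 := by
  simp [HasJet]

theorem HasJet.id : HasJet (fun τ => τ) 0 1 0 := by
  simp [HasJet]

theorem HasJet.sq : HasJet (fun τ => τ ^ 2) 0 0 1 := by
  simp [HasJet]

theorem HasJet.add {φ ψ : ℝ → ℝ} {a b c a' b' c' : ℝ} (h : HasJet φ a b c)
    (h' : HasJet ψ a' b' c') : HasJet (fun τ => φ τ + ψ τ) (a + a') (b + b') (c + c') :=
  (Asymptotics.IsLittleO.add h h').congr_left fun τ => by ring

theorem HasJet.const_mul {φ : ℝ → ℝ} {a b c : ℝ} (k : ℝ) (h : HasJet φ a b c) :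
    HasJet (fun τ => k * φ τ) (k * a) (k * b) (k * c) :=
  (Asymptotics.IsLittleO.const_mul_left h k).congr_left fun τ => by ring

theorem HasJet.sub {φ ψ : ℝ → ℝ} {a b c a' b' c' : ℝ} (h : HasJet φ a b c)
    (h' : HasJet ψ a' b' c') : HasJet (fun τ => φ τ - ψ τ) (a - a') (b - b') (c - c') :=
  (Asymptotics.IsLittleO.sub h h').congr_left fun τ => by ring

theorem HasJet.sum {ι : Type*} (s : Finset ι) {φ : ι → ℝ → ℝ} {a b c : ι → ℝ}
    (h : ∀ i ∈ s, HasJet (φ i) (a i) (b i) (c i)) :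
    HasJet (fun τ => ∑ i ∈ s, φ i τ) (∑ i ∈ s, a i) (∑ i ∈ s, b i) (∑ i ∈ s, c i) := by
  refine (Asymptotics.IsLittleO.sum h).congr_left fun τ => ?_
  simp only [Finset.sum_apply, Finset.sum_sub_distrib, Finset.sum_add_distrib, Finset.sum_mul]

theorem HasJet.tendsto {φ : ℝ → ℝ} {a b c : ℝ} (h : HasJet φ a b c) :
    Tendsto φ (𝓝 0) (𝓝 a) := by
  have h1 : Tendsto (fun τ => φ τ - a) (𝓝 0) (𝓝 0) := h.isBigO_sub.trans_tendsto tendsto_id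
  simpa using h1.add_const a

theorem HasJet.apply_zero {φ : ℝ → ℝ} {a b c : ℝ} (h : HasJet φ a b c) : φ 0 = a := by
  obtain ⟨C, hC⟩ := h.isBigO_sub.bound
  have := hC.self_of_nhds
  simp only [norm_zero, mul_zero, norm_le_zero_iff] at this
  linarith

theorem HasJet.mul {φ ψ : ℝ → ℝ} {a b c a' b' c' : ℝ} (h : HasJet φ a b c)
    (h' : HasJet ψ a' b' c') : HasJet (fun τ => φ τ * ψ τ) (a * a') (a * b' + b * a')
      (a * c' + b * b' + c * a') := by
  have hb : ψ =O[𝓝 0] fun _ => (1 : ℝ) := h'.tendsto.isBigO_one ℝ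
  have hp : (fun τ : ℝ => a + b * τ + c * τ ^ 2) =O[𝓝 0] fun _ => (1 : ℝ) := by
    refine Tendsto.isBigO_one ℝ (c := a) ?_
    have : Continuous fun τ : ℝ => a + b * τ + c * τ ^ 2 := by fun_prop
    simpa using this.tendsto 0
  have h1 := Asymptotics.IsLittleO.mul_isBigO h hb
  have h2 := hp.mul_isLittleO h'
  have h3 := (isLittleO_pow_three.const_mul_left (b * c' + c * b'))
  have h4 := ((Asymptotics.isLittleO_pow_pow (𝕜 := ℝ) (show 2 < 4 by norm_num)).const_mul_left
    (c * c'))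
  simp only [one_mul, mul_one] at h1 h2
  refine (((h1.add h2).add h3).add h4).congr_left fun τ => by ring

/-- First and second derivative tests at a minimum, for functions known only through their
expansion. Every spatial derivative identity or inequality for the flow is extracted this way. -/
theorem HasJet.nonneg_coeff {φ : ℝ → ℝ} {b c : ℝ} (h : HasJet φ 0 b c)
    (h0 : ∀ᶠ τ in 𝓝 0, 0 ≤ φ τ) : b = 0 ∧ 0 ≤ c := by
  have hlin : ∀ ε > 0, ∀ᶠ τ in 𝓝 (0 : ℝ), -(ε * τ ^ 2) ≤ b * τ + c * τ ^ 2 := by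
    intro ε hε
    filter_upwards [h.bound hε, h0] with τ hτ h0τ
    rw [Real.norm_eq_abs, Real.norm_eq_abs, abs_of_nonneg (sq_nonneg τ)] at hτ
    have := (abs_le.1 hτ).2
    linarith
  have hb : b = 0 := by
    have h1 := hlin 1 one_pos
    have hd : HasDerivAt (fun τ : ℝ => b * τ + (c + 1) * τ ^ 2) b 0 := by
      have := ((hasDerivAt_id (0 : ℝ)).const_mul b).add
        (((hasDerivAt_id (0 : ℝ)).pow 2).const_mul (c + 1))
      simpa using! this
    have hm : IsLocalMin (fun τ : ℝ => b * τ + (c + 1) * τ ^ 2) 0 := by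
      filter_upwards [h1] with τ hτ
      simp only [mul_zero, ne_eq, OfNat.ofNat_ne_zero, not_false_eq_true, zero_pow, add_zero]
      nlinarith
    exact hm.hasDerivAt_eq_zero hd
  refine ⟨hb, ?_⟩
  by_contra! hc
  have h1 := hlin (-c / 2) (by linarith)
  subst hb
  obtain ⟨δ, hδ, hδ'⟩ := Metric.eventually_nhds_iff.1 h1
  have := @hδ' (δ / 2) (by rw [Real.dist_eq, sub_zero, abs_of_pos] <;> linarith)
  nlinarith [mul_pos (neg_pos.2 hc) (mul_pos hδ hδ)]

theorem HasJet.unique {φ : ℝ → ℝ} {a b c a' b' c' : ℝ} (h : HasJet φ a b c)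
    (h' : HasJet φ a' b' c') : a = a' ∧ b = b' ∧ c = c' := by
  have ha : a = a' := h.apply_zero.symm.trans h'.apply_zero
  have h1 := (h.sub h').coeff (sub_eq_zero.2 ha) rfl rfl
  have h2 := (h'.sub h).coeff (sub_eq_zero.2 ha.symm) rfl rfl
  obtain ⟨h3, h4⟩ := h1.nonneg_coeff (by simp)
  obtain ⟨-, h5⟩ := h2.nonneg_coeff (by simp)
  exact ⟨ha, by linarith, by linarith⟩

/-- The remainder has derivative `o(τ)`, so the mean value inequality on `[0, τ]` makes it `o(τ²)`;
the second derivative is needed at `0` only. -/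
theorem hasJet_of_hasDerivAt {φ φ' : ℝ → ℝ} {c : ℝ}
    (h : ∀ᶠ τ in 𝓝 0, HasDerivAt φ (φ' τ) τ) (h' : HasDerivAt φ' c 0) :
    HasJet φ (φ 0) (φ' 0) (c / 2) := by
  rw [HasJet, Asymptotics.isLittleO_iff]
  intro ε hε
  have h2 := (hasDerivAt_iff_isLittleO.1 h').bound hε
  obtain ⟨δ, hδ, hδ'⟩ := Metric.eventually_nhds_iff_ball.1 (h.and h2)
  filter_upwards [Metric.ball_mem_nhds (0 : ℝ) hδ] with τ hτ
  have hsub : segment ℝ 0 τ ⊆ Metric.ball 0 δ :=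
    (convex_ball (0 : ℝ) δ).segment_subset (Metric.mem_ball_self hδ) hτ
  have key := Convex.norm_image_sub_le_of_norm_hasDerivWithin_le
    (f := fun s => φ s - (φ 0 + φ' 0 * s + c / 2 * s ^ 2))
    (f' := fun s => φ' s - (φ' 0 + c * s)) (s := segment ℝ 0 τ) (C := ε * |τ|)
    (x := 0) (y := τ) ?_ ?_ (convex_segment _ _) (left_mem_segment _ _ _)
    (right_mem_segment _ _ _)
  · simp only [Real.norm_eq_abs, sub_zero] at key ⊢
    rw [abs_of_nonneg (sq_nonneg τ)]
    refine le_trans (le_of_eq ?_) (key.trans (le_of_eq (by rw [← sq_abs τ]; ring)))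
    congr 1; ring
  · intro s hs
    have h3 := (hδ' s (hsub hs)).1
    have h4 : HasDerivAt (fun s : ℝ => φ 0 + φ' 0 * s + c / 2 * s ^ 2) (φ' 0 + c * s) s := by
      have := (((hasDerivAt_id s).const_mul (φ' 0)).const_add (φ 0)).add
        (((hasDerivAt_id s).pow 2).const_mul (c / 2))
      refine (this.congr_deriv ?_)
      simp; ring
    exact (h3.sub h4).hasDerivWithinAt
  · intro s hs
    have h3 := (hδ' s (hsub hs)).2
    simp only [sub_zero, smul_eq_mul, Real.norm_eq_abs] at h3 ⊢
    have h5 : |s| ≤ |τ| := by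
      rw [segment_eq_uIcc, mem_uIcc] at hs
      rcases hs with hs | hs
      · rw [abs_of_nonneg hs.1, abs_of_nonneg (hs.1.trans hs.2)]; exact hs.2
      · rw [abs_of_nonpos hs.2, abs_of_nonpos (hs.1.trans hs.2)]; linarith [hs.1]
    refine le_trans (le_of_eq ?_) (h3.trans (mul_le_mul_of_nonneg_left h5 hε.le))
    congr 1; ring

theorem HasJet.comp {φ g g' : ℝ → ℝ} {a b c d : ℝ} (h : HasJet φ a b c)
    (hg : ∀ᶠ s in 𝓝 a, HasDerivAt g (g' s) s) (hg' : HasDerivAt g' d a) :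
    HasJet (fun τ => g (φ τ)) (g a) (g' a * b) (g' a * c + d / 2 * b ^ 2) := by
  have hG : HasJet (fun s => g (a + s)) (g a) (g' a) (d / 2) := by
    have ht : Tendsto (fun s : ℝ => a + s) (𝓝 0) (𝓝 a) := by
      have : Continuous fun s : ℝ => a + s := by fun_prop
      simpa using this.tendsto 0
    have := hasJet_of_hasDerivAt (φ := fun s => g (a + s)) (φ' := fun s => g' (a + s)) (c := d)
      ((ht.eventually hg).mono fun s hs => by simpa using hs.comp_const_add a s)
      (by
        have h0 : HasDerivAt g' d (a + 0) := by simpa using hg'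
        simpa using h0.comp_const_add a 0)
    simpa using this
  have ht : Tendsto (fun τ => φ τ - a) (𝓝 0) (𝓝 0) := h.isBigO_sub.trans_tendsto tendsto_id
  have h1 := (Asymptotics.IsLittleO.comp_tendsto hG ht).trans_isBigO (h.isBigO_sub.pow 2)
  have hj : HasJet (fun τ => φ τ - a) 0 b c := (h.sub (HasJet.const a)).coeff (by ring) (by ring)
    (by ring)
  have h2 := (((hj.const_mul (g' a)).add ((hj.mul hj).const_mul (d / 2))).add (HasJet.const (g a)))
  have h3 : HasJet (fun τ => g (φ τ) - (g a + g' a * (φ τ - a) + d / 2 * (φ τ - a) ^ 2)) 0 0 0 := by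
    refine h1.congr_left fun τ => ?_
    simp
  refine ((h3.add h2).congr (Eventually.of_forall fun τ => ?_)).coeff ?_ ?_ ?_ <;> ring

theorem HasJet.inv {φ : ℝ → ℝ} {a b c : ℝ} (h : HasJet φ a b c) (ha : a ≠ 0) :
    HasJet (fun τ => (φ τ)⁻¹) a⁻¹ (-b / a ^ 2) (-c / a ^ 2 + b ^ 2 / a ^ 3) := by
  have hd : HasDerivAt (fun s : ℝ => -(s ^ 2)⁻¹) (2 / a ^ 3) a := by
    have := ((hasDerivAt_id a).pow 2).inv (by simpa using ha)
    refine (this.neg).congr_deriv ?_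
    simp; field_simp
  refine (h.comp (g := fun s => s⁻¹) (g' := fun s => -(s ^ 2)⁻¹) (d := 2 / a ^ 3) ?_ hd).coeff
    rfl ?_ ?_
  · filter_upwards [isOpen_ne.mem_nhds ha] with s hs using hasDerivAt_inv hs
  · field_simp
  · field_simp

/-! ### Iterated directional derivatives -/

section DirDeriv

variable {W : Type*} [NormedAddCommGroup W] [NormedSpace ℝ W]

/-- The derivative of `g` in the direction `v`. -/
def dirDeriv (v : W) (g : W → ℝ) (p : W) : ℝ := fderiv ℝ g p v

theorem dirDeriv_contDiffAt {g : W → ℝ} {p : W} (hg : ContDiffAt ℝ ∞ g p) (v : W) :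
    ContDiffAt ℝ ∞ (dirDeriv v g) p :=
  (hg.fderiv_right (m := ∞) (by simp)).clm_apply contDiffAt_const

theorem dirDeriv_differentiableAt {g : W → ℝ} {p : W} (hg : ContDiffAt ℝ 2 g p) (v : W) :
    DifferentiableAt ℝ (dirDeriv v g) p :=
  ((hg.fderiv_right (m := 1) (by norm_num)).clm_apply contDiffAt_const).differentiableAt (by simp)

theorem dirDeriv_congr {g g' : W → ℝ} {p : W} (h : g =ᶠ[𝓝 p] g') (v : W) :
    dirDeriv v g =ᶠ[𝓝 p] dirDeriv v g' :=
  (h.fderiv (𝕜 := ℝ)).mono fun q hq => by simp [dirDeriv, hq]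

theorem dirDeriv_comm {g : W → ℝ} {p : W} (hg : ContDiffAt ℝ 2 g p) (v w : W) :
    dirDeriv v (dirDeriv w g) p = dirDeriv w (dirDeriv v g) p := by
  have hs := hg.isSymmSndFDerivAt (by simp)
  have hd : DifferentiableAt ℝ (fderiv ℝ g) p :=
    (hg.fderiv_right (m := 1) (by norm_num)).differentiableAt (by simp)
  have h : ∀ v w : W, dirDeriv v (dirDeriv w g) p = fderiv ℝ (fderiv ℝ g) p v w := by
    intro v w
    unfold dirDeriv
    rw [fderiv_clm_apply hd (differentiableAt_const w)]
    simp
  rw [h, h, hs]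

theorem dirDeriv_comm_eventually {g : W → ℝ} {p : W} (hg : ContDiffAt ℝ ∞ g p) (v w : W) :
    dirDeriv v (dirDeriv w g) =ᶠ[𝓝 p] dirDeriv w (dirDeriv v g) := by
  have h2 : ContDiffAt ℝ 2 g p := hg.of_le (by norm_cast)
  filter_upwards [h2.eventually (by simp)] with q hq using dirDeriv_comm hq v w

theorem tendsto_line (p v : W) : Tendsto (fun τ : ℝ => p + τ • v) (𝓝 0) (𝓝 p) := by
  have : Continuous fun τ : ℝ => p + τ • v := by fun_prop
  simpa using this.tendsto 0

theorem hasDerivAt_line {g : W → ℝ} {p v : W} {τ : ℝ} (hg : DifferentiableAt ℝ g (p + τ • v)) :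
    HasDerivAt (fun s : ℝ => g (p + s • v)) (dirDeriv v g (p + τ • v)) τ := by
  have h1 : HasDerivAt (fun s : ℝ => p + s • v) v τ := by
    simpa using ((hasDerivAt_id τ).smul_const v).const_add p
  exact hg.hasFDerivAt.comp_hasDerivAt τ h1

theorem hasJet_line {g : W → ℝ} {p : W} (hg : ContDiffAt ℝ 2 g p) (v : W) :
    HasJet (fun τ => g (p + τ • v)) (g p) (dirDeriv v g p) (dirDeriv v (dirDeriv v g) p / 2) := by
  have h1 : ∀ᶠ q in 𝓝 p, DifferentiableAt ℝ g q :=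
    (hg.eventually (by simp)).mono fun q hq => hq.differentiableAt (by simp)
  have h2 : HasDerivAt (fun s : ℝ => dirDeriv v g (p + s • v))
      (dirDeriv v (dirDeriv v g) p) 0 := by
    simpa using hasDerivAt_line (g := dirDeriv v g) (p := p) (v := v) (τ := 0)
      (by simpa using dirDeriv_differentiableAt hg v)
  simpa using hasJet_of_hasDerivAt (((tendsto_line p v).eventually h1).mono
    fun τ hτ => hasDerivAt_line hτ) h2

end DirDeriv

/-! ### The modulating function in terms of the inverse speed -/

/-- The structural conditions on `Φ(s) = -Ψ(1/s)`, with derivatives `Φ₁` and `Φ₂`. -/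
structure IsDualModulating (Φ Φ₁ Φ₂ : ℝ → ℝ) : Prop where
  hasDerivAt : ∀ s, 0 < s → HasDerivAt Φ (Φ₁ s) s
  hasDerivAt' : ∀ s, 0 < s → HasDerivAt Φ₁ (Φ₂ s) s
  pos : ∀ s, 0 < s → 0 < Φ₁ s
  mul_add_nonneg : ∀ s, 0 < s → 0 ≤ Φ₁ s * s + Φ s
  nonpos : ∀ s, 0 < s → Φ₂ s ≤ 0
  mul_add_two_nonneg : ∀ s, 0 < s → 0 ≤ Φ₂ s * s + 2 * Φ₁ s

theorem IsDualModulating.le_tangent {Φ Φ₁ Φ₂ : ℝ → ℝ} (h : IsDualModulating Φ Φ₁ Φ₂) {a b : ℝ}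
    (ha : 0 < a) (hb : 0 < b) : Φ b ≤ Φ a + Φ₁ a * (b - a) := by
  have hc : ConcaveOn ℝ (Ioi 0) Φ := by
    refine AntitoneOn.concaveOn_of_deriv (convex_Ioi 0)
      (fun s hs => (h.hasDerivAt s hs).continuousAt.continuousWithinAt)
      (fun s hs => (h.hasDerivAt s (by simpa using hs)).differentiableAt.differentiableWithinAt) ?_
    rw [interior_Ioi]
    have h1 : AntitoneOn Φ₁ (Ioi 0) := by
      refine antitoneOn_of_deriv_nonpos (convex_Ioi 0)
        (fun s hs => (h.hasDerivAt' s hs).continuousAt.continuousWithinAt)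
        (fun s hs => (h.hasDerivAt' s (by simpa using hs)).differentiableAt.differentiableWithinAt)
        fun s hs => ?_
      rw [interior_Ioi] at hs
      rw [(h.hasDerivAt' s hs).deriv]
      exact h.nonpos s hs
    exact h1.congr fun s hs => (h.hasDerivAt s hs).deriv.symm
  have hd := h.hasDerivAt a ha
  rcases lt_trichotomy a b with hab | rfl | hab
  · have := hc.slope_le_of_hasDerivAt ha hb hab hd
    rw [slope_def_field, div_le_iff₀ (by linarith)] at this
    linarith
  · simp
  · have := hc.le_slope_of_hasDerivAt hb ha hab hd
    rw [slope_def_field, le_div_iff₀ (by linarith)] at this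
    linarith

/-- Inversion of the variable exchanges the two second order conditions: `Ψ'' s + 2Ψ' ≥ 0` becomes
concavity of `Φ`, while `Ψ'' ≤ 0` becomes `Φ'' s + 2Φ' ≥ 0`. -/
theorem IsModulating.isDualModulating {Ψ : ℝ → ℝ} (h : IsModulating Ψ) :
    IsDualModulating (fun s => -Ψ s⁻¹) (fun s => deriv Ψ s⁻¹ * (s ^ 2)⁻¹)
      (fun s => -(deriv (deriv Ψ) s⁻¹ * (s ^ 4)⁻¹ + 2 * deriv Ψ s⁻¹ * (s ^ 3)⁻¹)) := by
  have hc : ∀ s, 0 < s → ContDiffAt ℝ 2 Ψ s := fun s hs => h.contDiff.contDiffAt (Ioi_mem_nhds hs)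
  have h1 : ∀ s, 0 < s → HasDerivAt Ψ (deriv Ψ s) s := fun s hs =>
    ((hc s hs).differentiableAt (by simp)).hasDerivAt
  have h2 : ∀ s, 0 < s → HasDerivAt (deriv Ψ) (deriv (deriv Ψ) s) s := by
    intro s hs
    have hd : ContDiffAt ℝ 1 (deriv Ψ) s := by
      have := ((hc s hs).fderiv_right (m := 1) (by norm_num)).clm_apply
        (contDiffAt_const (c := (1 : ℝ)))
      exact this
    exact (hd.differentiableAt (by simp)).hasDerivAt
  refine ⟨fun s hs => ?_, fun s hs => ?_, fun s hs => ?_, fun s hs => ?_, fun s hs => ?_,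
    fun s hs => ?_⟩
  · refine ((h1 s⁻¹ (inv_pos.2 hs)).comp s (hasDerivAt_inv hs.ne')).neg.congr_deriv ?_
    ring
  · refine (((h2 s⁻¹ (inv_pos.2 hs)).comp s (hasDerivAt_inv hs.ne')).mul
      (((hasDerivAt_id s).pow 2).inv (by simpa using hs.ne'))).congr_deriv ?_
    simp; field_simp; ring
  · exact mul_pos (h.deriv_pos _ (inv_pos.2 hs)) (by positivity)
  · have := h.deriv_mul_sub_nonneg _ (inv_pos.2 hs)
    refine this.trans (le_of_eq ?_)
    field_simp; ring
  · have := mul_nonneg (h.deriv2_mul_add_nonneg _ (inv_pos.2 hs)) (inv_pos.2 (pow_pos hs 3)).le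
    refine neg_nonpos.2 (this.trans (le_of_eq ?_))
    field_simp
  · have := mul_nonneg (neg_nonneg.2 (h.deriv2_nonpos _ (inv_pos.2 hs)))
      (inv_pos.2 (pow_pos hs 3)).le
    refine this.trans (le_of_eq ?_)
    field_simp; ring

/-! ### Local solutions in the Gauss map parametrization -/

section LocalSol

variable {n : ℕ}

/-- Second spatial derivative of a function on space-time. -/
def hess (h : Ambient n × ℝ → ℝ) (a b : Ambient n) (p : Ambient n × ℝ) : ℝ :=
  dirDeriv (a, 0) (dirDeriv (b, 0) h) p

theorem hess_eq {h : Ambient n × ℝ → ℝ} {p : Ambient n × ℝ} (hp : ContDiffAt ℝ 2 h p)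
    (a b : Ambient n) : hess h a b p = fderiv ℝ (fderiv ℝ h) p (a, 0) (b, 0) := by
  have hd : DifferentiableAt ℝ (fderiv ℝ h) p :=
    (hp.fderiv_right (m := 1) (by norm_num)).differentiableAt (by simp)
  unfold hess dirDeriv
  rw [fderiv_clm_apply hd (differentiableAt_const _)]
  simp

section
variable {h : Ambient n × ℝ → ℝ} {p : Ambient n × ℝ}

theorem hess_add_left (hp : ContDiffAt ℝ 2 h p) (a b c : Ambient n) :
    hess h (a + b) c p = hess h a c p + hess h b c p := by
  have : ((a + b, 0) : Ambient n × ℝ) = (a, 0) + (b, 0) := by simp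
  simp only [hess_eq hp, this, map_add, add_apply]

theorem hess_smul_left (hp : ContDiffAt ℝ 2 h p) (s : ℝ) (a c : Ambient n) :
    hess h (s • a) c p = s * hess h a c p := by
  have : ((s • a, 0) : Ambient n × ℝ) = s • (a, 0) := by simp
  simp only [hess_eq hp, this, map_smul, smul_apply, smul_eq_mul]

theorem hess_symm (hp : ContDiffAt ℝ 2 h p) (a b : Ambient n) :
    hess h a b p = hess h b a p := dirDeriv_comm hp _ _

theorem hess_add_right (hp : ContDiffAt ℝ 2 h p) (a b c : Ambient n) :
    hess h c (a + b) p = hess h c a p + hess h c b p := by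
  rw [hess_symm hp, hess_add_left hp, hess_symm hp a, hess_symm hp b]

theorem hess_smul_right (hp : ContDiffAt ℝ 2 h p) (s : ℝ) (a c : Ambient n) :
    hess h c (s • a) p = s * hess h c a p := by
  rw [hess_symm hp, hess_smul_left hp, hess_symm hp a]

theorem hess_sum_left (hp : ContDiffAt ℝ 2 h p) {ι : Type*} (s : Finset ι) (a : ι → Ambient n)
    (c : Ambient n) : hess h (∑ i ∈ s, a i) c p = ∑ i ∈ s, hess h (a i) c p := by
  have : ((∑ i ∈ s, a i, 0) : Ambient n × ℝ) = ∑ i ∈ s, (a i, (0 : ℝ)) := by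
    ext1 <;> simp [Prod.fst_sum, Prod.snd_sum]
  simp only [hess_eq hp, this, map_sum, sum_apply]

end

/-- A smooth strictly convex solution of the flow near a point, in terms of its (homogeneously
extended) support function `h` and its inverse speed `ρ`. -/
structure IsLocalSol (f : (Fin n → ℝ) → ℝ) (Φ : ℝ → ℝ) (h ρ : Ambient n × ℝ → ℝ)
    (z : Ambient n) (t₀ : ℝ) : Prop where
  norm_eq : ‖z‖ = 1
  smooth : ContDiffAt ℝ ∞ h (z, t₀)
  smooth' : ContDiffAt ℝ 2 ρ (z, t₀)
  flow : ∀ᶠ p in 𝓝 (z, t₀), dirDeriv (0, 1) h p = ‖p.1‖ * Φ (ρ p)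
  euler : ∀ᶠ p in 𝓝 (z, t₀), dirDeriv (p.1, 0) h p = h p
  frame : ∀ᶠ p in 𝓝 (z, t₀), ∃ (e : Fin n → Ambient n) (μ : Fin n → ℝ), Orthonormal ℝ e ∧
    (∀ i, inner ℝ (e i) p.1 = 0) ∧ μ ∈ positiveCone n ∧ ρ p = dual f μ ∧
    ∀ i a, hess h a (e i) p = μ i / ‖p.1‖ * inner ℝ (e i) a

variable {f : (Fin n → ℝ) → ℝ} {Φ Φ₁ Φ₂ : ℝ → ℝ} {h ρ : Ambient n × ℝ → ℝ} {z : Ambient n} {t₀ : ℝ}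

namespace IsLocalSol

theorem eventually_contDiffAt (S : IsLocalSol f Φ h ρ z t₀) :
    ∀ᶠ p in 𝓝 (z, t₀), ContDiffAt ℝ 2 h p :=
  (S.smooth.of_le (by norm_cast)).eventually (by simp)

/-- Differentiating Euler's relation `Dh(p)p = h(p)` shows that the radial direction is in the
kernel of the Hessian. -/
theorem hess_self_right (S : IsLocalSol f Φ h ρ z t₀) :
    ∀ᶠ p in 𝓝 (z, t₀), ∀ a, hess h a p.1 p = 0 := by
  filter_upwards [S.eventually_contDiffAt, S.euler.eventually_nhds] with p hp hep a
  have hd : DifferentiableAt ℝ (fderiv ℝ h) p :=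
    (hp.fderiv_right (m := 1) (by norm_num)).differentiableAt (by simp)
  let L : Ambient n × ℝ →L[ℝ] Ambient n × ℝ :=
    (ContinuousLinearMap.inl ℝ (Ambient n) ℝ).comp (ContinuousLinearMap.fst ℝ (Ambient n) ℝ)
  have h1 : HasFDerivAt (fun q : Ambient n × ℝ => fderiv ℝ h q (L q)) (fderiv ℝ h p) p := by
    refine HasFDerivAt.congr_of_eventuallyEq (hp.differentiableAt (by simp)).hasFDerivAt ?_
    filter_upwards [hep] with q hq
    simpa [dirDeriv, L] using hq
  have h2 := hd.hasFDerivAt.clm_apply (L.hasFDerivAt (x := p))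
  have h3 := DFunLike.congr_fun (h1.unique h2) (a, 0)
  rw [hess_eq hp]
  simp [L] at h3
  linarith

/-- Schur–Horn followed by the tangent plane inequality for the concave `f_*`. The right side is
affine in the Hessian entries of `h`, and with `G`, `μ` an eigenframe and its eigenvalues there is
equality. -/
theorem le_of_frame (hf : IsAdmissible f) (hfc : IsInverseConcave f)
    (S : IsLocalSol f Φ h ρ z t₀) :
    ∀ᶠ p in 𝓝 (z, t₀), ∀ G : Fin n → Ambient n, Orthonormal ℝ G →
      (∀ i, inner ℝ (G i) p.1 = 0) → ∀ μ ∈ positiveCone n,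
      ρ p ≤ dual f μ + ∑ i, dualGrad f μ i * (‖p.1‖ * hess h (G i) (G i) p - μ i) := by
  have hne : ∀ᶠ p : Ambient n × ℝ in 𝓝 (z, t₀), p.1 ≠ 0 := by
    have : z ≠ 0 := fun h0 => by simpa [h0] using S.norm_eq
    exact continuousAt_fst.eventually_ne this
  filter_upwards [S.frame, S.eventually_contDiffAt, hne] with p hp hcp hpn G hG hGp μ hμ
  obtain ⟨e, μ', he, hep, hμ', hρ, hh⟩ := hp
  have hp0 : ‖p.1‖ ≠ 0 := norm_ne_zero_iff.2 hpn
  set w := (‖p.1‖)⁻¹ • p.1 with hw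
  have hw1 : ‖w‖ = 1 := by rw [hw, norm_smul, norm_inv, norm_norm, inv_mul_cancel₀ hp0]
  have hew : ∀ i, inner ℝ (e i) w = 0 := fun i => by rw [hw, inner_smul_right, hep, mul_zero]
  have hGw : ∀ i, inner ℝ (G i) w = 0 := fun i => by rw [hw, inner_smul_right, hGp, mul_zero]
  obtain ⟨h1, h2⟩ := dual_le_dual_frame hf hfc he hG hw1 hew hGw hμ'
  rw [hρ]
  refine h2.trans ((dual_le_tangent hf hfc hμ h1).trans (le_of_eq ?_))
  congr 1
  refine Finset.sum_congr rfl fun i _ => ?_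
  congr 2
  have hexp := expand_frame he hw1 hew (G i)
  rw [(real_inner_comm _ _).trans (hGw i), zero_smul, zero_add] at hexp
  have : hess h (G i) (G i) p = ∑ j, inner ℝ (e j) (G i) * hess h (G i) (e j) p := by
    rw [hess_symm hcp]
    conv_lhs => rw [hexp]
    rw [← hexp]
    have h3 : hess h (∑ j, inner ℝ (e j) (G i) • e j) (G i) p
        = ∑ j, inner ℝ (e j) (G i) * hess h (G i) (e j) p := by
      rw [hess_sum_left hcp]
      refine Finset.sum_congr rfl fun j _ => ?_
      rw [hess_smul_left hcp, hess_symm hcp]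
    rw [← h3, ← hexp]
  rw [this, Finset.mul_sum]
  refine Finset.sum_congr rfl fun j _ => ?_
  rw [hh]
  field_simp

/-- The map is the reflection in the hyperplane orthogonal to `z + w`. On the complement of `z` it
agrees with the rotation in the plane of `z`, `w` taking `z` to `w`; used with `-z` in place of `z`,
it becomes the mirror exchanging `z` and `w`. -/
theorem orthonormal_transport {g : Fin n → Ambient n} {z w : Ambient n} (hg : Orthonormal ℝ g)
    (hz : ‖z‖ = 1) (hw : ‖w‖ = 1) (hgz : ∀ i, inner ℝ (g i) z = 0)
    (hzw : 1 + inner ℝ z w ≠ (0 : ℝ)) :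
    Orthonormal ℝ (fun i => g i - (inner ℝ (g i) w / (1 + inner ℝ z w)) • (z + w)) ∧
    ∀ i, inner ℝ (g i - (inner ℝ (g i) w / (1 + inner ℝ z w)) • (z + w)) w = 0 := by
  have hz2 : inner ℝ z z = (1 : ℝ) := by rw [real_inner_self_eq_norm_sq, hz]; norm_num
  have hw2 : inner ℝ w w = (1 : ℝ) := by rw [real_inner_self_eq_norm_sq, hw]; norm_num
  have hzg : ∀ i, inner ℝ z (g i) = 0 := fun i => (real_inner_comm _ _).trans (hgz i)
  constructor
  · rw [orthonormal_iff_ite] at hg ⊢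
    intro i j
    rw [← hg i j]
    simp only [inner_sub_left, inner_sub_right, inner_smul_left, inner_smul_right, inner_add_left,
      inner_add_right, hz2, hw2, hzg, hgz, real_inner_comm z w, real_inner_comm w (g _),
      RCLike.conj_to_real]
    rw [real_inner_comm (g j) w]
    field_simp
    ring
  · intro i
    simp only [inner_sub_left, inner_smul_left, inner_add_left, hw2, RCLike.conj_to_real]
    field_simp
    ring

/-- A fixed frame at `z` is rotated to the tangent space at `p`. Multiples of `p` do not affect the
Hessian, so the rotated vector may be replaced by `g i` minus a multiple of the fixed vector `z`. -/
theorem le_of_transport (hf : IsAdmissible f) (hfc : IsInverseConcave f)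
    (S : IsLocalSol f Φ h ρ z t₀) :
    ∀ᶠ p in 𝓝 (z, t₀), ∀ g : Fin n → Ambient n, Orthonormal ℝ g →
      (∀ i, inner ℝ (g i) z = 0) → ∀ μ ∈ positiveCone n,
      ρ p ≤ dual f μ + ∑ i, dualGrad f μ i * (‖p.1‖ *
        hess h (g i - (inner ℝ (g i) p.1 / (‖p.1‖ + inner ℝ z p.1)) • z)
          (g i - (inner ℝ (g i) p.1 / (‖p.1‖ + inner ℝ z p.1)) • z) p - μ i) := by
  have hpos : ∀ᶠ p : Ambient n × ℝ in 𝓝 (z, t₀), 0 < inner ℝ z p.1 := by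
    have hc : Continuous fun p : Ambient n × ℝ => inner ℝ z p.1 := by fun_prop
    refine hc.continuousAt.eventually (lt_mem_nhds ?_)
    simp [S.norm_eq]
  filter_upwards [S.le_of_frame hf hfc, S.hess_self_right, S.eventually_contDiffAt, hpos]
    with p h1 h2 h3 h4 g hg hgz μ hμ
  have hp0 : 0 < ‖p.1‖ := norm_pos_iff.2 fun h0 => by simp [h0] at h4
  set w := (‖p.1‖)⁻¹ • p.1 with hw
  have hpw : p.1 = ‖p.1‖ • w := by rw [hw, smul_smul, mul_inv_cancel₀ hp0.ne', one_smul]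
  have hw1 : ‖w‖ = 1 := by rw [hw, norm_smul, norm_inv, norm_norm, inv_mul_cancel₀ hp0.ne']
  have hzw : 0 < inner ℝ z w := by rw [hw, inner_smul_right]; positivity
  obtain ⟨h5, h6⟩ := orthonormal_transport hg S.norm_eq hw1 hgz (by positivity)
  refine (h1 _ h5 (fun i => by rw [hpw, inner_smul_right, h6, mul_zero]) μ hμ).trans (le_of_eq ?_)
  congr 1
  refine Finset.sum_congr rfl fun i _ => ?_
  congr 3
  have e1 : g i - (inner ℝ (g i) w / (1 + inner ℝ z w)) • (z + w)
      = (g i - (inner ℝ (g i) p.1 / (‖p.1‖ + inner ℝ z p.1)) • z)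
        + (-(inner ℝ (g i) w / (1 + inner ℝ z w)) * (‖p.1‖)⁻¹) • p.1 := by
    have e2 : inner ℝ (g i) p.1 / (‖p.1‖ + inner ℝ z p.1)
        = inner ℝ (g i) w / (1 + inner ℝ z w) := by
      rw [hw, inner_smul_right, inner_smul_right]
      field_simp
    rw [e2, mul_smul, ← hw, smul_add, neg_smul]
    abel
  rw [e1]
  have h2' : ∀ a, hess h p.1 a p = 0 := fun a => by rw [hess_symm h3, h2]
  rw [hess_add_left h3, hess_add_right h3, hess_smul_left h3, hess_smul_right h3, h2', h2]
  ring

end IsLocalSol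

end LocalSol

/-! ### Derivatives of the support function and of the inverse speed at the base point -/

section LocalSol

variable {n : ℕ} {f : (Fin n → ℝ) → ℝ} {Φ Φ₁ Φ₂ : ℝ → ℝ} {h ρ : Ambient n × ℝ → ℝ}
  {z : Ambient n} {t₀ : ℝ} {e : Fin n → Ambient n} {μ : Fin n → ℝ}

theorem hasJet_norm {z : Ambient n} (hz : ‖z‖ = 1) (a : Ambient n) :
    HasJet (fun τ => ‖z + τ • a‖) 1 (inner ℝ z a) ((‖a‖ ^ 2 - inner ℝ z a ^ 2) / 2) := by
  have h1 := HasJet.of_quadratic 1 (2 * inner ℝ z a) (‖a‖ ^ 2)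
  have hd : HasDerivAt (fun s : ℝ => 1 / (2 * √s)) (-1 / 4) 1 := by
    have := (((Real.hasDerivAt_sqrt (one_ne_zero)).const_mul 2).inv (by simp))
    simp only [one_div]
    refine this.congr_deriv ?_
    norm_num
  have h2 := (h1.comp (g := fun s => √s) (g' := fun s => 1 / (2 * √s)) (d := -1 / 4) ?_ hd)
  · refine (h2.congr (Eventually.of_forall fun τ => ?_)).coeff (by simp) (by simp) (by simp; ring)
    have h3 : 1 + 2 * inner ℝ z a * τ + ‖a‖ ^ 2 * τ ^ 2 = ‖z + τ • a‖ ^ 2 := by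
      rw [norm_add_sq_real, hz, norm_smul, inner_smul_right, Real.norm_eq_abs, mul_pow, sq_abs]
      ring
    beta_reduce
    rw [h3, Real.sqrt_sq (norm_nonneg _)]
  · filter_upwards [isOpen_ne.mem_nhds one_ne_zero] with s hs using Real.hasDerivAt_sqrt hs

/-- An eigenframe of the inverse shape operator at the base point. -/
structure IsEigenframe (f : (Fin n → ℝ) → ℝ) (h ρ : Ambient n × ℝ → ℝ) (z : Ambient n) (t₀ : ℝ)
    (e : Fin n → Ambient n) (μ : Fin n → ℝ) : Prop where
  orthonormal : Orthonormal ℝ e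
  inner_eq_zero : ∀ i, inner ℝ (e i) z = 0
  mem : μ ∈ positiveCone n
  eq_dual : ρ (z, t₀) = dual f μ
  hess_eq : ∀ i a, hess h a (e i) (z, t₀) = μ i * inner ℝ (e i) a

theorem IsLocalSol.exists_eigenframe (S : IsLocalSol f Φ h ρ z t₀) :
    ∃ e μ, IsEigenframe f h ρ z t₀ e μ := by
  obtain ⟨e, μ, h1, h2, h3, h4, h5⟩ := S.frame.self_of_nhds
  exact ⟨e, μ, h1, h2, h3, h4, by simpa [S.norm_eq] using h5⟩

theorem IsEigenframe.inner_eq_zero' (E : IsEigenframe f h ρ z t₀ e μ) (i : Fin n) :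
    inner ℝ z (e i) = 0 := (real_inner_comm _ _).trans (E.inner_eq_zero i)

theorem IsEigenframe.inner_self (E : IsEigenframe f h ρ z t₀ e μ) (i : Fin n) :
    inner ℝ (e i) (e i) = (1 : ℝ) := by
  rw [real_inner_self_eq_norm_sq, E.orthonormal.1 i]; norm_num

theorem IsEigenframe.hess_self (E : IsEigenframe f h ρ z t₀ e μ) (i : Fin n) :
    hess h (e i) (e i) (z, t₀) = μ i := by rw [E.hess_eq, E.inner_self, mul_one]

theorem IsEigenframe.sum_dualGrad_mul (hf : IsAdmissible f) (E : IsEigenframe f h ρ z t₀ e μ) :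
    ∑ i, dualGrad f μ i * μ i = ρ (z, t₀) := by
  rw [CurvatureFlow.sum_dualGrad_mul hf E.mem, E.eq_dual]

namespace IsLocalSol

theorem rho_pos (hf : IsAdmissible f) (S : IsLocalSol f Φ h ρ z t₀) : 0 < ρ (z, t₀) := by
  obtain ⟨e, μ, E⟩ := S.exists_eigenframe
  rw [E.eq_dual]
  exact dual_pos hf E.mem

theorem hess_contDiffAt (S : IsLocalSol f Φ h ρ z t₀) (a b : Ambient n) :
    ContDiffAt ℝ ∞ (hess h a b) (z, t₀) :=
  dirDeriv_contDiffAt (dirDeriv_contDiffAt S.smooth _) _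

theorem hasJet_hess (S : IsLocalSol f Φ h ρ z t₀) (a u v : Ambient n) :
    HasJet (fun τ => hess h u v (z + τ • a, t₀)) (hess h u v (z, t₀))
      (dirDeriv (a, 0) (hess h u v) (z, t₀)) (hess (hess h u v) a a (z, t₀) / 2) := by
  have := hasJet_line (g := hess h u v) (p := (z, t₀))
    ((S.hess_contDiffAt u v).of_le (by norm_cast)) ((a, 0) : Ambient n × ℝ)
  simpa using! this

theorem hasJet_rho (S : IsLocalSol f Φ h ρ z t₀) (a : Ambient n) :
    HasJet (fun τ => ρ (z + τ • a, t₀)) (ρ (z, t₀)) (dirDeriv (a, 0) ρ (z, t₀))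
      (hess ρ a a (z, t₀) / 2) := by
  simpa using! hasJet_line S.smooth' ((a, 0) : Ambient n × ℝ)

theorem tendsto_space (z a : Ambient n) (t₀ : ℝ) :
    Tendsto (fun τ : ℝ => (z + τ • a, t₀)) (𝓝 0) (𝓝 (z, t₀)) := by
  have : Continuous fun τ : ℝ => (z + τ • a, t₀) := by fun_prop
  simpa using this.tendsto 0

/-- The bound of `le_of_transport` touches `ρ` from above at `z`, so first derivatives agree. The
rotation contributes nothing at first order because `z` is in the kernel of the Hessian there; the
term `⟨z,a⟩ρ` comes from the factor `‖p‖`. -/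
theorem dirDeriv_rho (hf : IsAdmissible f) (hfc : IsInverseConcave f)
    (S : IsLocalSol f Φ h ρ z t₀) (E : IsEigenframe f h ρ z t₀ e μ) (a : Ambient n) :
    dirDeriv (a, 0) ρ (z, t₀) = ∑ i, dualGrad f μ i * dirDeriv (a, 0) (hess h (e i) (e i)) (z, t₀)
      + inner ℝ z a * ρ (z, t₀) := by
  have hz := S.norm_eq
  have hzz : inner ℝ z z = (1 : ℝ) := by rw [real_inner_self_eq_norm_sq, hz]; norm_num
  have hN := hasJet_norm hz a
  have hH0 : ∀ u, hess h u z (z, t₀) = 0 := fun u => S.hess_self_right.self_of_nhds u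
  have hden : HasJet (fun τ => ‖z + τ • a‖ + inner ℝ z (z + τ • a)) 2 _ _ :=
    (hN.add (HasJet.of_quadratic 1 (inner ℝ z a) 0)).congr (Eventually.of_forall fun τ => by
      simp only [inner_add_right, inner_smul_right, hzz]; ring) |>.coeff (by norm_num) rfl rfl
  have hc : ∀ i, HasJet (fun τ => inner ℝ (e i) (z + τ • a) *
      (‖z + τ • a‖ + inner ℝ z (z + τ • a))⁻¹) 0 (inner ℝ (e i) a * 2⁻¹) _ := fun i => by
    refine (((HasJet.of_quadratic 0 (inner ℝ (e i) a) 0).mul (hden.inv two_ne_zero)).congr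
      (Eventually.of_forall fun τ => ?_)).coeff (by ring) (by ring) rfl
    simp only [inner_add_right, inner_smul_right, E.inner_eq_zero]
    ring
  have hsum := HasJet.sum Finset.univ (fun i _ => ((hN.mul
    ((S.hasJet_hess a (e i) (e i)).add (((((hc i).mul (S.hasJet_hess a (e i) z)).const_mul (-2))).add
      (((hc i).mul (hc i)).mul (S.hasJet_hess a z z))))).sub (HasJet.const (μ i))).const_mul
        (dualGrad f μ i))
  have htot := ((HasJet.const (ρ (z, t₀))).add hsum).sub (S.hasJet_rho a)
  have hnn := (htot.coeff (a' := 0) ?_ rfl rfl).nonneg_coeff ?_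
  · have h1 := hnn.1
    simp only [hH0, E.hess_self] at h1
    have : ∑ i, dualGrad f μ i * dirDeriv (a, 0) (hess h (e i) (e i)) (z, t₀)
      + inner ℝ z a * ∑ i, dualGrad f μ i * μ i = dirDeriv (a, 0) ρ (z, t₀) := by
      rw [Finset.mul_sum, ← Finset.sum_add_distrib]
      rw [zero_add, sub_eq_zero] at h1
      rw [← h1]
      exact Finset.sum_congr rfl fun i _ => by ring
    rw [← this, E.sum_dualGrad_mul hf]
  · simp only [hH0, E.hess_self]
    simp
  · filter_upwards [(tendsto_space z a t₀).eventually (S.le_of_transport hf hfc),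
      (tendsto_space z a t₀).eventually S.eventually_contDiffAt] with τ h1 h2
    have h3 := h1 e E.orthonormal E.inner_eq_zero μ E.mem
    rw [← E.eq_dual] at h3
    rw [sub_nonneg]
    refine h3.trans (le_of_eq ?_)
    congr 1
    refine Finset.sum_congr rfl fun i _ => ?_
    congr 3
    rw [sub_eq_add_neg, ← neg_smul, hess_add_left h2, hess_add_right h2, hess_smul_left h2,
      hess_smul_right h2, hess_add_right h2, hess_smul_right h2, hess_symm h2 z]
    ring

theorem hasJet_flow (hΦ : IsDualModulating Φ Φ₁ Φ₂) (hf : IsAdmissible f)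
    (S : IsLocalSol f Φ h ρ z t₀) (a : Ambient n) :
    HasJet (fun τ => ‖z + τ • a‖ * Φ (ρ (z + τ • a, t₀))) (Φ (ρ (z, t₀)))
      (Φ₁ (ρ (z, t₀)) * dirDeriv (a, 0) ρ (z, t₀) + inner ℝ z a * Φ (ρ (z, t₀)))
      (Φ₁ (ρ (z, t₀)) * (hess ρ a a (z, t₀) / 2)
        + Φ₂ (ρ (z, t₀)) / 2 * dirDeriv (a, 0) ρ (z, t₀) ^ 2
        + inner ℝ z a * (Φ₁ (ρ (z, t₀)) * dirDeriv (a, 0) ρ (z, t₀))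
        + (‖a‖ ^ 2 - inner ℝ z a ^ 2) / 2 * Φ (ρ (z, t₀))) := by
  have hp := S.rho_pos hf
  refine ((hasJet_norm S.norm_eq a).mul ((S.hasJet_rho a).comp (g := Φ) (g' := Φ₁) ?_
    (hΦ.hasDerivAt' _ hp))).coeff (by ring) (by ring) (by ring)
  filter_upwards [lt_mem_nhds hp] with s hs using hΦ.hasDerivAt s hs

theorem hasJet_time (S : IsLocalSol f Φ h ρ z t₀) (a : Ambient n) :
    HasJet (fun τ => ‖z + τ • a‖ * Φ (ρ (z + τ • a, t₀))) (dirDeriv (0, 1) h (z, t₀))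
      (dirDeriv (a, 0) (dirDeriv (0, 1) h) (z, t₀))
      (hess (dirDeriv (0, 1) h) a a (z, t₀) / 2) := by
  have := hasJet_line (g := dirDeriv (0, 1) h) (p := (z, t₀))
    ((dirDeriv_contDiffAt S.smooth _).of_le (by norm_cast)) ((a, 0) : Ambient n × ℝ)
  refine HasJet.congr (by simpa using! this) ?_
  filter_upwards [(tendsto_space z a t₀).eventually S.flow] with τ hτ
  exact hτ.symm

theorem dirDeriv_time_dirDeriv (hΦ : IsDualModulating Φ Φ₁ Φ₂) (hf : IsAdmissible f)
    (S : IsLocalSol f Φ h ρ z t₀) (a : Ambient n) :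
    dirDeriv (0, 1) (dirDeriv (a, 0) h) (z, t₀)
      = Φ₁ (ρ (z, t₀)) * dirDeriv (a, 0) ρ (z, t₀) + inner ℝ z a * Φ (ρ (z, t₀)) := by
  rw [dirDeriv_comm (S.smooth.of_le (by norm_cast))]
  exact ((S.hasJet_time a).unique (S.hasJet_flow hΦ hf a)).2.1

/-- The second order coefficient of `‖p‖ Φ(ρ)` along `a`, after commuting derivatives. The zeroth
order term `Φ` is produced by the second derivative of the norm in a tangential direction. -/
theorem dirDeriv_time_hess (hΦ : IsDualModulating Φ Φ₁ Φ₂) (hf : IsAdmissible f)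
    (S : IsLocalSol f Φ h ρ z t₀) {a : Ambient n} (ha : ‖a‖ = 1) (haz : inner ℝ z a = 0) :
    dirDeriv (0, 1) (hess h a a) (z, t₀)
      = Φ (ρ (z, t₀)) + Φ₁ (ρ (z, t₀)) * hess ρ a a (z, t₀)
        + Φ₂ (ρ (z, t₀)) * dirDeriv (a, 0) ρ (z, t₀) ^ 2 := by
  have h1 : dirDeriv (0, 1) (hess h a a) (z, t₀) = hess (dirDeriv (0, 1) h) a a (z, t₀) := by
    unfold hess
    rw [dirDeriv_comm ((dirDeriv_contDiffAt S.smooth _).of_le (by norm_cast))]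
    exact (dirDeriv_congr (dirDeriv_comm_eventually S.smooth _ _) _).self_of_nhds
  have h2 := ((S.hasJet_time a).unique (S.hasJet_flow hΦ hf a)).2.2
  rw [haz, ha] at h2
  rw [h1]
  linarith

theorem tendsto_time (z : Ambient n) (t₀ : ℝ) :
    Tendsto (fun τ : ℝ => (z, t₀ + τ)) (𝓝 0) (𝓝 (z, t₀)) := by
  have : Continuous fun τ : ℝ => (z, t₀ + τ) := by fun_prop
  simpa using this.tendsto 0

theorem hasDerivAt_time {g : Ambient n × ℝ → ℝ} (hg : DifferentiableAt ℝ g (z, t₀)) :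
    HasDerivAt (fun s : ℝ => g (z, t₀ + s)) (dirDeriv (0, 1) g (z, t₀)) 0 := by
  simpa using hasDerivAt_line (g := g) (p := (z, t₀)) (v := ((0, 1) : Ambient n × ℝ)) (τ := 0)
    (by simpa using hg)

/-- With the normal fixed, the frame can stay fixed in time. The upper bound for `ρ` holds on both
sides of `t₀` and touches at `t₀`, so the inequality yields an equality of derivatives. -/
theorem dirDeriv_time_rho (hΦ : IsDualModulating Φ Φ₁ Φ₂) (hf : IsAdmissible f)
    (hfc : IsInverseConcave f) (S : IsLocalSol f Φ h ρ z t₀) (E : IsEigenframe f h ρ z t₀ e μ) :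
    dirDeriv (0, 1) ρ (z, t₀) = ∑ i, dualGrad f μ i * (Φ (ρ (z, t₀))
      + Φ₁ (ρ (z, t₀)) * hess ρ (e i) (e i) (z, t₀)
      + Φ₂ (ρ (z, t₀)) * dirDeriv (e i, 0) ρ (z, t₀) ^ 2) := by
  have hd : HasDerivAt (fun s => ρ (z, t₀) + ∑ i, dualGrad f μ i *
      (hess h (e i) (e i) (z, t₀ + s) - μ i) - ρ (z, t₀ + s))
      (∑ i, dualGrad f μ i * dirDeriv (0, 1) (hess h (e i) (e i)) (z, t₀)
        - dirDeriv (0, 1) ρ (z, t₀)) 0 := by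
    have h1 := HasDerivAt.fun_sum (u := Finset.univ) fun i _ => ((hasDerivAt_time
      ((S.hess_contDiffAt (e i) (e i)).differentiableAt (by simp))).sub_const (μ i)).const_mul
        (dualGrad f μ i)
    exact (h1.const_add (ρ (z, t₀))).sub (hasDerivAt_time (S.smooth'.differentiableAt (by simp)))
  have hmin : IsLocalMin (fun s => ρ (z, t₀) + ∑ i, dualGrad f μ i *
      (hess h (e i) (e i) (z, t₀ + s) - μ i) - ρ (z, t₀ + s)) 0 := by
    filter_upwards [(tendsto_time z t₀).eventually (S.le_of_frame hf hfc)] with s hs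
    have := hs e E.orthonormal E.inner_eq_zero μ E.mem
    rw [← E.eq_dual] at this
    simp only [S.norm_eq, one_mul] at this
    simp only [add_zero, E.hess_self, sub_self, mul_zero, Finset.sum_const_zero]
    linarith
  have := hmin.hasDerivAt_eq_zero hd
  rw [← sub_eq_zero.1 this]
  refine Finset.sum_congr rfl fun i _ => ?_
  rw [S.dirDeriv_time_hess hΦ hf (E.orthonormal.1 i) (E.inner_eq_zero' i)]

end IsLocalSol

end LocalSol

/-! ### First zeros of the two-point function at distinct normals -/

section OffDiagonal

variable {n : ℕ} {f : (Fin n → ℝ) → ℝ} {Φ Φ₁ Φ₂ : ℝ → ℝ}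

/-- The contribution of one principal direction, where `D = 1 - ⟨z,w⟩`, `w` stands for the component
`⟨eᵢ,w⟩`, and `r`, `R` are the first and second derivatives of `ρ`. The first order condition
expresses `r` through `m w`, so the second order condition gains `2 m w² / D`. This gain absorbs the
bad term `Φ2 r²`, because `m / K ≤ ρ` and `Φ2 ρ + 2 Φ1 ≥ 0`. -/
theorem off_diagonal_coeff {Φv Φ1 Φ2 K ρ D q R r w m T B μ : ℝ} (hK : 0 < K) (hD : 0 < D)
    (hq : 0 ≤ q) (hΦ1 : 0 < Φ1) (hΦ2 : Φ2 ≤ 0) (hΦ : 0 ≤ Φ2 * ρ + 2 * Φ1) (hm : m = K * ρ - μ)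
    (hm0 : 0 ≤ m) (hμ : 0 ≤ μ) (h1 : K * r * D = m * w)
    (h2 : 0 ≤ K * (R / 2 * D - r * (w + w) + ρ * (1 / 2 - (1 - w ^ 2 / D) + (1 - D) / 2))
      + T / 2 + μ * (1 - w ^ 2 / D) - B / 2) :
    q * (K * D * Φv + Φ1 * (K * ρ * D - T - 2 * μ + B)) ≤
      q * (K * D * (Φv + Φ1 * R + Φ2 * r ^ 2)) := by
  refine mul_le_mul_of_nonneg_left ?_ hq
  have hr : K * r = m * w / D := by field_simp; linarith
  have h3 : 2 * (m * w ^ 2 / D) + K * ρ * D - T - 2 * μ + B ≤ K * D * R := by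
    have e : K * (R / 2 * D - r * (w + w) + ρ * (1 / 2 - (1 - w ^ 2 / D) + (1 - D) / 2))
      + T / 2 + μ * (1 - w ^ 2 / D) - B / 2 = K * D * R / 2 - 2 * (K * r) * w
        + K * ρ * (w ^ 2 / D - D / 2) + T / 2 + μ * (1 - w ^ 2 / D) - B / 2 := by ring
    rw [e, hr] at h2
    have e2 : m * w ^ 2 / D = K * ρ * (w ^ 2 / D) - μ * (w ^ 2 / D) := by rw [hm]; ring
    have e3 : m * w / D * w = m * w ^ 2 / D := by ring
    nlinarith
  have h4 : 0 ≤ Φ1 * (2 * (m * w ^ 2 / D)) + Φ2 * (K * D * r ^ 2) := by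
    have e : Φ1 * (2 * (m * w ^ 2 / D)) + Φ2 * (K * D * r ^ 2)
        = (m * w ^ 2 / D) * (2 * Φ1 + Φ2 * (m / K)) := by
      have : r = m * w / (D * K) := by field_simp; linarith
      rw [this]; field_simp
    rw [e]
    refine mul_nonneg (by positivity) ?_
    have : m / K ≤ ρ := by rw [div_le_iff₀ hK]; linarith
    nlinarith
  have h5 := mul_le_mul_of_nonneg_left h3 hΦ1.le
  nlinarith

theorem tendsto_pair (z w a b : Ambient n) (t₀ : ℝ) :
    Tendsto (fun τ : ℝ => (z + τ • a, w + τ • b, t₀)) (𝓝 0) (𝓝 (z, w, t₀)) := by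
  have : Continuous fun τ : ℝ => (z + τ • a, w + τ • b, t₀) := by fun_prop
  simpa using this.tendsto 0

/-- The two-point function in the Gauss map parametrization. -/
def twoPoint (K : ℝ → ℝ) (h ρ h' : Ambient n × ℝ → ℝ) (q : Ambient n × Ambient n × ℝ) : ℝ :=
  K q.2.2 * ρ (q.1, q.2.2) * (‖q.2.1‖ - inner ℝ q.1 q.2.1 * ‖q.1‖⁻¹)
    + dirDeriv (q.2.1, 0) h (q.1, q.2.2) - h' (q.2.1, q.2.2)

theorem dirDeriv_add_smul (h : Ambient n × ℝ → ℝ) (p : Ambient n × ℝ) (a b : Ambient n) (τ : ℝ) :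
    dirDeriv (a + τ • b, 0) h p = dirDeriv (a, 0) h p + τ * dirDeriv (b, 0) h p := by
  have : ((a + τ • b, 0) : Ambient n × ℝ) = (a, 0) + τ • (b, 0) := by simp
  simp only [dirDeriv, this, map_add, map_smul, smul_eq_mul]

variable {h ρ h' ρ' : Ambient n × ℝ → ℝ} {z w : Ambient n} {t₀ : ℝ}

theorem hasJet_twoPoint (S : IsLocalSol f Φ h ρ z t₀) (S' : IsLocalSol f Φ h' ρ' w t₀)
    (K : ℝ → ℝ) {a b : Ambient n} (ha : inner ℝ z a = 0) (hb : inner ℝ w b = 0) :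
    HasJet (fun τ => twoPoint K h ρ h' (z + τ • a, w + τ • b, t₀))
      (twoPoint K h ρ h' (z, w, t₀))
      (K t₀ * (dirDeriv (a, 0) ρ (z, t₀) * (1 - inner ℝ z w)
        - ρ (z, t₀) * (inner ℝ a w + inner ℝ z b)) + hess h a w (z, t₀)
        + dirDeriv (b, 0) h (z, t₀) - dirDeriv (b, 0) h' (w, t₀))
      (K t₀ * (hess ρ a a (z, t₀) / 2 * (1 - inner ℝ z w)
        - dirDeriv (a, 0) ρ (z, t₀) * (inner ℝ a w + inner ℝ z b)
        + ρ (z, t₀) * (‖b‖ ^ 2 / 2 - inner ℝ a b + inner ℝ z w / 2 * ‖a‖ ^ 2))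
        + dirDeriv (w, 0) (hess h a a) (z, t₀) / 2 + hess h a b (z, t₀)
        - hess h' b b (w, t₀) / 2) := by
  have hN := (hasJet_norm S.norm_eq a).inv one_ne_zero
  have hN' := hasJet_norm S'.norm_eq b
  have hNN := HasJet.of_quadratic (inner ℝ z w) (inner ℝ a w + inner ℝ z b) (inner ℝ a b)
  have hw := hasJet_line ((dirDeriv_contDiffAt S.smooth (w, 0)).of_le (by norm_cast))
    ((a, 0) : Ambient n × ℝ)
  have hb' := hasJet_line ((dirDeriv_contDiffAt S.smooth (b, 0)).of_le (by norm_cast))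
    ((a, 0) : Ambient n × ℝ)
  have hh := hasJet_line (S'.smooth.of_le (by norm_cast)) ((b, 0) : Ambient n × ℝ)
  have h3 : dirDeriv (a, 0) (dirDeriv (a, 0) (dirDeriv (w, 0) h)) (z, t₀)
      = dirDeriv (w, 0) (hess h a a) (z, t₀) := by
    rw [(dirDeriv_congr (dirDeriv_comm_eventually S.smooth (a, 0) (w, 0)) (a, 0)).self_of_nhds,
      dirDeriv_comm ((dirDeriv_contDiffAt S.smooth (a, 0)).of_le (by norm_cast))]
    rfl
  refine ((((((S.hasJet_rho a).const_mul (K t₀)).mul (hN'.sub (hNN.mul hN))).add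
    (hw.add (HasJet.id.mul hb'))).sub hh).congr (Eventually.of_forall fun τ => ?_)).coeff ?_ ?_ ?_
  · simp only [twoPoint, dirDeriv_add_smul, inner_add_left, inner_add_right, inner_smul_left,
      inner_smul_right, Prod.mk_add_mk, Prod.smul_mk, smul_zero, add_zero, RCLike.conj_to_real]
    ring
  · simp [twoPoint, S.norm_eq, S'.norm_eq]
  · rw [ha, hb]; simp only [hess]; ring
  · rw [ha, hb, h3]; simp only [hess]; ring

theorem nonpos_of_hasDerivAt_of_nonneg {φ : ℝ → ℝ} {d : ℝ} (h : HasDerivAt φ d 0) (h0 : φ 0 = 0)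
    (hle : ∀ᶠ s in 𝓝 (0 : ℝ), s ≤ 0 → 0 ≤ φ s) : d ≤ 0 := by
  have h1 := (hasDerivAt_iff_tendsto_slope.1 h).mono_left
    (nhdsWithin_mono (0 : ℝ) (show Iio (0 : ℝ) ⊆ {0}ᶜ from fun x hx => ne_of_lt hx))
  refine le_of_tendsto h1 ?_
  filter_upwards [mem_nhdsWithin_of_mem_nhds hle, self_mem_nhdsWithin] with s hs (hs0 : s < 0)
  rw [slope_def_field, h0, sub_zero, sub_zero]
  exact div_nonpos_of_nonneg_of_nonpos (hs hs0.le) hs0.le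

/-- At the zero, space derivatives satisfy the minimum conditions while the time derivative is `≤
0`, nonnegativity being known for earlier times. Weighting the second order conditions by the
derivatives of `f_*` contradicts the evolution equations. -/
theorem not_off_diagonal_zero (hΦ : IsDualModulating Φ Φ₁ Φ₂) (hf : IsAdmissible f)
    (hfc : IsInverseConcave f) (S : IsLocalSol f Φ h ρ z t₀) (S' : IsLocalSol f Φ h' ρ' w t₀)
    (hzw : z ≠ w) {K : ℝ → ℝ} {K' : ℝ} (hK : 0 < K t₀) (hKd : HasDerivAt K K' t₀) (hK' : 0 < K')
    (hle : ∀ e μ, IsEigenframe f h ρ z t₀ e μ → ∀ i, μ i ≤ K t₀ * ρ (z, t₀))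
    (hnn : ∀ᶠ q in 𝓝 (z, w, t₀), q.2.2 ≤ t₀ → 0 ≤ twoPoint K h ρ h' q)
    (h0 : twoPoint K h ρ h' (z, w, t₀) = 0) : False := by
  obtain ⟨e, μ, E⟩ := S.exists_eigenframe
  have hz := S.norm_eq
  have hw := S'.norm_eq
  have hzz : inner ℝ z z = (1 : ℝ) := by rw [real_inner_self_eq_norm_sq, hz]; norm_num
  have hww : inner ℝ w w = (1 : ℝ) := by rw [real_inner_self_eq_norm_sq, hw]; norm_num
  have hρ := S.rho_pos hf
  set D := 1 - inner ℝ z w with hDdef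
  have hD : 0 < D := by
    have := (inner_lt_one_iff_real_of_norm_eq_one hz hw).2 hzw
    linarith
  -- The reflection exchanging `z` and `w`, applied to the eigenframe at `z`; since `‖z - w‖² = 2D`
  -- it has this form.
  set e' : Fin n → Ambient n := fun i => e i + (inner ℝ (e i) w / D) • (z - w) with he'
  have htr := IsLocalSol.orthonormal_transport E.orthonormal (z := -z) (by rwa [norm_neg]) hw
    (fun i => by rw [inner_neg_right, E.inner_eq_zero, neg_zero])
    (by rw [inner_neg_left, ← sub_eq_add_neg]; exact hD.ne')
  have he'eq : e' = fun i => e i - (inner ℝ (e i) w / (1 + inner ℝ (-z) w)) • (-z + w) := by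
    funext i
    rw [inner_neg_left, ← sub_eq_add_neg, ← hDdef, he']
    simp only [smul_add, smul_sub, smul_neg]
    abel
  rw [← he'eq] at htr
  obtain ⟨hoe', hoe'w⟩ := htr
  have hoe'w : ∀ i, inner ℝ (e' i) w = 0 := fun i => by rw [he'eq]; exact hoe'w i
  have hwe' : ∀ i, inner ℝ w (e' i) = 0 := fun i => (real_inner_comm _ _).trans (hoe'w i)
  have hze' : ∀ i, inner ℝ z (e' i) = inner ℝ (e i) w := fun i => by
    simp only [he', inner_add_right, inner_smul_right, inner_sub_right, hzz, E.inner_eq_zero']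
    rw [← hDdef]; field_simp; ring
  have hee' : ∀ i, inner ℝ (e i) (e' i) = 1 - inner ℝ (e i) w ^ 2 / D := fun i => by
    simp only [he', inner_add_right, inner_smul_right, inner_sub_right, E.inner_self,
      E.inner_eq_zero]
    ring
  have hspace : ∀ a b : Ambient n, ∀ᶠ τ in 𝓝 (0 : ℝ),
      0 ≤ twoPoint K h ρ h' (z + τ • a, w + τ • b, t₀) := fun a b =>
    ((tendsto_pair z w a b t₀).eventually hnn).mono fun τ hτ => hτ le_rfl
  have hfirst : ∀ i, K t₀ * dirDeriv (e i, 0) ρ (z, t₀) * D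
      = (K t₀ * ρ (z, t₀) - μ i) * inner ℝ (e i) w := by
    intro i
    have hj := (((hasJet_twoPoint S S' K (a := e i) (b := 0) (E.inner_eq_zero' i)
      (inner_zero_right _)).coeff h0 rfl rfl).nonneg_coeff (hspace _ _)).1
    rw [hess_symm S.eventually_contDiffAt.self_of_nhds, E.hess_eq] at hj
    simp only [inner_zero_right, dirDeriv, Prod.mk_zero_zero, map_zero] at hj ⊢
    linarith
  -- Second variation with both normals moving, `z` along `e i` and `w` along its mirror image `e'
  -- i`. Varying `z` alone would not involve the Hessian of `h'`.
  have hsecond : ∀ i, 0 ≤ K t₀ * (hess ρ (e i) (e i) (z, t₀) / 2 * D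
      - dirDeriv (e i, 0) ρ (z, t₀) * (inner ℝ (e i) w + inner ℝ (e i) w)
      + ρ (z, t₀) * (1 / 2 - (1 - inner ℝ (e i) w ^ 2 / D) + (1 - D) / 2))
      + dirDeriv (w, 0) (hess h (e i) (e i)) (z, t₀) / 2 + μ i * (1 - inner ℝ (e i) w ^ 2 / D)
      - hess h' (e' i) (e' i) (w, t₀) / 2 := by
    intro i
    have hj := (((hasJet_twoPoint S S' K (a := e i) (b := e' i) (E.inner_eq_zero' i)
      (hwe' i)).coeff h0 rfl rfl).nonneg_coeff (hspace _ _)).2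
    rw [hess_symm S.eventually_contDiffAt.self_of_nhds, E.hess_eq, hze', hee', hoe'.1 i,
      E.orthonormal.1 i, ← hDdef] at hj
    refine hj.trans (le_of_eq ?_)
    have : inner ℝ z w = 1 - D := by rw [hDdef]; ring
    rw [this]; ring
  have hq := dualGrad_nonneg hf E.mem
  have hμ := hle e μ E
  have hcoef := Finset.sum_le_sum fun i (_ : i ∈ Finset.univ) =>
    off_diagonal_coeff (Φv := Φ (ρ (z, t₀))) hK hD (hq i) (hΦ.pos _ hρ) (hΦ.nonpos _ hρ)
      (hΦ.mul_add_two_nonneg _ hρ) rfl (sub_nonneg.2 (hμ i)) (E.mem i).le (hfirst i) (hsecond i)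
  -- Concavity of `f_*` compares `ρ'` at `w` with `ρ` at `z`, using the tangent plane at the radii
  -- `μ` of the point `z`.
  have hB := S'.le_of_frame hf hfc |>.self_of_nhds e' hoe' hoe'w μ E.mem
  rw [← E.eq_dual] at hB
  simp only [hw, one_mul] at hB
  have hρ' := S'.rho_pos hf
  have htan := hΦ.le_tangent hρ hρ'
  have hρw := S.dirDeriv_rho hf hfc E w
  have hsum := E.sum_dualGrad_mul hf
  have htime : K' * ρ (z, t₀) * D + K t₀ * dirDeriv (0, 1) ρ (z, t₀) * D
      + (Φ₁ (ρ (z, t₀)) * dirDeriv (w, 0) ρ (z, t₀) + inner ℝ z w * Φ (ρ (z, t₀)))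
      - Φ (ρ' (w, t₀)) ≤ 0 := by
    have hd : HasDerivAt (fun s => twoPoint K h ρ h' (z, w, t₀ + s))
        (K' * ρ (z, t₀) * D + K t₀ * dirDeriv (0, 1) ρ (z, t₀) * D
          + dirDeriv (0, 1) (dirDeriv (w, 0) h) (z, t₀) - dirDeriv (0, 1) h' (w, t₀)) 0 := by
      have d1 : HasDerivAt (fun s => K (t₀ + s)) K' 0 := by
        have : HasDerivAt K K' (t₀ + 0) := by simpa using hKd
        simpa using this.comp_const_add t₀ 0
      have d2 := IsLocalSol.hasDerivAt_time (S.smooth'.differentiableAt (by simp))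
      have d3 := IsLocalSol.hasDerivAt_time
        ((dirDeriv_contDiffAt S.smooth (w, 0)).differentiableAt (by simp))
      have d4 := IsLocalSol.hasDerivAt_time (S'.smooth.differentiableAt (by simp))
      have d5 := (((d1.mul d2).mul_const D).add d3).sub d4
      refine (d5.congr_deriv ?_).congr_of_eventuallyEq (Eventually.of_forall fun s => ?_)
      · simp only [add_zero]; ring
      · simp [twoPoint, hz, hw, hDdef]
    have hcont : Tendsto (fun s : ℝ => (z, w, t₀ + s)) (𝓝 0) (𝓝 (z, w, t₀)) := by
      have : Continuous fun s : ℝ => (z, w, t₀ + s) := by fun_prop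
      simpa using this.tendsto 0
    have := nonpos_of_hasDerivAt_of_nonneg hd (by simpa using h0)
      ((hcont.eventually hnn).mono fun s hs hs0 => hs (by simpa using hs0))
    rw [S.dirDeriv_time_dirDeriv hΦ hf, S'.flow.self_of_nhds] at this
    simpa [hw] using this
  rw [S.dirDeriv_time_rho hΦ hf hfc E] at htime
  have hΦ1 := hΦ.pos _ hρ
  have hΦa := hΦ.mul_add_nonneg _ hρ
  -- Homogeneity gives `∑ qᵢ μᵢ = ρ`, and `μᵢ ≤ Kρ`, so `K ∑ qᵢ ≥ 1`.
  have hKQ : 0 ≤ K t₀ * ∑ i, dualGrad f μ i - 1 := by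
    have h1 : ∑ i, dualGrad f μ i * μ i ≤ ∑ i, dualGrad f μ i * (K t₀ * ρ (z, t₀)) :=
      Finset.sum_le_sum fun i _ => mul_le_mul_of_nonneg_left (hμ i) (hq i)
    rw [hsum, ← Finset.sum_mul] at h1
    have h2 : 0 ≤ (K t₀ * ∑ i, dualGrad f μ i - 1) * ρ (z, t₀) := by linarith
    exact nonneg_of_mul_nonneg_left h2 hρ
  generalize ρ (z, t₀) = r at *
  generalize ρ' (w, t₀) = r' at *
  have e1 : ∑ i, dualGrad f μ i * (K t₀ * D * Φ r + Φ₁ r * (K t₀ * r * D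
      - dirDeriv (w, 0) (hess h (e i) (e i)) (z, t₀) - 2 * μ i + hess h' (e' i) (e' i) (w, t₀)))
      = (∑ i, dualGrad f μ i) * (K t₀ * D * (Φ r + Φ₁ r * r))
        - Φ₁ r * ∑ i, dualGrad f μ i * dirDeriv (w, 0) (hess h (e i) (e i)) (z, t₀)
        - Φ₁ r * ∑ i, dualGrad f μ i * μ i
        + Φ₁ r * ∑ i, dualGrad f μ i * (hess h' (e' i) (e' i) (w, t₀) - μ i) := by
    simp only [Finset.mul_sum, Finset.sum_mul, ← Finset.sum_add_distrib, ← Finset.sum_sub_distrib]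
    exact Finset.sum_congr rfl fun i _ => by ring
  have e2 : ∑ i, dualGrad f μ i * (K t₀ * D * (Φ r + Φ₁ r * hess ρ (e i) (e i) (z, t₀)
      + Φ₂ r * dirDeriv (e i, 0) ρ (z, t₀) ^ 2))
      = K t₀ * (∑ i, dualGrad f μ i * (Φ r + Φ₁ r * hess ρ (e i) (e i) (z, t₀)
      + Φ₂ r * dirDeriv (e i, 0) ρ (z, t₀) ^ 2)) * D := by
    simp only [Finset.mul_sum, Finset.sum_mul]
    exact Finset.sum_congr rfl fun i _ => by ring
  rw [e1, e2, hsum] at hcoef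
  have hzw' : inner ℝ z w = 1 - D := by rw [hDdef]; ring
  rw [hzw'] at hρw htime
  rw [hρw] at htime
  have hB' := mul_le_mul_of_nonneg_left hB hΦ1.le
  -- After all substitutions the time inequality reads `K' r D + D (K ∑ qᵢ - 1)(Φ₁ r + Φ) ≤ 0`.
  have p1 : 0 < K' * r * D := by positivity
  have p2 : 0 ≤ D * ((K t₀ * ∑ i, dualGrad f μ i - 1) * (Φ₁ r * r + Φ r)) := by positivity
  nlinarith

end OffDiagonal

/-! ### The pinching form and reflected frames -/

section Diagonal

variable {n : ℕ} {f : (Fin n → ℝ) → ℝ} {Φ Φ₁ Φ₂ : ℝ → ℝ} {h ρ : Ambient n × ℝ → ℝ}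
  {z : Ambient n} {t₀ : ℝ} {e : Fin n → Ambient n} {μ : Fin n → ℝ}

/-- The quadratic form `K ρ g - r` on the tangent bundle in the Gauss map parametrization. -/
def pinching (K : ℝ → ℝ) (h ρ : Ambient n × ℝ → ℝ) (a : Ambient n) (p : Ambient n × ℝ) : ℝ :=
  K p.2 * ρ p * ((‖p.1‖ ^ 2 * ‖a‖ ^ 2 - inner ℝ a p.1 ^ 2) * (‖p.1‖⁻¹) ^ 3) - hess h a a p

/-- The tangent vector is moved to `u + τ B` together with the base point. The freedom in `B`
strengthens the second order condition beyond the one for a fixed null vector. -/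
theorem hasJet_pinching (S : IsLocalSol f Φ h ρ z t₀) (K : ℝ → ℝ) {u a B : Ambient n}
    (hu : ‖u‖ = 1) (huz : inner ℝ u z = 0) (ha : inner ℝ z a = 0) (hB : inner ℝ B z = 0) :
    HasJet (fun τ => pinching K h ρ (u + τ • B) (z + τ • a, t₀))
      (pinching K h ρ u (z, t₀))
      (K t₀ * (dirDeriv (a, 0) ρ (z, t₀) + ρ (z, t₀) * (2 * inner ℝ u B))
        - dirDeriv (a, 0) (hess h u u) (z, t₀) - 2 * hess h u B (z, t₀))
      (K t₀ * (hess ρ a a (z, t₀) / 2 + dirDeriv (a, 0) ρ (z, t₀) * (2 * inner ℝ u B)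
        + ρ (z, t₀) * (‖B‖ ^ 2 - inner ℝ u a ^ 2 - ‖a‖ ^ 2 / 2))
        - hess (hess h u u) a a (z, t₀) / 2 - 2 * dirDeriv (a, 0) (hess h u B) (z, t₀)
        - hess h B B (z, t₀)) := by
  have hN := hasJet_norm S.norm_eq a
  have hNi := hN.inv one_ne_zero
  have hA := HasJet.of_quadratic 1 (2 * inner ℝ u B) (‖B‖ ^ 2)
  have hI := HasJet.of_quadratic 0 (inner ℝ u a) (inner ℝ B a)
  have hT := (S.hasJet_hess a u u).add (((HasJet.id.const_mul 2).mul (S.hasJet_hess a u B)).add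
    (HasJet.sq.mul (S.hasJet_hess a B B)))
  have hj := ((((S.hasJet_rho a).const_mul (K t₀)).mul ((((hN.mul hN).mul hA).sub (hI.mul hI)).mul
    (hNi.mul (hNi.mul hNi)))).sub hT)
  refine (hj.congr ?_).coeff ?_ ?_ ?_
  · filter_upwards [(IsLocalSol.tendsto_space z a t₀).eventually S.eventually_contDiffAt] with τ hτ
    have e1 : ‖u + τ • B‖ ^ 2 = 1 + 2 * inner ℝ u B * τ + ‖B‖ ^ 2 * τ ^ 2 := by
      rw [norm_add_sq_real, hu, norm_smul, inner_smul_right, Real.norm_eq_abs, mul_pow, sq_abs]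
      ring
    have e2 : inner ℝ (u + τ • B) (z + τ • a) = 0 + inner ℝ u a * τ + inner ℝ B a * τ ^ 2 := by
      simp only [inner_add_left, inner_add_right, inner_smul_left, inner_smul_right, huz, hB,
        RCLike.conj_to_real]
      ring
    have e3 : hess h (u + τ • B) (u + τ • B) (z + τ • a, t₀) = hess h u u (z + τ • a, t₀)
        + (2 * τ * hess h u B (z + τ • a, t₀) + τ ^ 2 * hess h B B (z + τ • a, t₀)) := by
      rw [hess_add_left hτ, hess_add_right hτ, hess_add_right hτ, hess_smul_left hτ,
        hess_smul_left hτ, hess_smul_right hτ, hess_smul_right hτ, hess_symm hτ B u]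
      ring
    simp only [pinching, e1, e2, e3]
    ring
  · simp [pinching, S.norm_eq, hu, huz]
  · rw [ha]; ring
  · rw [ha]; ring

theorem orthonormal_reflect {e : Fin n → Ambient n} (he : Orthonormal ℝ e) {m : Ambient n}
    (hm : m ≠ 0) :
    Orthonormal ℝ (fun i => e i - (2 / ‖m‖ ^ 2 * inner ℝ (e i) m) • m) := by
  have hm2 : inner ℝ m m = ‖m‖ ^ 2 := real_inner_self_eq_norm_sq m
  have hm0 : ‖m‖ ≠ 0 := norm_ne_zero_iff.2 hm
  rw [orthonormal_iff_ite] at he ⊢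
  intro i j
  rw [← he i j]
  simp only [inner_sub_left, inner_sub_right, inner_smul_left, inner_smul_right, hm2,
    RCLike.conj_to_real, real_inner_comm (e j) m]
  field_simp
  ring

/-- The coefficient of the reflected frame along `e₁ + τ b`. -/
def reflCoeff (δ c β τ : ℝ) : ℝ := 2 / (1 + β * τ ^ 2) * (δ + c * τ)

theorem hasJet_reflCoeff (δ c β : ℝ) :
    HasJet (reflCoeff δ c β) (2 * δ) (2 * c) (-2 * β * δ) := by
  refine (((((HasJet.of_quadratic 1 0 β).inv one_ne_zero).const_mul 2).mul
    (HasJet.of_quadratic δ c 0)).congr (Eventually.of_forall fun τ => ?_)).coeff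
      (by ring) (by ring) (by ring)
  simp only [reflCoeff, zero_mul, add_zero]
  ring

theorem hasJet_reflCoeff_transport {N : ℝ → ℝ} (hN : HasJet N 1 0 (1 / 2)) (δ c β : ℝ) :
    HasJet (fun τ => τ ^ 2 * (N τ + 1)⁻¹ * (δ - reflCoeff δ c β τ) - reflCoeff δ c β τ)
      (-2 * δ) (-2 * c) (2 * β * δ - δ / 2) := by
  have hκ := (((hN.add (HasJet.const 1)).coeff (by norm_num : _ = (2 : ℝ)) rfl rfl).inv two_ne_zero)
  have hs := hasJet_reflCoeff δ c β
  exact (((HasJet.sq.mul hκ).mul ((HasJet.const δ).sub hs)).sub hs).coeff (by ring) (by ring)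
    (by ring)

/-- Expansion of the Hessian on the moving vector `eᵢ + x eₖ - τ s b`, times the norm `N`; the index
`1` stands for `k`. Modulo the radial direction, these are the frame vectors reflected along `eₖ + τ
b` and then rotated to the new normal. -/
theorem hasJet_reflected {T11 Tii Ti1 Tib T1b Tbb N x s : ℝ → ℝ} {δ c β a0 a1 a2 b0 b1 b2 c0 c1 c2
    d0 d1 d2 g0 g1 g2 k0 k1 k2 : ℝ} (hN : HasJet N 1 0 (1 / 2))
    (hs : HasJet s (2 * δ) (2 * c) (-2 * β * δ))
    (hx : HasJet x (-2 * δ) (-2 * c) (2 * β * δ - δ / 2)) (h11 : HasJet T11 a0 a1 a2)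
    (hii : HasJet Tii b0 b1 b2) (hi1 : HasJet Ti1 c0 c1 c2) (hib : HasJet Tib d0 d1 d2)
    (h1b : HasJet T1b g0 g1 g2) (hbb : HasJet Tbb k0 k1 k2) :
    HasJet (fun τ => N τ * (Tii τ + x τ ^ 2 * T11 τ + τ ^ 2 * s τ ^ 2 * Tbb τ + 2 * x τ * Ti1 τ
      - 2 * τ * s τ * Tib τ - 2 * τ * x τ * s τ * T1b τ))
      (b0 + 4 * δ ^ 2 * a0 - 4 * δ * c0)
      (b1 + 4 * δ ^ 2 * a1 + 8 * δ * c * a0 - 4 * δ * c1 - 4 * c * c0 - 4 * δ * d0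
        + 8 * δ ^ 2 * g0)
      (b2 + 4 * δ ^ 2 * a2 + 8 * δ * c * a1 + (4 * c ^ 2 - 8 * β * δ ^ 2 + 2 * δ ^ 2) * a0
        + 4 * δ ^ 2 * k0 - 4 * δ * c2 - 4 * c * c1 + (4 * β * δ - δ) * c0 - 4 * δ * d1 - 4 * c * d0
        + 8 * δ ^ 2 * g1 + 16 * δ * c * g0 + (b0 + 4 * δ ^ 2 * a0 - 4 * δ * c0) / 2) := by
  have hj := hN.mul (((((hii.add ((hx.mul hx).mul h11)).add ((HasJet.sq.mul (hs.mul hs)).mul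
    hbb)).add ((hx.const_mul 2).mul hi1)).sub (((HasJet.id.const_mul 2).mul hs).mul hib)).sub
    ((((HasJet.id.const_mul 2).mul hx).mul hs).mul h1b))
  refine (hj.congr (Eventually.of_forall fun τ => by ring)).coeff ?_ ?_ ?_ <;> ring

end Diagonal

/-! ### First times at which a radius of curvature reaches `K ρ` -/

section Diagonal

variable {n : ℕ} {f : (Fin n → ℝ) → ℝ} {Φ Φ₁ Φ₂ : ℝ → ℝ} {h ρ : Ambient n × ℝ → ℝ}
  {z : Ambient n} {t₀ : ℝ} {e : Fin n → Ambient n} {μ : Fin n → ℝ}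

theorem hess_quadratic {p : Ambient n × ℝ} (hp : ContDiffAt ℝ 2 h p) (u v w : Ambient n)
    (x y : ℝ) : hess h (u + x • v + y • w) (u + x • v + y • w) p = hess h u u p
      + x ^ 2 * hess h v v p + y ^ 2 * hess h w w p + 2 * x * hess h u v p + 2 * y * hess h u w p
      + 2 * x * y * hess h v w p := by
  simp only [hess_add_left hp, hess_add_right hp, hess_smul_left hp, hess_smul_right hp]
  rw [hess_symm hp v u, hess_symm hp w u, hess_symm hp w v]
  ring

/-- Reflecting along `m = eₖ + τ b` gives, for every `τ`, an exactly orthonormal frame which to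
first order is `eᵢ - 2τ⟨eᵢ,b⟩eₖ` for `i ≠ k` and `-(eₖ + 2τ b)` for `i = k`. The sign is invisible
to quadratic forms, so this realizes an arbitrary infinitesimal rotation mixing `eₖ` with the other
directions. -/
theorem IsLocalSol.le_of_reflect (hf : IsAdmissible f) (hfc : IsInverseConcave f)
    (S : IsLocalSol f Φ h ρ z t₀) (E : IsEigenframe f h ρ z t₀ e μ) (k : Fin n) {b : Ambient n}
    (hbz : inner ℝ b z = 0) (hkb : inner ℝ (e k) b = 0) :
    ∀ᶠ τ in 𝓝 (0 : ℝ), ρ (z + τ • e k, t₀) ≤ dual f μ + ∑ i, dualGrad f μ i *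
      (‖z + τ • e k‖ * (hess h (e i) (e i) (z + τ • e k, t₀)
        + (τ ^ 2 * (‖z + τ • e k‖ + 1)⁻¹ * ((if i = k then 1 else 0)
            - reflCoeff (if i = k then 1 else 0) (inner ℝ (e i) b) (‖b‖ ^ 2) τ)
            - reflCoeff (if i = k then 1 else 0) (inner ℝ (e i) b) (‖b‖ ^ 2) τ) ^ 2
          * hess h (e k) (e k) (z + τ • e k, t₀)
        + τ ^ 2 * reflCoeff (if i = k then 1 else 0) (inner ℝ (e i) b) (‖b‖ ^ 2) τ ^ 2
          * hess h b b (z + τ • e k, t₀)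
        + 2 * (τ ^ 2 * (‖z + τ • e k‖ + 1)⁻¹ * ((if i = k then 1 else 0)
            - reflCoeff (if i = k then 1 else 0) (inner ℝ (e i) b) (‖b‖ ^ 2) τ)
            - reflCoeff (if i = k then 1 else 0) (inner ℝ (e i) b) (‖b‖ ^ 2) τ)
          * hess h (e i) (e k) (z + τ • e k, t₀)
        - 2 * τ * reflCoeff (if i = k then 1 else 0) (inner ℝ (e i) b) (‖b‖ ^ 2) τ
          * hess h (e i) b (z + τ • e k, t₀)
        - 2 * τ * (τ ^ 2 * (‖z + τ • e k‖ + 1)⁻¹ * ((if i = k then 1 else 0)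
            - reflCoeff (if i = k then 1 else 0) (inner ℝ (e i) b) (‖b‖ ^ 2) τ)
            - reflCoeff (if i = k then 1 else 0) (inner ℝ (e i) b) (‖b‖ ^ 2) τ)
          * reflCoeff (if i = k then 1 else 0) (inner ℝ (e i) b) (‖b‖ ^ 2) τ
          * hess h (e k) b (z + τ • e k, t₀)) - μ i) := by
  have hzz : inner ℝ z z = (1 : ℝ) := by rw [real_inner_self_eq_norm_sq, S.norm_eq]; norm_num
  filter_upwards [(tendsto_space z (e k) t₀).eventually (S.le_of_transport hf hfc),
    (tendsto_space z (e k) t₀).eventually S.eventually_contDiffAt,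
    (tendsto_space z (e k) t₀).eventually S.hess_self_right] with τ h1 h2 h3
  set m := e k + τ • b with hm
  have hmk : inner ℝ (e k) m = 1 := by
    rw [hm, inner_add_right, E.inner_self, inner_smul_right, hkb, mul_zero, add_zero]
  have hm2 : ‖m‖ ^ 2 = 1 + ‖b‖ ^ 2 * τ ^ 2 := by
    rw [hm, norm_add_sq_real, E.orthonormal.1, inner_smul_right, hkb, norm_smul, Real.norm_eq_abs,
      mul_pow, sq_abs]
    ring
  have hm0 : m ≠ 0 := by
    intro h0; rw [h0, inner_zero_right] at hmk; exact zero_ne_one hmk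
  have hmz : inner ℝ m z = 0 := by
    rw [hm, inner_add_left, E.inner_eq_zero, inner_smul_left, hbz, mul_zero, add_zero]
  have hik : ∀ i, inner ℝ (e i) (e k) = if i = k then (1 : ℝ) else 0 := fun i =>
    orthonormal_iff_ite.1 E.orthonormal i k
  have hcoef : ∀ i, 2 / ‖m‖ ^ 2 * inner ℝ (e i) m
      = reflCoeff (if i = k then 1 else 0) (inner ℝ (e i) b) (‖b‖ ^ 2) τ := by
    intro i
    rw [hm2, reflCoeff, hm, inner_add_right, inner_smul_right, hik, mul_comm τ]
  have ho := orthonormal_reflect E.orthonormal hm0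
  simp only [hcoef] at ho
  refine (h1 _ ho (fun i => ?_) μ E.mem).trans (le_of_eq ?_)
  · rw [inner_sub_left, inner_smul_left, hmz, E.inner_eq_zero]; simp
  congr 1
  refine Finset.sum_congr rfl fun i _ => ?_
  congr 2
  set s := reflCoeff (if i = k then 1 else 0) (inner ℝ (e i) b) (‖b‖ ^ 2) τ
  have hzN : inner ℝ z (z + τ • e k) = 1 := by
    rw [inner_add_right, hzz, inner_smul_right, E.inner_eq_zero']; ring
  have hgN : inner ℝ (e i - s • m) (z + τ • e k) = τ * ((if i = k then 1 else 0) - s) := by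
    rw [inner_sub_left, inner_smul_left, inner_add_right, inner_add_right, hmz, E.inner_eq_zero,
      inner_smul_right, inner_smul_right, hik, real_inner_comm, hmk, RCLike.conj_to_real]
    ring
  simp only [hzN, hgN]
  set δ : ℝ := if i = k then 1 else 0
  set N := ‖z + τ • e k‖
  have hG : e i - s • m - (τ * (δ - s) / (N + 1)) • z
      = (e i + (τ ^ 2 * (N + 1)⁻¹ * (δ - s) - s) • e k + (-(τ * s)) • b)
        + (-(τ * (δ - s) / (N + 1))) • (z + τ • e k) := by
    rw [hm]
    module
  have h3' : ∀ a, hess h (z + τ • e k) a (z + τ • e k, t₀) = 0 := fun a => by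
    rw [hess_symm h2, h3]
  have h3'' : ∀ a, hess h a (z + τ • e k) (z + τ • e k, t₀) = 0 := h3
  rw [hG, hess_add_left h2, hess_add_right h2, hess_smul_left h2, hess_smul_right h2, h3', h3'',
    hess_quadratic h2]
  ring

/-- The second order content of inverse-concavity. The vector `b` parametrizes a rotation of the
frame; keeping it free replaces the usual formula for the second derivative of a function of
eigenvalues, with its difference quotients. -/
theorem IsLocalSol.hess_rho_le (hf : IsAdmissible f) (hfc : IsInverseConcave f)
    (S : IsLocalSol f Φ h ρ z t₀) (E : IsEigenframe f h ρ z t₀ e μ) (k : Fin n) {b : Ambient n}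
    (hbz : inner ℝ b z = 0) (hkb : inner ℝ (e k) b = 0) :
    hess ρ (e k) (e k) (z, t₀) / 2 ≤ ∑ i, dualGrad f μ i * (if i = k then
      hess (hess h (e k) (e k)) (e k) (e k) (z, t₀) / 2 + μ k * (3 / 2 - 4 * ‖b‖ ^ 2)
        + 4 * hess h b b (z, t₀) + 4 * dirDeriv (e k, 0) (hess h (e k) b) (z, t₀)
      else hess (hess h (e i) (e i)) (e k) (e k) (z, t₀) / 2 + μ i / 2
        + 4 * inner ℝ (e i) b ^ 2 * (μ k - μ i)
        - 4 * inner ℝ (e i) b * dirDeriv (e k, 0) (hess h (e i) (e k)) (z, t₀)) := by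
  have hN : HasJet (fun τ => ‖z + τ • e k‖) 1 0 (1 / 2) :=
    (hasJet_norm S.norm_eq (e k)).coeff rfl (E.inner_eq_zero' k)
      (by rw [E.orthonormal.1, E.inner_eq_zero']; norm_num)
  have hp := S.eventually_contDiffAt.self_of_nhds
  have hsum := HasJet.sum Finset.univ (fun i _ => ((hasJet_reflected hN
    (hasJet_reflCoeff (if i = k then 1 else 0) (inner ℝ (e i) b) (‖b‖ ^ 2))
    (hasJet_reflCoeff_transport hN (if i = k then 1 else 0) (inner ℝ (e i) b) (‖b‖ ^ 2))
    (S.hasJet_hess (e k) (e k) (e k)) (S.hasJet_hess (e k) (e i) (e i))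
    (S.hasJet_hess (e k) (e i) (e k)) (S.hasJet_hess (e k) (e i) b) (S.hasJet_hess (e k) (e k) b)
    (S.hasJet_hess (e k) b b)).sub (HasJet.const (μ i))).const_mul (dualGrad f μ i))
  have htot := ((HasJet.const (ρ (z, t₀))).add hsum).sub (S.hasJet_rho (e k))
  have hik : ∀ i, inner ℝ (e i) (e k) = if i = k then (1 : ℝ) else 0 := fun i =>
    orthonormal_iff_ite.1 E.orthonormal i k
  have hHb : ∀ i, hess h (e i) b (z, t₀) = μ i * inner ℝ (e i) b := fun i => by
    rw [hess_symm hp, E.hess_eq]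
  have hHk : ∀ i, hess h (e i) (e k) (z, t₀) = μ i * if i = k then (1 : ℝ) else 0 := fun i => by
    rw [hess_symm hp, E.hess_eq, hik]
  have hnn := (htot.coeff (a' := 0) ?_ rfl rfl).nonneg_coeff ?_
  · rw [← sub_nonneg]
    refine hnn.2.trans (le_of_eq ?_)
    rw [zero_add]
    congr 1
    refine Finset.sum_congr rfl fun i _ => ?_
    congr 1
    rw [E.hess_self, E.hess_self, hHk, hHb, hHb]
    by_cases hi : i = k
    · subst hi
      simp only [if_true, hkb]
      ring
    · simp only [if_neg hi, hkb]
      ring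
  · have : ∀ i, dualGrad f μ i * (hess h (e i) (e i) (z, t₀)
        + 4 * (if i = k then 1 else 0) ^ 2 * hess h (e k) (e k) (z, t₀)
        - 4 * (if i = k then 1 else 0) * hess h (e i) (e k) (z, t₀) - μ i) = 0 := by
      intro i
      rw [E.hess_self, E.hess_self, hHk]
      by_cases hi : i = k
      · subst hi; simp only [if_true]; ring
      · simp only [if_neg hi]; ring
    simp only [this]
    simp
  · filter_upwards [S.le_of_reflect hf hfc E k hbz hkb] with τ hτ
    rw [← E.eq_dual] at hτ
    exact sub_nonneg.2 hτ

/-- With `c = r / (2ρ)` the rotation terms equal `-K r²/ρ - μ (r/ρ)²`, and `Φ2 ρ + 2Φ1 ≥ 0` lets the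
first absorb `K Φ2 r²`. This `c` is the optimum for `μ = 0`; the true optimum would divide by `Kρ -
μ`, which may vanish. -/
theorem diagonal_coeff {Φ1 Φ2 K ρ q r c R F F' μ m : ℝ} (hρ : 0 < ρ) (hq : 0 ≤ q) (hK : 0 < K)
    (hΦ1 : 0 < Φ1) (hΦ : 0 ≤ Φ2 * ρ + 2 * Φ1) (hm : m = K * ρ - μ) (hμ : 0 ≤ μ)
    (hc : c = r / (2 * ρ)) (hF : F = F') (h2 : 0 ≤ K * (R / 2 - ρ / 2) - F' / 2) :
    2 * Φ1 * (q * (F / 2 + μ / 2 + 4 * c ^ 2 * (K * ρ - μ) - 4 * c * (K * r)))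
      ≤ q * (K * (Φ1 * R + Φ2 * r ^ 2) - Φ1 * m) := by
  have h3 : 2 * Φ1 * (F / 2 + μ / 2 + 4 * c ^ 2 * (K * ρ - μ) - 4 * c * (K * r))
      ≤ K * (Φ1 * R + Φ2 * r ^ 2) - Φ1 * m := by
    have h4 : 4 * c ^ 2 * (K * ρ - μ) - 4 * c * (K * r) ≤ - (K * r ^ 2 / ρ) := by
      have e1 : 4 * c ^ 2 * (K * ρ - μ) - 4 * c * (K * r)
        = - (K * r ^ 2 / ρ) - μ * (r / ρ) ^ 2 := by rw [hc]; field_simp; ring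
      rw [e1]
      have : 0 ≤ μ * (r / ρ) ^ 2 := by positivity
      linarith
    have h5 : -(2 * Φ1 * (K * r ^ 2 / ρ)) ≤ K * Φ2 * r ^ 2 := by
      have e1 : K * Φ2 * r ^ 2 + 2 * Φ1 * (K * r ^ 2 / ρ) = K * r ^ 2 / ρ * (Φ2 * ρ + 2 * Φ1) := by
        field_simp
      have : 0 ≤ K * r ^ 2 / ρ * (Φ2 * ρ + 2 * Φ1) := by positivity
      linarith
    have h6 := mul_le_mul_of_nonneg_left h4 (by positivity : 0 ≤ 2 * Φ1)
    have h7 : F + μ ≤ K * R - m := by linarith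
    have h8 := mul_le_mul_of_nonneg_left h7 hΦ1.le
    linarith
  have := mul_le_mul_of_nonneg_left h3 hq
  linarith

/-- A maximum principle for the form `K ρ g - r` with null vector `eₖ`. The extra terms from
rotating the frame are what compensates the gradient terms with `Φ₂`. -/
theorem not_diagonal_zero (hΦ : IsDualModulating Φ Φ₁ Φ₂) (hf : IsAdmissible f)
    (hfc : IsInverseConcave f) (S : IsLocalSol f Φ h ρ z t₀) (E : IsEigenframe f h ρ z t₀ e μ)
    {K : ℝ → ℝ} {K' : ℝ} (hK : 0 < K t₀) (hKd : HasDerivAt K K' t₀) (hK' : 0 < K')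
    (hnn : ∀ᶠ p in 𝓝 (z, t₀), p.2 ≤ t₀ → ∀ a, 0 ≤ pinching K h ρ a p)
    {k : Fin n} (hk : μ k = K t₀ * ρ (z, t₀)) : False := by
  have hρ := S.rho_pos hf
  have hp := S.eventually_contDiffAt.self_of_nhds
  have hq := dualGrad_nonneg hf E.mem
  have hzero : pinching K h ρ (e k) (z, t₀) = 0 := by
    simp [pinching, S.norm_eq, E.orthonormal.1, E.inner_eq_zero, E.hess_self, hk]
  have hspace : ∀ a u B : Ambient n, ∀ᶠ τ in 𝓝 (0 : ℝ),
      0 ≤ pinching K h ρ (u + τ • B) (z + τ • a, t₀) := fun a u B =>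
    ((IsLocalSol.tendsto_space z a t₀).eventually hnn).mono fun τ hτ => hτ le_rfl _
  have hfirst : ∀ a, inner ℝ z a = 0 →
      dirDeriv (a, 0) (hess h (e k) (e k)) (z, t₀) = K t₀ * dirDeriv (a, 0) ρ (z, t₀) := by
    intro a ha
    have := (((hasJet_pinching S K (E.orthonormal.1 k) (E.inner_eq_zero k) ha
      (B := 0) (inner_zero_left _)).coeff hzero rfl rfl).nonneg_coeff (hspace _ _ _)).1
    have h0 : hess h (e k) 0 (z, t₀) = 0 := by
      have := hess_smul_right hp 0 0 (e k)
      simpa using this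
    rw [inner_zero_right, h0] at this
    linarith
  set r : Fin n → ℝ := fun i => dirDeriv (e i, 0) ρ (z, t₀) with hr
  set R : Fin n → ℝ := fun i => hess ρ (e i) (e i) (z, t₀) with hR
  -- The rotation with coefficients `rᵢ / (2ρ)` prepared by `diagonal_coeff`; the component along
  -- `eₖ` is irrelevant and set to zero.
  set b : Ambient n := ∑ i, (if i = k then 0 else r i / (2 * ρ (z, t₀))) • e i with hb
  have hbe : ∀ i, inner ℝ (e i) b = if i = k then 0 else r i / (2 * ρ (z, t₀)) := fun i => by
    rw [hb, E.orthonormal.inner_right_fintype]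
  have hkb : inner ℝ (e k) b = 0 := by rw [hbe, if_pos rfl]
  have hbz : inner ℝ b z = 0 := by
    rw [hb, sum_inner]
    exact Finset.sum_eq_zero fun i _ => by rw [inner_smul_left, E.inner_eq_zero, mul_zero]
  have hzb : inner ℝ z b = 0 := (real_inner_comm _ _).trans hbz
  -- Symmetry of third derivatives turns the mixed terms into derivatives of `h_kk`, which the first
  -- order condition identifies with `K` times derivatives of `ρ`.
  have hcomm : ∀ a, dirDeriv (e k, 0) (hess h a (e k)) (z, t₀)
      = dirDeriv (a, 0) (hess h (e k) (e k)) (z, t₀) := fun a =>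
    dirDeriv_comm ((dirDeriv_contDiffAt S.smooth (e k, 0)).of_le (by norm_cast)) _ _
  have hcomm' : dirDeriv (e k, 0) (hess h (e k) b) (z, t₀)
      = dirDeriv (b, 0) (hess h (e k) (e k)) (z, t₀) := by
    rw [← hcomm b]
    exact (dirDeriv_congr (dirDeriv_comm_eventually S.smooth (e k, 0) (b, 0)) _).self_of_nhds
  have hfour : ∀ i, hess (hess h (e i) (e i)) (e k) (e k) (z, t₀)
      = hess (hess h (e k) (e k)) (e i) (e i) (z, t₀) := by
    intro i
    have c1 : dirDeriv (e k, 0) (dirDeriv (e i, 0) (dirDeriv (e i, 0) h)) =ᶠ[𝓝 (z, t₀)]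
        dirDeriv (e i, 0) (dirDeriv (e i, 0) (dirDeriv (e k, 0) h)) :=
      (dirDeriv_comm_eventually (dirDeriv_contDiffAt S.smooth _) _ _).trans
        (dirDeriv_congr (dirDeriv_comm_eventually S.smooth _ _) _)
    have c2 : dirDeriv (e k, 0) (dirDeriv (e i, 0) (dirDeriv (e i, 0) (dirDeriv (e k, 0) h)))
        =ᶠ[𝓝 (z, t₀)] dirDeriv (e i, 0) (dirDeriv (e i, 0) (dirDeriv (e k, 0)
          (dirDeriv (e k, 0) h))) :=
      (dirDeriv_comm_eventually (dirDeriv_contDiffAt (dirDeriv_contDiffAt S.smooth _) _) _ _).trans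
        (dirDeriv_congr (dirDeriv_comm_eventually (dirDeriv_contDiffAt S.smooth _) _ _) _)
    exact (dirDeriv_congr c1 _).self_of_nhds.trans c2.self_of_nhds
  have hμ : ∀ i, μ i ≤ K t₀ * ρ (z, t₀) := fun i => by
    have := hnn.self_of_nhds le_rfl (e i)
    simp only [pinching, S.norm_eq, E.orthonormal.1, E.inner_eq_zero, E.hess_self] at this
    norm_num at this
    exact this
  have hsecond : ∀ i, i ≠ k → 0 ≤ K t₀ * (R i / 2 - ρ (z, t₀) / 2)
      - hess (hess h (e k) (e k)) (e i) (e i) (z, t₀) / 2 := by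
    intro i hi
    have := (((hasJet_pinching S K (E.orthonormal.1 k) (E.inner_eq_zero k) (E.inner_eq_zero' i)
      (B := 0) (inner_zero_left _)).coeff hzero rfl rfl).nonneg_coeff (hspace _ _ _)).2
    have h0 : ∀ a, hess h a 0 = fun _ => 0 := by
      intro a
      have h2 : dirDeriv ((0, 0) : Ambient n × ℝ) h = fun _ => 0 := by
        funext q
        exact map_zero (fderiv ℝ h q)
      funext p
      simp [hess, h2, dirDeriv]
    have h1 : inner ℝ (e k) (e i) = (0 : ℝ) := E.orthonormal.2 (Ne.symm hi)
    rw [h0, h0, h1, E.orthonormal.1 i, inner_zero_right] at this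
    simp only [dirDeriv, norm_zero, fderiv_fun_const, Pi.zero_apply, zero_apply] at this
    refine this.trans (le_of_eq ?_)
    simp only [hR]
    ring
  -- The null vector is moved along `2b`, matching the first order motion of the reflected `eₖ`, so
  -- that the unknown terms in `b` cancel against those of `hess_rho_le`.
  have hsecondk : 0 ≤ K t₀ * (R k / 2 + ρ (z, t₀) * (4 * ‖b‖ ^ 2 - 3 / 2))
      - hess (hess h (e k) (e k)) (e k) (e k) (z, t₀) / 2
      - 4 * dirDeriv (e k, 0) (hess h (e k) b) (z, t₀) - 4 * hess h b b (z, t₀) := by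
    have := (((hasJet_pinching S K (E.orthonormal.1 k) (E.inner_eq_zero k) (E.inner_eq_zero' k)
      (B := (2 : ℝ) • b) (by rw [inner_smul_left, hbz, mul_zero])).coeff hzero rfl
        rfl).nonneg_coeff (hspace _ _ _)).2
    have h1 : dirDeriv (e k, 0) (hess h (e k) ((2 : ℝ) • b)) (z, t₀)
        = 2 * dirDeriv (e k, 0) (hess h (e k) b) (z, t₀) := by
      have h2 : hess h (e k) ((2 : ℝ) • b) =ᶠ[𝓝 (z, t₀)] fun p => (2 : ℝ) • hess h (e k) b p := by
        filter_upwards [S.eventually_contDiffAt] with p hp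
        rw [hess_smul_right hp, smul_eq_mul]
      rw [(dirDeriv_congr h2 _).self_of_nhds]
      unfold dirDeriv
      rw [fderiv_fun_const_smul ((S.hess_contDiffAt (e k) b).differentiableAt (by simp))]
      simp
    rw [h1, hess_smul_left hp, hess_smul_right hp, inner_smul_right, hkb, norm_smul,
      E.inner_self, E.orthonormal.1] at this
    refine this.trans (le_of_eq ?_)
    simp only [hR, Real.norm_eq_abs, mul_pow, sq_abs]
    ring
  have hconc := S.hess_rho_le hf hfc E k hbz hkb
  have hΦ1 := hΦ.pos _ hρ
  have hΦ2 := hΦ.nonpos _ hρ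
  have hsumle : 2 * Φ₁ (ρ (z, t₀)) * (R k / 2) ≤ ∑ i, (dualGrad f μ i *
      (K t₀ * (Φ₁ (ρ (z, t₀)) * R i + Φ₂ (ρ (z, t₀)) * r i ^ 2)
        - Φ₁ (ρ (z, t₀)) * (K t₀ * ρ (z, t₀) - μ i))
      - if i = k then K t₀ * Φ₂ (ρ (z, t₀)) * r i ^ 2 * dualGrad f μ i else 0) := by
    refine (mul_le_mul_of_nonneg_left hconc (by positivity)).trans ?_
    rw [Finset.mul_sum]
    refine Finset.sum_le_sum fun i _ => ?_
    by_cases hi : i = k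
    · subst hi
      simp only [if_true]
      have h1 : hess (hess h (e i) (e i)) (e i) (e i) (z, t₀) / 2 + μ i * (3 / 2 - 4 * ‖b‖ ^ 2)
        + 4 * hess h b b (z, t₀) + 4 * dirDeriv (e i, 0) (hess h (e i) b) (z, t₀)
          ≤ K t₀ * R i / 2 := by
        rw [hk]; linarith
      have h2 := mul_le_mul_of_nonneg_left h1 (mul_nonneg (mul_nonneg two_pos.le hΦ1.le) (hq i))
      rw [hk, sub_self]
      rw [hk] at h2
      linarith
    · simp only [if_neg hi, sub_zero]
      have hx : dirDeriv (e k, 0) (hess h (e i) (e k)) (z, t₀) = K t₀ * r i := by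
        rw [hcomm, hfirst _ (E.inner_eq_zero' i)]
      rw [hx, hk]
      exact diagonal_coeff hρ (hq i) hK hΦ1 (hΦ.mul_add_two_nonneg _ hρ) rfl
        (E.mem i).le (by rw [hbe, if_neg hi]) (hfour i) (hsecond i hi)
  have htime : K' * ρ (z, t₀) + K t₀ * dirDeriv (0, 1) ρ (z, t₀)
      - (Φ (ρ (z, t₀)) + Φ₁ (ρ (z, t₀)) * R k + Φ₂ (ρ (z, t₀)) * r k ^ 2) ≤ 0 := by
    have hd : HasDerivAt (fun s => pinching K h ρ (e k) (z, t₀ + s))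
        (K' * ρ (z, t₀) + K t₀ * dirDeriv (0, 1) ρ (z, t₀)
          - dirDeriv (0, 1) (hess h (e k) (e k)) (z, t₀)) 0 := by
      have d1 : HasDerivAt (fun s => K (t₀ + s)) K' 0 := by
        have : HasDerivAt K K' (t₀ + 0) := by simpa using hKd
        simpa using this.comp_const_add t₀ 0
      have d2 := IsLocalSol.hasDerivAt_time (S.smooth'.differentiableAt (by simp))
      have d3 := IsLocalSol.hasDerivAt_time
        ((S.hess_contDiffAt (e k) (e k)).differentiableAt (by simp))
      refine (((d1.mul d2).sub d3).congr_deriv ?_).congr_of_eventuallyEq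
        (Eventually.of_forall fun s => ?_)
      · simp only [add_zero]
      · simp [pinching, S.norm_eq, E.orthonormal.1, E.inner_eq_zero]
    have := nonpos_of_hasDerivAt_of_nonneg hd (by simpa using hzero)
      (((IsLocalSol.tendsto_time z t₀).eventually hnn).mono fun s hs hs0 =>
        hs (by simpa using hs0) _)
    rwa [S.dirDeriv_time_hess hΦ hf (E.orthonormal.1 k) (E.inner_eq_zero' k)] at this
  rw [S.dirDeriv_time_rho hΦ hf hfc E] at htime
  have hsum := E.sum_dualGrad_mul hf
  have hΦa := hΦ.mul_add_nonneg _ hρ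
  have hKQ : 0 ≤ K t₀ * ∑ i, dualGrad f μ i - 1 := by
    have h1 : ∑ i, dualGrad f μ i * μ i ≤ ∑ i, dualGrad f μ i * (K t₀ * ρ (z, t₀)) :=
      Finset.sum_le_sum fun i _ => mul_le_mul_of_nonneg_left (hμ i) (hq i)
    rw [hsum, ← Finset.sum_mul] at h1
    have h2 : 0 ≤ (K t₀ * ∑ i, dualGrad f μ i - 1) * ρ (z, t₀) := by linarith
    exact nonneg_of_mul_nonneg_left h2 hρ
  -- A single term of `∑ qᵢ μᵢ = ρ`, with `μₖ = Kρ`. It controls the direction `k`, where `Φ₂ rₖ²`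
  -- enters once from the Hessian of `h` and once with weight `K qₖ`.
  have hKq : K t₀ * dualGrad f μ k ≤ 1 := by
    have h1 : dualGrad f μ k * μ k ≤ ∑ i, dualGrad f μ i * μ i :=
      Finset.single_le_sum (f := fun i => dualGrad f μ i * μ i)
        (fun i _ => mul_nonneg (hq i) (E.mem i).le) (Finset.mem_univ k)
    rw [hsum, hk] at h1
    have h2 : (K t₀ * dualGrad f μ k) * ρ (z, t₀) ≤ 1 * ρ (z, t₀) := by linarith
    exact le_of_mul_le_mul_right h2 hρ
  rw [Finset.sum_sub_distrib, Finset.sum_ite_eq' Finset.univ k, if_pos (Finset.mem_univ k)] at hsumle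
  generalize ρ (z, t₀) = x at *
  have e1 : ∑ i, dualGrad f μ i * (K t₀ * (Φ₁ x * R i + Φ₂ x * r i ^ 2)
      - Φ₁ x * (K t₀ * x - μ i)) = K t₀ * (∑ i, dualGrad f μ i *
        (Φ x + Φ₁ x * R i + Φ₂ x * r i ^ 2)) - K t₀ * (∑ i, dualGrad f μ i) * (Φ x + Φ₁ x * x)
        + Φ₁ x * ∑ i, dualGrad f μ i * μ i := by
    simp only [Finset.mul_sum, Finset.sum_mul, ← Finset.sum_add_distrib, ← Finset.sum_sub_distrib]
    exact Finset.sum_congr rfl fun i _ => by ring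
  rw [e1, hsum] at hsumle
  -- The time inequality has become the statement that the sum of the three nonnegative quantities
  -- `p1`, `p2`, `p3`, the first strictly positive, is at most zero.
  have p1 : 0 < K' * x := by positivity
  have p2 : 0 ≤ (K t₀ * ∑ i, dualGrad f μ i - 1) * (Φ₁ x * x + Φ x) := by positivity
  have p3 : 0 ≤ (1 - K t₀ * dualGrad f μ k) * (-Φ₂ x * r k ^ 2) :=
    mul_nonneg (sub_nonneg.2 hKq) (mul_nonneg (neg_nonneg.2 hΦ2) (sq_nonneg _))
  linarith

end Diagonal

/-! ### Global convexity of locally strictly convex boundaries -/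

section Convexity

theorem IsPreconnected.subset_of_disjoint_frontier {α : Type*} [TopologicalSpace α] {S U : Set α}
    (hS : IsPreconnected S) (hd : Disjoint S (frontier U)) (hne : (S ∩ U).Nonempty) :
    S ⊆ interior U := by
  have hcov : S ⊆ interior U ∪ (closure U)ᶜ := by
    intro x hx
    by_cases h1 : x ∈ interior U
    · exact Or.inl h1
    · exact Or.inr fun h2 => hd.le_bot ⟨hx, h2, h1⟩
  refine hS.subset_left_of_subset_union isOpen_interior isClosed_closure.isOpen_compl
    (disjoint_compl_right.mono_left (interior_subset.trans subset_closure)) hcov ?_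
  obtain ⟨x, hx, hxU⟩ := hne
  refine ⟨x, hx, ?_⟩
  rcases hcov hx with h | h
  · exact h
  · exact absurd (subset_closure hxU) h

theorem exists_forall_of_locally {α : Type*} [TopologicalSpace α] [CompactSpace α]
    {P : ℝ → α → Prop} (hmono : ∀ C C' x, C ≤ C' → P C x → P C' x)
    (hloc : ∀ x, ∃ C, ∀ᶠ y in 𝓝 x, P C y) : ∃ C, ∀ x, P C x := by
  have := isCompact_univ.induction_on (p := fun s : Set α => ∃ C, ∀ x ∈ s, P C x)
    ⟨0, by simp⟩ (fun s t hst ⟨C, hC⟩ => ⟨C, fun x hx => hC x (hst hx)⟩)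
    (fun s t ⟨C, hC⟩ ⟨D, hD⟩ => ⟨max C D, fun x hx => hx.elim
      (fun h => hmono _ _ _ (le_max_left _ _) (hC x h))
      (fun h => hmono _ _ _ (le_max_right _ _) (hD x h))⟩)
    (fun x _ => by
      obtain ⟨C, hC⟩ := hloc x
      exact ⟨{y | P C y}, mem_nhdsWithin_of_mem_nhds hC, C, fun y hy => hy⟩)
  obtain ⟨C, hC⟩ := this
  exact ⟨C, fun x => hC x trivial⟩

variable {n : ℕ} {M : Type*} [TopologicalSpace M]

/-- A compact connected boundary in Euclidean space with a continuous outward unit normal, in a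
form that does not refer to a smooth structure. -/
structure IsBoundary (Y N : M → Ambient n) (Ω : Set (Ambient n)) : Prop where
  embedding : IsEmbedding Y
  continuous_normal : Continuous N
  norm_normal : ∀ x, ‖N x‖ = 1
  isOpen : IsOpen Ω
  frontier_eq : frontier Ω = range Y
  outward : ∀ x, ∀ᶠ s in 𝓝[>] (0 : ℝ), Y x - s • N x ∈ Ω ∧ Y x + s • N x ∉ closure Ω
  normal_of_nearest : ∀ x q, (∀ y, ‖Y x - q‖ ≤ ‖Y y - q‖) → ∃ s : ℝ, q = Y x - s • N x

variable {Y N : M → Ambient n} {Ω : Set (Ambient n)}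

theorem exists_upper_bound [CompactSpace M] (hB : IsBoundary Y N Ω)
    (hup : ∀ x, ∃ C, ∀ᶠ p in 𝓝 (x, x),
      2 * inner ℝ (Y p.1 - Y p.2) (N p.1) ≤ C * ‖Y p.1 - Y p.2‖ ^ 2) :
    ∃ C, 0 < C ∧ ∀ x y, 2 * inner ℝ (Y x - Y y) (N x) ≤ C * ‖Y x - Y y‖ ^ 2 := by
  have hYc := hB.embedding.continuous
  have hNc := hB.continuous_normal
  obtain ⟨C, hC⟩ := exists_forall_of_locally
    (P := fun C (p : M × M) => 2 * inner ℝ (Y p.1 - Y p.2) (N p.1) ≤ C * ‖Y p.1 - Y p.2‖ ^ 2)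
    (fun C C' p h hp => hp.trans (by gcongr)) fun p => by
      obtain ⟨x, y⟩ := p
      by_cases hxy : x = y
      · subst hxy; exact hup x
      · have hpos : 0 < ‖Y x - Y y‖ ^ 2 := by
          have : Y x - Y y ≠ 0 := sub_ne_zero.2 fun h => hxy (hB.embedding.injective h)
          positivity
        refine ⟨2 * inner ℝ (Y x - Y y) (N x) / ‖Y x - Y y‖ ^ 2 + 1, ?_⟩
        have hc : Continuous fun p : M × M => (2 * inner ℝ (Y x - Y y) (N x) / ‖Y x - Y y‖ ^ 2 + 1)
          * ‖Y p.1 - Y p.2‖ ^ 2 - 2 * inner ℝ (Y p.1 - Y p.2) (N p.1) := by fun_prop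
        have h0 : 0 < (2 * inner ℝ (Y x - Y y) (N x) / ‖Y x - Y y‖ ^ 2 + 1)
          * ‖Y x - Y y‖ ^ 2 - 2 * inner ℝ (Y x - Y y) (N x) := by
          rw [add_mul, div_mul_cancel₀ _ hpos.ne']; linarith
        filter_upwards [hc.continuousAt.eventually (lt_mem_nhds (a := 0) (b := _) h0)] with q hq
        linarith
  refine ⟨max C 1, lt_max_of_lt_right one_pos, fun x y => (hC (x, y)).trans ?_⟩
  gcongr
  exact le_max_left _ _

/-- The chord bound says that no boundary point lies in the ball of radius `C⁻¹` touching at `x`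
from inside; the ball is connected and meets `Ω` near `x`. -/
theorem ball_subset (hB : IsBoundary Y N Ω) {C : ℝ} (hC0 : 0 < C)
    (hC : ∀ x y, 2 * inner ℝ (Y x - Y y) (N x) ≤ C * ‖Y x - Y y‖ ^ 2) (x : M) :
    Metric.ball (Y x - C⁻¹ • N x) C⁻¹ ⊆ Ω := by
  have hr : 0 < C⁻¹ := inv_pos.2 hC0
  rw [← hB.isOpen.interior_eq]
  refine IsPreconnected.subset_of_disjoint_frontier (convex_ball _ _).isPreconnected ?_ ?_
  · rw [hB.frontier_eq, Set.disjoint_right]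
    rintro _ ⟨y, rfl⟩ hy
    rw [Metric.mem_ball, dist_eq_norm] at hy
    have e : Y y - (Y x - C⁻¹ • N x) = C⁻¹ • N x - (Y x - Y y) := by abel
    have h1 : ‖Y y - (Y x - C⁻¹ • N x)‖ ^ 2 = C⁻¹ ^ 2 - C⁻¹ * (2 * inner ℝ (Y x - Y y) (N x))
        + ‖Y x - Y y‖ ^ 2 := by
      rw [e, norm_sub_sq_real, norm_smul, hB.norm_normal, inner_smul_left, real_inner_comm,
        Real.norm_eq_abs, mul_one, sq_abs, RCLike.conj_to_real]
      ring
    have h2 := mul_le_mul_of_nonneg_left (hC x y) hr.le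
    rw [← mul_assoc C⁻¹ C, inv_mul_cancel₀ hC0.ne', one_mul] at h2
    have h3 : C⁻¹ ^ 2 ≤ ‖Y y - (Y x - C⁻¹ • N x)‖ ^ 2 := by rw [h1]; linarith
    exact absurd hy (not_lt.2 (abs_le_of_sq_le_sq' h3 (norm_nonneg _)).2)
  · have h1 : ∀ᶠ s in 𝓝[>] (0 : ℝ), s < C⁻¹ := mem_nhdsWithin_of_mem_nhds (gt_mem_nhds hr)
    obtain ⟨s, ⟨⟨hs1, -⟩, hs2⟩, hs3⟩ := ((hB.outward x).and h1 |>.and self_mem_nhdsWithin).exists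
    refine ⟨Y x - s • N x, ?_, hs1⟩
    have e : Y x - s • N x - (Y x - C⁻¹ • N x) = (C⁻¹ - s) • N x := by module
    rw [Metric.mem_ball, dist_eq_norm, e, norm_smul, hB.norm_normal, mul_one, Real.norm_eq_abs,
      abs_of_pos (sub_pos.2 hs2)]
    linarith [show (0 : ℝ) < s from hs3]

/-- The centres of the interior touching balls depend continuously on `x ∈ M`, so by connectedness
of `M` they lie in one component of `Ω`. Any point of `Ω` joins that component through the largest
ball around it, which touches the boundary at a nearest point and overlaps the interior ball there.
-/
theorem isPreconnected_interior [CompactSpace M] [ConnectedSpace M] (hB : IsBoundary Y N Ω)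
    {C : ℝ} (hC0 : 0 < C)
    (hC : ∀ x y, 2 * inner ℝ (Y x - Y y) (N x) ≤ C * ‖Y x - Y y‖ ^ 2) : IsPreconnected Ω := by
  have hr : 0 < C⁻¹ := inv_pos.2 hC0
  have hball := ball_subset hB hC0 hC
  have hmem : ∀ x, Y x - C⁻¹ • N x ∈ Ω := fun x => hball x (Metric.mem_ball_self hr)
  have hloc : IsLocallyConstant fun x => connectedComponentIn Ω (Y x - C⁻¹ • N x) := by
    rw [IsLocallyConstant.iff_eventually_eq]
    intro x
    have hc : Continuous fun x => Y x - C⁻¹ • N x := by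
      have h1 := hB.embedding.continuous
      have h2 := hB.continuous_normal
      fun_prop
    filter_upwards [hc.continuousAt.eventually (Metric.ball_mem_nhds _ hr)] with y hy
    refine (connectedComponentIn_eq ?_).symm
    exact (convex_ball _ _).isPreconnected.subset_connectedComponentIn (Metric.mem_ball_self hr)
      (hball x) hy
  obtain ⟨x₀⟩ := (inferInstance : Nonempty M)
  have hall : Ω ⊆ connectedComponentIn Ω (Y x₀ - C⁻¹ • N x₀) := by
    intro q hq
    obtain ⟨x, hx⟩ := (isCompact_univ (X := M)).exists_isMinOn univ_nonempty
      (f := fun x => ‖Y x - q‖) (by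
        have := hB.embedding.continuous
        fun_prop) |>.imp fun x hx => hx.2
    have hx' : ∀ y, ‖Y x - q‖ ≤ ‖Y y - q‖ := fun y => hx (mem_univ y)
    obtain ⟨s, hs⟩ := hB.normal_of_nearest x q hx'
    have hYx : Y x ∉ Ω := by
      have : Y x ∈ frontier Ω := by rw [hB.frontier_eq]; exact mem_range_self x
      rw [hB.isOpen.frontier_eq] at this
      exact this.2
    have hs0 : s ≠ 0 := by
      rintro rfl
      rw [zero_smul, sub_zero] at hs
      exact hYx (hs ▸ hq)
    have hdist : ‖Y x - q‖ = |s| := by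
      rw [hs, sub_sub_cancel, norm_smul, hB.norm_normal, mul_one, Real.norm_eq_abs]
    have hsub : Metric.ball q |s| ⊆ Ω := by
      rw [← hB.isOpen.interior_eq]
      refine IsPreconnected.subset_of_disjoint_frontier (convex_ball _ _).isPreconnected ?_
        ⟨q, Metric.mem_ball_self (abs_pos.2 hs0), hq⟩
      rw [hB.frontier_eq, Set.disjoint_right]
      rintro _ ⟨y, rfl⟩ hy
      rw [Metric.mem_ball, dist_eq_norm] at hy
      linarith [hx' y]
    -- For `s < 0` the ball about `q` would reach the outer side of the boundary at `x`, although it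
    -- is contained in `Ω`.
    have hspos : 0 < s := by
      by_contra! hneg
      have hneg : s < 0 := lt_of_le_of_ne hneg hs0
      have h1 : ∀ᶠ σ in 𝓝[>] (0 : ℝ), σ < -s :=
        mem_nhdsWithin_of_mem_nhds (gt_mem_nhds (by linarith))
      obtain ⟨σ, ⟨⟨-, h2⟩, h3⟩, h4⟩ := ((hB.outward x).and h1 |>.and self_mem_nhdsWithin).exists
      refine h2 (subset_closure (hsub ?_))
      have e : Y x + σ • N x - q = (s + σ) • N x := by rw [hs]; module
      rw [Metric.mem_ball, dist_eq_norm, e, norm_smul, hB.norm_normal, mul_one, Real.norm_eq_abs,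
        abs_of_neg hneg, abs_lt]
      constructor <;> linarith [show (0 : ℝ) < σ from h4]
    have hcomp : connectedComponentIn Ω (Y x₀ - C⁻¹ • N x₀)
        = connectedComponentIn Ω (Y x - C⁻¹ • N x) :=
      hloc.apply_eq_of_preconnectedSpace x₀ x
    rw [hcomp]
    obtain ⟨σ, hσ, hσs, hσr⟩ : ∃ σ, 0 < σ ∧ σ < s ∧ σ < C⁻¹ := by
      obtain ⟨σ, h1, h2⟩ := exists_between (lt_min hspos hr)
      exact ⟨σ, h1, h2.trans_le (min_le_left _ _), h2.trans_le (min_le_right _ _)⟩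
    have hp1 : Y x - σ • N x ∈ Metric.ball q |s| := by
      have e : Y x - σ • N x - q = (s - σ) • N x := by
        rw [hs]; module
      rw [Metric.mem_ball, dist_eq_norm, e, norm_smul, hB.norm_normal, mul_one, Real.norm_eq_abs,
        abs_of_pos hspos, abs_lt]
      constructor <;> linarith
    have hp2 : Y x - σ • N x ∈ Metric.ball (Y x - C⁻¹ • N x) C⁻¹ := by
      have e : Y x - σ • N x - (Y x - C⁻¹ • N x) = (C⁻¹ - σ) • N x := by module
      rw [Metric.mem_ball, dist_eq_norm, e, norm_smul, hB.norm_normal, mul_one, Real.norm_eq_abs,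
        abs_lt]
      constructor <;> linarith
    have hu : IsPreconnected (Metric.ball q |s| ∪ Metric.ball (Y x - C⁻¹ • N x) C⁻¹) :=
      IsPreconnected.union _ hp1 hp2 (convex_ball _ _).isPreconnected (convex_ball _ _).isPreconnected
    exact hu.subset_connectedComponentIn (Or.inr (Metric.mem_ball_self hr))
      (union_subset hsub (hball x)) (Or.inl (Metric.mem_ball_self (abs_pos.2 hs0)))
  have := (connectedComponentIn_subset Ω (Y x₀ - C⁻¹ • N x₀)).antisymm hall
  rw [← this]
  exact isPreconnected_connectedComponentIn

/-- The closed half ball on the outer side of the tangent plane, without its centre, is star-shaped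
about the exterior point `Y x + s N x` and contains no boundary point, so it lies outside `closure
Ω`. -/
theorem exists_local_support (hB : IsBoundary Y N Ω) (x : M)
    (hlow : ∃ c, 0 < c ∧ ∀ᶠ p in 𝓝 (x, x),
      c * ‖Y p.1 - Y p.2‖ ^ 2 ≤ 2 * inner ℝ (Y p.1 - Y p.2) (N p.1)) :
    ∃ r, 0 < r ∧ ∀ q ∈ closure Ω, ‖q - Y x‖ < r → q ≠ Y x → inner ℝ (q - Y x) (N x) < 0 := by
  obtain ⟨c, hc, hlow⟩ := hlow
  have h1 : ∀ᶠ y in 𝓝 x, c * ‖Y x - Y y‖ ^ 2 ≤ 2 * inner ℝ (Y x - Y y) (N x) := by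
    have : Tendsto (fun y : M => (x, y)) (𝓝 x) (𝓝 (x, x)) := by
      have : Continuous fun y : M => (x, y) := by fun_prop
      exact this.tendsto x
    exact this.eventually hlow
  rw [hB.embedding.nhds_eq_comap, eventually_comap] at h1
  obtain ⟨r, hr, hr'⟩ := Metric.eventually_nhds_iff_ball.1 h1
  refine ⟨r, hr, fun q hq hqr hqx => ?_⟩
  by_contra! hin
  set H : Set (Ambient n) := {p | ‖p - Y x‖ < r ∧ 0 ≤ inner ℝ (p - Y x) (N x) ∧ p ≠ Y x} with hH
  have hdisj : Disjoint H (frontier Ω) := by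
    rw [hB.frontier_eq, Set.disjoint_right]
    rintro _ ⟨y, rfl⟩ ⟨hy1, hy2, hy3⟩
    have h2 := hr' (Y y) (by rwa [Metric.mem_ball, dist_eq_norm]) y rfl
    have h3 : 0 < ‖Y x - Y y‖ ^ 2 := by
      have : Y x - Y y ≠ 0 := sub_ne_zero.2 hy3.symm
      positivity
    have h4 : inner ℝ (Y x - Y y) (N x) = -inner ℝ (Y y - Y x) (N x) := by
      rw [← inner_neg_left, neg_sub]
    nlinarith [mul_pos hc h3]
  have h2 : ∀ᶠ s in 𝓝[>] (0 : ℝ), s < r := mem_nhdsWithin_of_mem_nhds (gt_mem_nhds hr)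
  obtain ⟨s, ⟨⟨-, hs1⟩, hs2⟩, hs3⟩ := ((hB.outward x).and h2 |>.and self_mem_nhdsWithin).exists
  have hs3 : 0 < s := hs3
  have hNN : inner ℝ (N x) (N x) = (1 : ℝ) := by
    rw [real_inner_self_eq_norm_sq, hB.norm_normal]; norm_num
  have hsm : Y x + s • N x ∈ H := by
    refine ⟨?_, ?_, ?_⟩
    · rw [add_sub_cancel_left, norm_smul, hB.norm_normal, mul_one, Real.norm_eq_abs, abs_of_pos hs3]
      exact hs2
    · rw [add_sub_cancel_left, inner_smul_left, hNN]; simpa using hs3.le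
    · intro h0
      have h5 : s • N x = 0 := by simpa using h0
      have := congrArg norm h5
      rw [norm_smul, hB.norm_normal, Real.norm_eq_abs, abs_of_pos hs3, norm_zero] at this
      linarith
  have hconn : IsPreconnected H := by
    refine isPreconnected_of_forall (Y x + s • N x) fun p hp => ?_
    refine ⟨segment ℝ (Y x + s • N x) p, ?_, left_mem_segment _ _ _, right_mem_segment _ _ _,
      (convex_segment _ _).isPreconnected⟩
    rintro _ ⟨a, b, ha, hb, hab, rfl⟩
    have e : a • (Y x + s • N x) + b • p - Y x = a • (s • N x) + b • (p - Y x) := by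
      have : a = 1 - b := by linarith
      subst this; module
    have hine : inner ℝ (a • (Y x + s • N x) + b • p - Y x) (N x)
        = a * s + b * inner ℝ (p - Y x) (N x) := by
      rw [e, inner_add_left, inner_smul_left, inner_smul_left, inner_smul_left, hNN]; simp
    refine ⟨?_, ?_, ?_⟩
    · have hcv := (convex_ball (Y x) r) (x := Y x + s • N x) (y := p)
        (by rw [Metric.mem_ball, dist_eq_norm]; exact hsm.1)
        (by rw [Metric.mem_ball, dist_eq_norm]; exact hp.1) ha hb hab
      rwa [Metric.mem_ball, dist_eq_norm] at hcv
    · rw [hine]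
      have := hp.2.1
      positivity
    · intro h0
      rw [h0, sub_self, inner_zero_left] at hine
      have h6 : 0 ≤ b * inner ℝ (p - Y x) (N x) := mul_nonneg hb hp.2.1
      have ha0 : a = 0 := by
        by_contra hne
        have : 0 < a * s := mul_pos (lt_of_le_of_ne ha (Ne.symm hne)) hs3
        linarith
      have hb1 : b = 1 := by linarith
      rw [ha0, hb1, zero_smul, one_smul, zero_add] at h0
      exact hp.2.2 h0
  have hsub := IsPreconnected.subset_of_disjoint_frontier (U := (closure Ω)ᶜ) hconn
    (hdisj.mono_right (by rw [frontier_compl]; exact frontier_closure_subset))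
    ⟨_, hsm, hs1⟩
  exact interior_subset (hsub ⟨hqr, hin, hqx⟩) hq

/-- Tietze–Nakajima: the points of `Ω` joined to `p` by a segment inside `Ω` form an open and
relatively closed set, and `Ω` is connected. -/
theorem convex_interior (hB : IsBoundary Y N Ω) (hconn : IsPreconnected Ω)
    (hsupp : ∀ x, ∃ r, 0 < r ∧ ∀ q ∈ closure Ω, ‖q - Y x‖ < r → q ≠ Y x →
      inner ℝ (q - Y x) (N x) < 0) : Convex ℝ Ω := by
  rw [convex_iff_segment_subset]
  intro p hp q₀ hq₀
  set G : Set (Ambient n) := {q | segment ℝ p q ⊆ Ω} with hG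
  have himg : ∀ q, segment ℝ p q = (fun θ : ℝ => p + θ • (q - p)) '' Icc 0 1 :=
    fun q => segment_eq_image' ℝ p q
  have hGopen : IsOpen G := by
    rw [isOpen_iff_mem_nhds]
    intro q hq
    have hc : Continuous fun x : Ambient n × ℝ => p + x.2 • (x.1 - p) := by fun_prop
    have h1 : ∀ θ ∈ Icc (0 : ℝ) 1, ∀ᶠ x in 𝓝 q ×ˢ 𝓝 θ, p + x.2 • (x.1 - p) ∈ Ω := by
      intro θ hθ
      rw [← nhds_prod_eq]
      refine hc.continuousAt.eventually (hB.isOpen.mem_nhds (hq ?_))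
      rw [himg]; exact ⟨θ, hθ, rfl⟩
    have h2 := (isCompact_Icc (a := (0 : ℝ)) (b := 1)).eventually_forall_of_forall_eventually
      (x₀ := q) (P := fun x θ => p + θ • (x - p) ∈ Ω) (fun θ hθ => by
        have := h1 θ hθ; rwa [← nhds_prod_eq] at this)
    filter_upwards [h2] with x hx
    show segment ℝ p x ⊆ Ω
    rw [himg]
    rintro _ ⟨θ, hθ, rfl⟩
    exact hx θ hθ
  have hGclosed : ∀ q ∈ Ω, q ∈ closure G → q ∈ G := by
    intro q hq hqc
    have hseg : segment ℝ p q ⊆ closure Ω := by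
      rw [himg]
      rintro _ ⟨θ, hθ, rfl⟩
      have hc : Continuous fun x : Ambient n => p + θ • (x - p) := by fun_prop
      exact map_mem_closure (f := fun x => p + θ • (x - p)) hc hqc fun x hx =>
        (show segment ℝ p x ⊆ Ω from hx) (by rw [himg]; exact ⟨θ, hθ, rfl⟩)
    intro m hm
    by_contra hmΩ
    have hmf : m ∈ frontier Ω := by
      rw [hB.isOpen.frontier_eq]; exact ⟨hseg hm, hmΩ⟩
    rw [hB.frontier_eq] at hmf
    obtain ⟨x, rfl⟩ := hmf
    obtain ⟨r, hr, hr'⟩ := hsupp x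
    have hm2 := hm
    rw [himg] at hm2
    obtain ⟨θ, hθ, hθm⟩ := hm2
    have hθ0 : θ ≠ 0 := by rintro rfl; exact hmΩ (by simpa [← hθm] using hp)
    have hθ1 : θ ≠ 1 := by rintro rfl; exact hmΩ (by simpa [← hθm] using hq)
    have hθ0' : 0 < θ := lt_of_le_of_ne hθ.1 (Ne.symm hθ0)
    have hθ1' : θ < 1 := lt_of_le_of_ne hθ.2 hθ1
    have hv : q - p ≠ 0 := by
      intro h0
      apply hmΩ
      have : p + θ • (q - p) = p := by rw [h0, smul_zero, add_zero]
      rw [← hθm]; simpa [this] using hp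
    -- A limiting segment that meets the boundary at an inner point extends from there in both
    -- directions inside `closure Ω`; local strict support would make `s` and `-s` both give a
    -- negative product.
    have hpt : ∀ s : ℝ, |s| < θ → |s| < 1 - θ → |s| * ‖q - p‖ < r → s ≠ 0 →
        s * inner ℝ (q - p) (N x) < 0 := by
      intro s h1 h2 h3 h4
      rw [abs_lt] at h1 h2
      have hmem : Y x + s • (q - p) ∈ closure Ω := by
        apply hseg
        rw [himg]
        exact ⟨θ + s, ⟨by linarith, by linarith⟩, by rw [← hθm]; module⟩
      have := hr' _ hmem (by rwa [add_sub_cancel_left, norm_smul, Real.norm_eq_abs])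
        (by simpa using ⟨h4, hv⟩)
      rwa [add_sub_cancel_left, inner_smul_left, RCLike.conj_to_real] at this
    obtain ⟨s, hs0, hs1, hs2, hs3⟩ : ∃ s : ℝ, 0 < s ∧ s < θ ∧ s < 1 - θ ∧ s * ‖q - p‖ < r := by
      have hvn : 0 < ‖q - p‖ := norm_pos_iff.2 hv
      set s₀ := min (min θ (1 - θ)) (r / ‖q - p‖)
      have : 0 < s₀ := lt_min (lt_min hθ0' (by linarith)) (by positivity)
      refine ⟨s₀ / 2, by linarith, ?_, ?_, ?_⟩
      · linarith [(min_le_left _ _ : s₀ ≤ _).trans (min_le_left _ _)]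
      · linarith [(min_le_left _ _ : s₀ ≤ _).trans (min_le_right _ _)]
      · rw [← lt_div_iff₀ hvn]
        linarith [(min_le_right _ _ : s₀ ≤ r / ‖q - p‖)]
    have a1 := hpt s (by rwa [abs_of_pos hs0]) (by rwa [abs_of_pos hs0]) (by rwa [abs_of_pos hs0])
      hs0.ne'
    have a2 := hpt (-s) (by rwa [abs_neg, abs_of_pos hs0]) (by rwa [abs_neg, abs_of_pos hs0])
      (by rwa [abs_neg, abs_of_pos hs0]) (neg_ne_zero.2 hs0.ne')
    linarith
  have hsub : Ω ⊆ G := by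
    have hpG : p ∈ G := by
      show segment ℝ p p ⊆ Ω
      simpa using hp
    have hcov : Ω ⊆ G ∪ (closure G)ᶜ := by
      intro q hq
      by_cases h : q ∈ closure G
      · exact Or.inl (hGclosed q hq h)
      · exact Or.inr h
    exact hconn.subset_left_of_subset_union hGopen isClosed_closure.isOpen_compl
      (disjoint_compl_right.mono_left subset_closure) hcov ⟨p, hp, hpG⟩
  exact hsub hq₀

/-- A short piece of the chord from `Y x` towards `Y y` stays in the convex set `closure Ω`, so the
local support property suffices. -/
theorem inner_pos_of_convex (hB : IsBoundary Y N Ω) (hΩ : Convex ℝ Ω)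
    (hsupp : ∀ x, ∃ r, 0 < r ∧ ∀ q ∈ closure Ω, ‖q - Y x‖ < r → q ≠ Y x →
      inner ℝ (q - Y x) (N x) < 0) {x y : M} (hxy : x ≠ y) :
    0 < inner ℝ (Y x - Y y) (N x) := by
  obtain ⟨r, hr, hr'⟩ := hsupp x
  have hcl : ∀ x, Y x ∈ closure Ω := fun x => by
    have : Y x ∈ frontier Ω := by rw [hB.frontier_eq]; exact mem_range_self x
    exact this.1
  have hv : Y y - Y x ≠ 0 := sub_ne_zero.2 fun h => hxy (hB.embedding.injective h.symm)
  have hvn : 0 < ‖Y y - Y x‖ := norm_pos_iff.2 hv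
  set θ := min 1 (r / ‖Y y - Y x‖ / 2)
  have hθ : 0 < θ := lt_min one_pos (by positivity)
  have hmem := hΩ.closure.add_smul_sub_mem (hcl x) (hcl y) ⟨hθ.le, min_le_left _ _⟩
  have := hr' _ hmem ?_ ?_
  · rw [add_sub_cancel_left, inner_smul_left, RCLike.conj_to_real] at this
    have h1 : inner ℝ (Y y - Y x) (N x) < 0 := by
      by_contra! h
      linarith [mul_nonneg hθ.le h]
    rw [← neg_sub, inner_neg_left]
    linarith
  · rw [add_sub_cancel_left, norm_smul, Real.norm_eq_abs, abs_of_pos hθ, ← lt_div_iff₀ hvn]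
    have : 0 < r / ‖Y y - Y x‖ := by positivity
    linarith [(min_le_right _ _ : θ ≤ r / ‖Y y - Y x‖ / 2)]
  · simpa using ⟨hθ.ne', hv⟩

theorem exists_lower_bound [CompactSpace M] (hB : IsBoundary Y N Ω)
    (hpos : ∀ x y, x ≠ y → 0 < inner ℝ (Y x - Y y) (N x))
    (hlow : ∀ x, ∃ c, 0 < c ∧ ∀ᶠ p in 𝓝 (x, x),
      c * ‖Y p.1 - Y p.2‖ ^ 2 ≤ 2 * inner ℝ (Y p.1 - Y p.2) (N p.1)) :
    ∃ c, 0 < c ∧ ∀ x y, c * ‖Y x - Y y‖ ^ 2 ≤ 2 * inner ℝ (Y x - Y y) (N x) := by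
  have hYc := hB.embedding.continuous
  have hNc := hB.continuous_normal
  have hnn : ∀ x y, 0 ≤ inner ℝ (Y x - Y y) (N x) := by
    intro x y
    by_cases hxy : x = y
    · subst hxy; simp
    · exact (hpos x y hxy).le
  obtain ⟨C, hC⟩ := exists_forall_of_locally
    (P := fun C (p : M × M) => ‖Y p.1 - Y p.2‖ ^ 2 ≤ C * (2 * inner ℝ (Y p.1 - Y p.2) (N p.1)))
    (fun C C' p h hp => hp.trans (by have := hnn p.1 p.2; gcongr)) fun p => by
      obtain ⟨x, y⟩ := p
      by_cases hxy : x = y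
      · subst hxy
        obtain ⟨c, hc, h⟩ := hlow x
        refine ⟨c⁻¹, h.mono fun p hp => ?_⟩
        rw [inv_mul_eq_div, le_div_iff₀ hc]; linarith
      · have h0 := hpos x y hxy
        refine ⟨‖Y x - Y y‖ ^ 2 / (2 * inner ℝ (Y x - Y y) (N x)) + 1, ?_⟩
        have hc : Continuous fun p : M × M => (‖Y x - Y y‖ ^ 2 / (2 * inner ℝ (Y x - Y y) (N x)) + 1)
          * (2 * inner ℝ (Y p.1 - Y p.2) (N p.1)) - ‖Y p.1 - Y p.2‖ ^ 2 := by fun_prop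
        have h1 : 0 < (‖Y x - Y y‖ ^ 2 / (2 * inner ℝ (Y x - Y y) (N x)) + 1)
          * (2 * inner ℝ (Y x - Y y) (N x)) - ‖Y x - Y y‖ ^ 2 := by
          rw [add_mul, div_mul_cancel₀ _ (by positivity)]; linarith
        filter_upwards [hc.continuousAt.eventually (lt_mem_nhds (a := 0) (b := _) h1)] with q hq
        linarith
  refine ⟨(max C 1)⁻¹, by positivity, fun x y => ?_⟩
  rw [inv_mul_eq_div, div_le_iff₀ (by positivity)]
  refine (hC (x, y)).trans ?_
  rw [mul_comm (2 * _)]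
  have := hnn x y
  gcongr
  exact le_max_left _ _

end Convexity

/-! ### Second order expansion of a moving hypersurface in a chart -/

section Expansion

variable {E A : Type*} [NormedAddCommGroup E] [NormedSpace ℝ E]
  [NormedAddCommGroup A] [InnerProductSpace ℝ A]

/-- The derivative of `Y (·, t)`. -/
def sliceDeriv (Y : E × ℝ → A) (p : E × ℝ) : E →L[ℝ] A := fderiv ℝ (fun u => Y (u, p.2)) p.1

variable {O : Set E} {J : Set ℝ} {Y V : E × ℝ → A}

theorem hasFDerivAt_slice_within (hO : IsOpen O)
    (hY : ContDiffOn ℝ ∞ Y (O ×ˢ J)) {u : E} {t : ℝ} (hu : u ∈ O) (ht : t ∈ J) :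
    HasFDerivAt (fun v => Y (v, t))
      ((fderivWithin ℝ Y (O ×ˢ J) (u, t)).comp (ContinuousLinearMap.inl ℝ E ℝ)) u := by
  have h1 := ((hY.differentiableOn (by simp)) (u, t) ⟨hu, ht⟩).hasFDerivWithinAt
  have h2 : HasFDerivWithinAt (fun v : E => (v, t)) (ContinuousLinearMap.inl ℝ E ℝ) O u :=
    (hasFDerivAt_prodMk_left u t).hasFDerivWithinAt
  have h3 := h1.comp u h2 (fun v hv => Set.mk_mem_prod hv ht)
  exact h3.hasFDerivAt (hO.mem_nhds hu)

theorem sliceDeriv_eq (hO : IsOpen O) (hY : ContDiffOn ℝ ∞ Y (O ×ˢ J)) {p : E × ℝ}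
    (hp : p ∈ O ×ˢ J) : sliceDeriv Y p
      = (fderivWithin ℝ Y (O ×ˢ J) p).comp (ContinuousLinearMap.inl ℝ E ℝ) :=
  (hasFDerivAt_slice_within hO hY hp.1 hp.2).fderiv

theorem hasFDerivAt_slice (hO : IsOpen O)
    (hY : ContDiffOn ℝ ∞ Y (O ×ˢ J)) {u : E} {t : ℝ} (hu : u ∈ O) (ht : t ∈ J) :
    HasFDerivAt (fun v => Y (v, t)) (sliceDeriv Y (u, t)) u := by
  rw [sliceDeriv_eq hO hY ⟨hu, ht⟩]
  exact hasFDerivAt_slice_within hO hY hu ht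

theorem continuousOn_sliceDeriv (hO : IsOpen O) (hJ : UniqueDiffOn ℝ J)
    (hY : ContDiffOn ℝ ∞ Y (O ×ˢ J)) : ContinuousOn (sliceDeriv Y) (O ×ˢ J) := by
  have h1 := hY.continuousOn_fderivWithin (hO.uniqueDiffOn.prod hJ) (by simp)
  exact (h1.clm_comp continuousOn_const).congr fun p hp => sliceDeriv_eq hO hY hp

theorem eventually_ball (hO : IsOpen O) {u₀ : E} {t₀ : ℝ} (hu : u₀ ∈ O) {P : E × ℝ → Prop}
    (h : ∀ᶠ p in 𝓝[O ×ˢ J] (u₀, t₀), P p) :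
    ∃ δ, 0 < δ ∧ Metric.ball u₀ δ ⊆ O ∧
      ∀ᶠ t in 𝓝[J] t₀, t ∈ J ∧ ∀ u ∈ Metric.ball u₀ δ, P (u, t) := by
  rw [nhdsWithin_prod_eq, hO.nhdsWithin_eq hu, eventually_prod_iff] at h
  obtain ⟨a, ha, b, hb, hab⟩ := h
  obtain ⟨δ, hδ, hδ'⟩ := Metric.eventually_nhds_iff_ball.1 (ha.and (hO.mem_nhds hu))
  exact ⟨δ, hδ, fun u hu => (hδ' u hu).2,
    (hb.and self_mem_nhdsWithin).mono fun t ht => ⟨ht.2, fun u hu => hab (hδ' u hu).1 ht.1⟩⟩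

theorem eventually_ball_prod {u₀ : E} {t₀ : ℝ} {δ : ℝ} (hδ : 0 < δ) {P : ℝ → Prop}
    (h : ∀ᶠ t in 𝓝[J] t₀, P t) :
    ∀ᶠ q : E × E × ℝ in 𝓝 u₀ ×ˢ 𝓝 u₀ ×ˢ 𝓝[J] t₀,
      q.1 ∈ Metric.ball u₀ δ ∧ q.2.1 ∈ Metric.ball u₀ δ ∧ P q.2.2 := by
  have hb := Metric.ball_mem_nhds u₀ hδ
  exact (eventually_of_mem hb fun _ h => h).prod_mk
    ((eventually_of_mem hb fun _ h => h).prod_mk h) |>.mono fun q hq => ⟨hq.1, hq.2.1, hq.2.2⟩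

theorem isLittleO_slice_sub (hO : IsOpen O) (hJ : UniqueDiffOn ℝ J)
    (hY : ContDiffOn ℝ ∞ Y (O ×ˢ J)) {u₀ : E} {t₀ : ℝ} (hu : u₀ ∈ O) (ht : t₀ ∈ J) :
    (fun q : E × E × ℝ => Y (q.1, q.2.2) - Y (q.2.1, q.2.2)
      - sliceDeriv Y (u₀, t₀) (q.1 - q.2.1))
      =o[𝓝 u₀ ×ˢ 𝓝 u₀ ×ˢ 𝓝[J] t₀] fun q => q.1 - q.2.1 := by
  rw [Asymptotics.isLittleO_iff]
  intro ε hε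
  have h1 : ∀ᶠ p in 𝓝[O ×ˢ J] (u₀, t₀), ‖sliceDeriv Y p - sliceDeriv Y (u₀, t₀)‖ ≤ ε := by
    have := (continuousOn_sliceDeriv hO hJ hY (u₀, t₀) ⟨hu, ht⟩).eventually
      (Metric.closedBall_mem_nhds _ hε)
    filter_upwards [this] with p hp
    rwa [dist_eq_norm] at hp
  obtain ⟨δ, hδ, hδO, h2⟩ := eventually_ball hO hu h1
  filter_upwards [eventually_ball_prod hδ h2] with q ⟨hq1, hq2, hqJ, hq⟩
  exact (convex_ball u₀ δ).norm_image_sub_le_of_norm_hasFDerivWithin_le'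
    (fun v hv => (hasFDerivAt_slice hO hY (hδO hv) hqJ).hasFDerivWithinAt) hq hq2 hq1

/-- Along the chord, the derivative of `⟨Y(u + sd) - Y(u), V(u + sd)⟩` involves only the derivative
of `V`, since `V` is normal. First derivatives of `Y` and `V` therefore give the second order
expansion, locally uniformly in both points and in time. -/
theorem isLittleO_inner_normal (hO : IsOpen O) (hJ : UniqueDiffOn ℝ J)
    (hY : ContDiffOn ℝ ∞ Y (O ×ˢ J)) (hV : ContDiffOn ℝ ∞ V (O ×ˢ J))
    (hperp : ∀ p ∈ O ×ˢ J, ∀ d, inner ℝ (sliceDeriv Y p d) (V p) = 0)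
    {u₀ : E} {t₀ : ℝ} (hu : u₀ ∈ O) (ht : t₀ ∈ J) :
    (fun q : E × E × ℝ => 2 * inner ℝ (Y (q.1, q.2.2) - Y (q.2.1, q.2.2)) (V (q.1, q.2.2))
      - inner ℝ (sliceDeriv Y (u₀, t₀) (q.1 - q.2.1)) (sliceDeriv V (u₀, t₀) (q.1 - q.2.1)))
      =o[𝓝 u₀ ×ˢ 𝓝 u₀ ×ˢ 𝓝[J] t₀] fun q => ‖q.1 - q.2.1‖ ^ 2 := by
  set L := sliceDeriv Y (u₀, t₀) with hL
  set W := sliceDeriv V (u₀, t₀) with hW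
  rw [Asymptotics.isLittleO_iff]
  intro ε hε
  obtain ⟨η, hη, hη1, hηε⟩ : ∃ η : ℝ, 0 < η ∧ η ≤ 1 ∧ 2 * (η * (‖W‖ + 1 + ‖L‖)) ≤ ε := by
    have hpos : 0 < 2 * (‖W‖ + 1 + ‖L‖) := by positivity
    refine ⟨min 1 (ε / (2 * (‖W‖ + 1 + ‖L‖))), lt_min one_pos (by positivity), min_le_left _ _, ?_⟩
    have := min_le_right 1 (ε / (2 * (‖W‖ + 1 + ‖L‖)))
    rw [le_div_iff₀ hpos] at this
    linarith
  have h1 : ∀ᶠ p in 𝓝[O ×ˢ J] (u₀, t₀), ‖sliceDeriv Y p - L‖ ≤ η ∧ ‖sliceDeriv V p - W‖ ≤ η := by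
    have h1 := (continuousOn_sliceDeriv hO hJ hY (u₀, t₀) ⟨hu, ht⟩).eventually
      (Metric.closedBall_mem_nhds _ hη)
    have h2 := (continuousOn_sliceDeriv hO hJ hV (u₀, t₀) ⟨hu, ht⟩).eventually
      (Metric.closedBall_mem_nhds _ hη)
    filter_upwards [h1, h2] with p hp hp'
    rw [dist_eq_norm] at hp hp'
    exact ⟨hp, hp'⟩
  obtain ⟨δ, hδ, hδO, h2⟩ := eventually_ball hO hu h1
  filter_upwards [eventually_ball_prod hδ h2] with q ⟨hq1, hq2, hqJ, hq⟩
  obtain ⟨v, u, t⟩ := q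
  dsimp only at hq1 hq2 hqJ hq ⊢
  set d := v - u with hd
  have hmem : ∀ s ∈ Icc (0 : ℝ) 1, u + s • d ∈ Metric.ball u₀ δ := fun s hs =>
    (convex_ball u₀ δ).add_smul_sub_mem hq2 hq1 hs
  have hline : ∀ s : ℝ, HasDerivAt (fun s : ℝ => u + s • d) d s := fun s => by
    simpa using ((hasDerivAt_id s).smul_const d).const_add u
  have hYd : ∀ s ∈ Icc (0 : ℝ) 1, HasDerivAt (fun s : ℝ => Y (u + s • d, t))
      (sliceDeriv Y (u + s • d, t) d) s := fun s hs =>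
    (hasFDerivAt_slice hO hY (hδO (hmem s hs)) hqJ).comp_hasDerivAt (f := fun s : ℝ => u + s • d) s
      (hline s)
  have hVd : ∀ s ∈ Icc (0 : ℝ) 1, HasDerivAt (fun s : ℝ => V (u + s • d, t))
      (sliceDeriv V (u + s • d, t) d) s := fun s hs =>
    (hasFDerivAt_slice hO hV (hδO (hmem s hs)) hqJ).comp_hasDerivAt (f := fun s : ℝ => u + s • d) s
      (hline s)
  have hYs : ∀ s ∈ Icc (0 : ℝ) 1, ‖Y (u + s • d, t) - Y (u, t) - s • L d‖ ≤ η * ‖d‖ := by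
    intro s hs
    have := (convex_ball u₀ δ).norm_image_sub_le_of_norm_hasFDerivWithin_le'
      (fun v hv => (hasFDerivAt_slice hO hY (hδO hv) hqJ).hasFDerivWithinAt)
      (fun v hv => (hq v hv).1) hq2 (hmem s hs)
    rw [add_sub_cancel_left, map_smul, norm_smul, Real.norm_eq_abs, abs_of_nonneg hs.1] at this
    refine this.trans ?_
    have h0 := norm_nonneg d
    gcongr
    exact mul_le_of_le_one_left h0 hs.2
  have hg : ∀ s ∈ Icc (0 : ℝ) 1, HasDerivAt
      (fun s : ℝ => inner ℝ (Y (u + s • d, t) - Y (u, t)) (V (u + s • d, t))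
        - s ^ 2 / 2 * inner ℝ (L d) (W d))
      (inner ℝ (Y (u + s • d, t) - Y (u, t)) (sliceDeriv V (u + s • d, t) d)
        - s * inner ℝ (L d) (W d)) s := by
    intro s hs
    have h3 := ((hYd s hs).sub_const (Y (u, t))).inner ℝ (hVd s hs)
    rw [hperp _ ⟨hδO (hmem s hs), hqJ⟩, add_zero] at h3
    have h4 := ((hasDerivAt_pow 2 s).div_const 2).mul_const (inner ℝ (L d) (W d))
    refine (h3.sub h4).congr_deriv ?_
    norm_num
  have hbd : ∀ s ∈ Ico (0 : ℝ) 1, ‖inner ℝ (Y (u + s • d, t) - Y (u, t))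
      (sliceDeriv V (u + s • d, t) d) - s * inner ℝ (L d) (W d)‖
      ≤ η * (‖W‖ + 1 + ‖L‖) * ‖d‖ ^ 2 := by
    intro s hs
    have hs' : s ∈ Icc (0 : ℝ) 1 := ⟨hs.1, hs.2.le⟩
    have e : inner ℝ (Y (u + s • d, t) - Y (u, t)) (sliceDeriv V (u + s • d, t) d)
        - s * inner ℝ (L d) (W d)
        = inner ℝ (Y (u + s • d, t) - Y (u, t) - s • L d) (sliceDeriv V (u + s • d, t) d)
          + s * inner ℝ (L d) ((sliceDeriv V (u + s • d, t) - W) d) := by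
      rw [inner_sub_left _ (s • L d), inner_smul_left, sub_apply, inner_sub_right]
      simp only [RCLike.conj_to_real]
      ring
    rw [e]
    have hV1 : ‖sliceDeriv V (u + s • d, t)‖ ≤ ‖W‖ + 1 := by
      have := norm_le_norm_add_norm_sub' (sliceDeriv V (u + s • d, t)) W
      have := (hq _ (hmem s hs')).2
      linarith
    have b1 : ‖(inner ℝ (Y (u + s • d, t) - Y (u, t) - s • L d) (sliceDeriv V (u + s • d, t) d) : ℝ)‖
        ≤ (η * ‖d‖) * ((‖W‖ + 1) * ‖d‖) :=
      (norm_inner_le_norm _ _).trans (mul_le_mul (hYs s hs')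
        ((ContinuousLinearMap.le_opNorm _ _).trans (by gcongr)) (norm_nonneg _) (by positivity))
    have b2 : ‖s * (inner ℝ (L d) ((sliceDeriv V (u + s • d, t) - W) d) : ℝ)‖
        ≤ 1 * ((‖L‖ * ‖d‖) * (η * ‖d‖)) := by
      rw [norm_mul]
      refine mul_le_mul ?_ ?_ (norm_nonneg _) one_pos.le
      · rw [Real.norm_eq_abs, abs_of_nonneg hs.1]; exact hs.2.le
      · exact (norm_inner_le_norm _ _).trans (mul_le_mul (L.le_opNorm d)
          ((ContinuousLinearMap.le_opNorm _ _).trans (by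
            have := (hq _ (hmem s hs')).2
            gcongr)) (norm_nonneg _) (by positivity))
    refine (norm_add_le _ _).trans ((add_le_add b1 b2).trans (le_of_eq ?_))
    ring
  have hfin := norm_image_sub_le_of_norm_deriv_le_segment_01'
    (fun s hs => (hg s hs).hasDerivWithinAt) hbd
  have e1 : u + (1 : ℝ) • d = v := by rw [hd]; module
  rw [e1] at hfin
  simp only [zero_smul, add_zero, sub_self, inner_zero_left] at hfin
  have e2 : 2 * inner ℝ (Y (v, t) - Y (u, t)) (V (v, t)) - inner ℝ (L d) (W d)
      = 2 * (inner ℝ (Y (v, t) - Y (u, t)) (V (v, t)) - 1 ^ 2 / 2 * inner ℝ (L d) (W d)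
        - (0 - 0 ^ 2 / 2 * inner ℝ (L d) (W d))) := by ring
  rw [e2, norm_mul, Real.norm_of_nonneg (by norm_num : (0 : ℝ) ≤ 2), norm_pow, norm_norm]
  have hd2 : 0 ≤ ‖d‖ ^ 2 := by positivity
  calc _ ≤ 2 * (η * (‖W‖ + 1 + ‖L‖) * ‖d‖ ^ 2) := by gcongr
    _ = 2 * (η * (‖W‖ + 1 + ‖L‖)) * ‖d‖ ^ 2 := by ring
    _ ≤ _ := by gcongr

theorem isLittleO_norm_sq_sub {α : Type*} {l : Filter α} {a : α → A} {d : α → E} {L : E →L[ℝ] A}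
    (h : (fun q => a q - L (d q)) =o[l] d) :
    (fun q => ‖a q‖ ^ 2 - ‖L (d q)‖ ^ 2) =o[l] fun q => ‖d q‖ ^ 2 := by
  have hL : (fun q => L (d q)) =O[l] d := L.isBigO_comp d l
  have h2 : (fun q => a q - L (d q) + (2 : ℝ) • L (d q)) =O[l] d :=
    h.isBigO.add (hL.const_smul_left _)
  have h3 : (fun q => (inner ℝ (a q - L (d q)) (a q - L (d q) + (2 : ℝ) • L (d q)) : ℝ))
      =O[l] fun q => ‖a q - L (d q)‖ * ‖a q - L (d q) + (2 : ℝ) • L (d q)‖ :=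
    Asymptotics.isBigO_of_le _ fun q => by
      rw [norm_mul, norm_norm, norm_norm]; exact norm_inner_le_norm _ _
  refine (h3.trans_isLittleO (h.norm_norm.mul_isBigO h2.norm_norm)).congr (fun q => ?_) fun q => ?_
  · rw [inner_add_right, inner_smul_right, inner_sub_left, inner_sub_right, inner_sub_right,
      inner_sub_left, real_inner_self_eq_norm_sq, real_inner_self_eq_norm_sq,
      real_inner_comm (L (d q))]
    ring
  · ring

/-- Second order expansion of a combination of the squared chord, the height above the tangent
hyperplane, and the squared chord of the Gauss image. -/
theorem isLittleO_chord (hO : IsOpen O) (hJ : UniqueDiffOn ℝ J)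
    (hY : ContDiffOn ℝ ∞ Y (O ×ˢ J)) (hV : ContDiffOn ℝ ∞ V (O ×ˢ J))
    (hperp : ∀ p ∈ O ×ˢ J, ∀ d, inner ℝ (sliceDeriv Y p d) (V p) = 0)
    {u₀ : E} {t₀ : ℝ} (hu : u₀ ∈ O) (ht : t₀ ∈ J) (α β γ : ℝ) :
    (fun q : E × E × ℝ => α * ‖Y (q.1, q.2.2) - Y (q.2.1, q.2.2)‖ ^ 2
      + β * (2 * inner ℝ (Y (q.1, q.2.2) - Y (q.2.1, q.2.2)) (V (q.1, q.2.2)))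
      + γ * ‖V (q.1, q.2.2) - V (q.2.1, q.2.2)‖ ^ 2
      - (α * ‖sliceDeriv Y (u₀, t₀) (q.1 - q.2.1)‖ ^ 2
        + β * inner ℝ (sliceDeriv Y (u₀, t₀) (q.1 - q.2.1)) (sliceDeriv V (u₀, t₀) (q.1 - q.2.1))
        + γ * ‖sliceDeriv V (u₀, t₀) (q.1 - q.2.1)‖ ^ 2))
      =o[𝓝 u₀ ×ˢ 𝓝 u₀ ×ˢ 𝓝[J] t₀] fun q => ‖q.1 - q.2.1‖ ^ 2 := by
  have h1 := (isLittleO_norm_sq_sub (isLittleO_slice_sub hO hJ hY hu ht)).const_mul_left α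
  have h2 := (isLittleO_inner_normal hO hJ hY hV hperp hu ht).const_mul_left β
  have h3 := (isLittleO_norm_sq_sub (isLittleO_slice_sub hO hJ hV hu ht)).const_mul_left γ
  exact ((h1.add h2).add h3).congr_left fun q => by ring

theorem quadratic_eq_sum {n : ℕ} {e : Fin n → E} {κ : Fin n → ℝ} {L W : E →L[ℝ] A}
    (he : Orthonormal ℝ fun i => L (e i)) (hW : ∀ i, W (e i) = κ i • L (e i)) (α β γ : ℝ)
    (a : Fin n → ℝ) :
    α * ‖L (∑ i, a i • e i)‖ ^ 2
      + β * inner ℝ (L (∑ i, a i • e i)) (W (∑ i, a i • e i))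
      + γ * ‖W (∑ i, a i • e i)‖ ^ 2 = ∑ i, (α + β * κ i + γ * κ i ^ 2) * a i ^ 2 := by
  have hL' : L (∑ i, a i • e i) = ∑ i, a i • L (e i) := by simp
  have hW' : W (∑ i, a i • e i) = ∑ i, (a i * κ i) • L (e i) := by simp [hW, smul_smul]
  rw [← real_inner_self_eq_norm_sq, ← real_inner_self_eq_norm_sq, hL', hW',
    he.inner_sum, he.inner_sum, he.inner_sum, Finset.mul_sum, Finset.mul_sum, Finset.mul_sum,
    ← Finset.sum_add_distrib, ← Finset.sum_add_distrib]
  refine Finset.sum_congr rfl fun i _ => ?_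
  simp only [RCLike.conj_to_real]
  ring

theorem exists_eq_sum_smul {n : ℕ} [FiniteDimensional ℝ E] (hn : Module.finrank ℝ E = n)
    {e : Fin n → E} {L : E →L[ℝ] A} (he : Orthonormal ℝ fun i => L (e i)) (d : E) :
    ∃ a : Fin n → ℝ, d = ∑ i, a i • e i := by
  have hli : LinearIndependent ℝ e := LinearIndependent.of_comp L.toLinearMap he.linearIndependent
  have htop := hli.span_eq_top_of_card_eq_finrank' (by rw [hn, Fintype.card_fin])
  have : d ∈ Submodule.span ℝ (range e) := htop ▸ Submodule.mem_top
  obtain ⟨a, ha⟩ := (Submodule.mem_span_range_iff_exists_fun ℝ).1 this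
  exact ⟨a, ha.symm⟩

theorem exists_quadratic_lower_bound {n : ℕ} [FiniteDimensional ℝ E]
    (hn : Module.finrank ℝ E = n) {e : Fin n → E} {κ : Fin n → ℝ} {L W : E →L[ℝ] A}
    (he : Orthonormal ℝ fun i => L (e i)) (hW : ∀ i, W (e i) = κ i • L (e i)) {α β γ : ℝ}
    (hpos : ∀ i, 0 < α + β * κ i + γ * κ i ^ 2) :
    ∃ m, 0 < m ∧ ∀ d, m * ‖d‖ ^ 2 ≤ α * ‖L d‖ ^ 2 + β * inner ℝ (L d) (W d) + γ * ‖W d‖ ^ 2 := by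
  obtain ⟨m₀, hm₀, hm⟩ : ∃ m₀ : ℝ, 0 < m₀ ∧ ∀ i, m₀ ≤ α + β * κ i + γ * κ i ^ 2 := by
    have : ∀ᶠ m in 𝓝[>] (0 : ℝ), ∀ i, m ≤ α + β * κ i + γ * κ i ^ 2 :=
      eventually_all.2 fun i => mem_nhdsWithin_of_mem_nhds (Iic_mem_nhds (hpos i))
    obtain ⟨m, h1, h2⟩ := (this.and self_mem_nhdsWithin).exists
    exact ⟨m, h2, h1⟩
  set S := ∑ i, ‖e i‖ ^ 2 with hS
  have hS0 : 0 ≤ S := Finset.sum_nonneg fun i _ => by positivity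
  refine ⟨m₀ / (S + 1), by positivity, fun d => ?_⟩
  obtain ⟨a, rfl⟩ := exists_eq_sum_smul hn he d
  rw [quadratic_eq_sum he hW]
  have h1 : ‖∑ i, a i • e i‖ ^ 2 ≤ (∑ i, a i ^ 2) * S := by
    have h2 : ‖∑ i, a i • e i‖ ≤ ∑ i, |a i| * ‖e i‖ :=
      (norm_sum_le _ _).trans (le_of_eq (Finset.sum_congr rfl fun i _ => by
        rw [norm_smul, Real.norm_eq_abs]))
    have h3 := Finset.sum_mul_sq_le_sq_mul_sq Finset.univ (fun i => |a i|) fun i => ‖e i‖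
    simp only [sq_abs] at h3
    exact (pow_le_pow_left₀ (norm_nonneg _) h2 2).trans h3
  have h2 : m₀ * ∑ i, a i ^ 2 ≤ ∑ i, (α + β * κ i + γ * κ i ^ 2) * a i ^ 2 := by
    rw [Finset.mul_sum]
    exact Finset.sum_le_sum fun i _ => mul_le_mul_of_nonneg_right (hm i) (sq_nonneg _)
  refine le_trans ?_ h2
  rw [div_mul_eq_mul_div, div_le_iff₀ (by positivity), mul_assoc]
  refine mul_le_mul_of_nonneg_left (h1.trans ?_) hm₀.le
  have : 0 ≤ ∑ i, a i ^ 2 := Finset.sum_nonneg fun i _ => sq_nonneg _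
  nlinarith

variable {n : ℕ} [FiniteDimensional ℝ E] {e : Fin n → E} {κ : Fin n → ℝ}

/-- The coefficients `(C, -1, 0)` and `(-c, 1, 0)` give bounds on ball curvatures near the diagonal,
`(0, -1, γ)` the nonnegativity of the gap there. -/
theorem eventually_chord_nonneg (hn : Module.finrank ℝ E = n) (hO : IsOpen O)
    (hJ : UniqueDiffOn ℝ J) (hY : ContDiffOn ℝ ∞ Y (O ×ˢ J)) (hV : ContDiffOn ℝ ∞ V (O ×ˢ J))
    (hperp : ∀ p ∈ O ×ˢ J, ∀ d, inner ℝ (sliceDeriv Y p d) (V p) = 0)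
    {u₀ : E} {t₀ : ℝ} (hu : u₀ ∈ O) (ht : t₀ ∈ J)
    (he : Orthonormal ℝ fun i => sliceDeriv Y (u₀, t₀) (e i))
    (hW : ∀ i, sliceDeriv V (u₀, t₀) (e i) = κ i • sliceDeriv Y (u₀, t₀) (e i)) {α β γ : ℝ}
    (hpos : ∀ i, 0 < α + β * κ i + γ * κ i ^ 2) :
    ∀ᶠ q : E × E × ℝ in 𝓝 u₀ ×ˢ 𝓝 u₀ ×ˢ 𝓝[J] t₀,
      0 ≤ α * ‖Y (q.1, q.2.2) - Y (q.2.1, q.2.2)‖ ^ 2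
        + β * (2 * inner ℝ (Y (q.1, q.2.2) - Y (q.2.1, q.2.2)) (V (q.1, q.2.2)))
        + γ * ‖V (q.1, q.2.2) - V (q.2.1, q.2.2)‖ ^ 2 := by
  obtain ⟨m, hm, hm'⟩ := exists_quadratic_lower_bound hn he hW hpos
  filter_upwards [(Asymptotics.isLittleO_iff.1
    (isLittleO_chord hO hJ hY hV hperp hu ht α β γ)) hm] with q hq
  have h1 := hm' (q.1 - q.2.1)
  rw [norm_pow, norm_norm, Real.norm_eq_abs] at hq
  have := (abs_le.1 hq).1
  linarith

theorem nonneg_of_eventually_chord_nonneg (hO : IsOpen O)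
    (hJ : UniqueDiffOn ℝ J) (hY : ContDiffOn ℝ ∞ Y (O ×ˢ J)) (hV : ContDiffOn ℝ ∞ V (O ×ˢ J))
    (hperp : ∀ p ∈ O ×ˢ J, ∀ d, inner ℝ (sliceDeriv Y p d) (V p) = 0)
    {u₀ : E} {t₀ : ℝ} (hu : u₀ ∈ O) (ht : t₀ ∈ J)
    (he : Orthonormal ℝ fun i => sliceDeriv Y (u₀, t₀) (e i))
    (hW : ∀ i, sliceDeriv V (u₀, t₀) (e i) = κ i • sliceDeriv Y (u₀, t₀) (e i)) {α β γ : ℝ}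
    (hnn : ∀ᶠ u in 𝓝 u₀, 0 ≤ α * ‖Y (u₀, t₀) - Y (u, t₀)‖ ^ 2
        + β * (2 * inner ℝ (Y (u₀, t₀) - Y (u, t₀)) (V (u₀, t₀)))
        + γ * ‖V (u₀, t₀) - V (u, t₀)‖ ^ 2) (i : Fin n) :
    0 ≤ α + β * κ i + γ * κ i ^ 2 := by
  set Q := α + β * κ i + γ * κ i ^ 2 with hQ
  have hs : Tendsto (fun s : ℝ => u₀ - s • e i) (𝓝[>] 0) (𝓝 u₀) := by
    have : Continuous fun s : ℝ => u₀ - s • e i := by fun_prop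
    have h := this.tendsto 0
    rw [zero_smul, sub_zero] at h
    exact h.mono_left nhdsWithin_le_nhds
  have hs' : Tendsto (fun s : ℝ => (u₀, u₀ - s • e i, t₀)) (𝓝[>] 0)
      (𝓝 u₀ ×ˢ 𝓝 u₀ ×ˢ 𝓝[J] t₀) :=
    tendsto_const_nhds.prodMk (hs.prodMk
      (tendsto_nhdsWithin_iff.2 ⟨tendsto_const_nhds, Eventually.of_forall fun _ => ht⟩))
  have hle : ∀ ε, 0 < ε → -(ε * ‖e i‖ ^ 2) ≤ Q := by
    intro ε hε
    have h1 := hs'.eventually ((Asymptotics.isLittleO_iff.1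
      (isLittleO_chord hO hJ hY hV hperp hu ht α β γ)) hε)
    obtain ⟨s, ⟨h2, h3⟩, h4⟩ := ((h1.and (hs.eventually hnn)).and self_mem_nhdsWithin).exists
    have h4 : 0 < s := h4
    dsimp only at h2
    have e1 : u₀ - (u₀ - s • e i) = ∑ j, (Pi.single i s : Fin n → ℝ) j • e j := by
      rw [sub_sub_cancel, Finset.sum_eq_single i]
      · rw [Pi.single_eq_same]
      · intro j _ hj; rw [Pi.single_eq_of_ne hj, zero_smul]
      · simp
    have e2 := quadratic_eq_sum he hW α β γ (Pi.single i s)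
    rw [← e1, Finset.sum_eq_single i (by
      intro j _ hj; rw [Pi.single_eq_of_ne hj]; ring) (by simp), Pi.single_eq_same] at e2
    rw [e2, Real.norm_eq_abs, sub_sub_cancel, norm_pow, norm_norm, norm_smul, Real.norm_eq_abs,
      mul_pow, sq_abs] at h2
    have h5 := le_of_abs_le h2
    have h6 : 0 ≤ (Q + ε * ‖e i‖ ^ 2) * s ^ 2 := by rw [hQ]; linarith
    have h7 : 0 ≤ Q + ε * ‖e i‖ ^ 2 := by
      by_contra! h
      have : 0 < s ^ 2 := by positivity
      nlinarith
    linarith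
  by_contra! hneg
  have hneg' : 0 < -Q := by linarith
  have h1 := hle (-Q / (2 * (‖e i‖ ^ 2 + 1))) (by positivity)
  have h2 : -Q / (2 * (‖e i‖ ^ 2 + 1)) * ‖e i‖ ^ 2 ≤ -Q / 2 := by
    rw [div_mul_eq_mul_div, div_le_div_iff₀ (by positivity) two_pos]
    nlinarith [sq_nonneg ‖e i‖]
  linarith

end Expansion

/-! ### Embedded solutions in a chart -/

/-- For `n = 0` the cone is a single point fixed by scaling, and homogeneity contradicts positivity.
-/
theorem IsAdmissible.pos_dim {n : ℕ} {f : (Fin n → ℝ) → ℝ} (hf : IsAdmissible f) : 0 < n := by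
  rcases Nat.eq_zero_or_pos n with rfl | h
  · have hm : (0 : Fin 0 → ℝ) ∈ positiveCone 0 := fun i => i.elim0
    have h1 := hf.homogeneous 2 two_pos 0 hm
    have h2 := hf.positive 0 hm
    rw [smul_zero] at h1
    linarith
  · exact h

theorem convex_timeInterval (T : EReal) : Convex ℝ (timeInterval T) := by
  refine Set.OrdConnected.convex ⟨fun a ha b hb x hx => ⟨ha.1.trans hx.1, ?_⟩⟩
  exact lt_of_le_of_lt (EReal.coe_le_coe_iff.2 hx.2) hb.2

theorem mem_nhds_timeInterval {T : EReal} {t : ℝ} (ht : t ∈ timeInterval T) (h0 : 0 < t) :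
    timeInterval T ∈ 𝓝 t := by
  have h1 : ∀ᶠ s : ℝ in 𝓝 t, (s : EReal) < T :=
    continuous_coe_real_ereal.continuousAt.eventually (gt_mem_nhds ht.2)
  filter_upwards [h1, lt_mem_nhds h0] with s h2 h3
  exact ⟨h3.le, h2⟩

theorem uniqueDiffOn_timeInterval {T : EReal} (hT : 0 < T) :
    UniqueDiffOn ℝ (timeInterval T) := by
  refine uniqueDiffOn_convex (convex_timeInterval T) ?_
  obtain ⟨t, ht0, htT⟩ := EReal.lt_iff_exists_real_btwn.1 hT
  have ht0' : 0 < t := by exact_mod_cast ht0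
  exact ⟨t, mem_interior_iff_mem_nhds.2 (mem_nhds_timeInterval ⟨ht0'.le, htT⟩ ht0')⟩

section Chart

variable {n : ℕ} {M : Type*} [TopologicalSpace M] [ChartedSpace (EuclideanSpace ℝ (Fin n)) M]

/-- A time-dependent map on `M`, read in a chart of `M`. -/
def chartRep (c : OpenPartialHomeomorph M (EuclideanSpace ℝ (Fin n))) (X : M → ℝ → Ambient n)
    (p : EuclideanSpace ℝ (Fin n) × ℝ) : Ambient n := X (c.symm p.1) p.2

/-- `c` is a chart in which the moving hypersurface `X`, with unit normal `ν`, is smooth and has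
principal curvatures `κ`. -/
structure IsFlowChart (J : Set ℝ) (X ν : M → ℝ → Ambient n) (κ : M → ℝ → Fin n → ℝ)
    (c : OpenPartialHomeomorph M (EuclideanSpace ℝ (Fin n))) : Prop where
  smooth : ContDiffOn ℝ ∞ (chartRep c X) (c.target ×ˢ J)
  smooth_normal : ContDiffOn ℝ ∞ (chartRep c ν) (c.target ×ˢ J)
  perp : ∀ p ∈ c.target ×ˢ J, ∀ d, inner ℝ (sliceDeriv (chartRep c X) p d) (chartRep c ν p) = 0
  frame : ∀ p ∈ c.target ×ˢ J, ∃ e : Fin n → EuclideanSpace ℝ (Fin n),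
    (Orthonormal ℝ fun i => sliceDeriv (chartRep c X) p (e i)) ∧
    ∀ i, sliceDeriv (chartRep c ν) p (e i)
      = κ (c.symm p.1) p.2 i • sliceDeriv (chartRep c X) p (e i)

theorem contDiffOn_chartRep [IsManifold (𝓡 n) ∞ M] {J : Set ℝ} {X : M → ℝ → Ambient n}
    (hX : ContMDiffOn ((𝓡 n).prod 𝓘(ℝ, ℝ)) 𝓘(ℝ, Ambient n) ∞
      (fun p : M × ℝ => X p.1 p.2) (univ ×ˢ J)) (x₀ : M) :
    ContDiffOn ℝ ∞ (chartRep (chartAt (EuclideanSpace ℝ (Fin n)) x₀) X)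
      ((chartAt (EuclideanSpace ℝ (Fin n)) x₀).target ×ˢ J) := by
  set c := chartAt (EuclideanSpace ℝ (Fin n)) x₀ with hc
  have h1 : ContMDiffOn (𝓡 n) (𝓡 n) ∞ c.symm c.target := contMDiffOn_chart_symm
  have h2 : ContMDiffOn ((𝓡 n).prod 𝓘(ℝ, ℝ)) ((𝓡 n).prod 𝓘(ℝ, ℝ)) ∞
      (Prod.map c.symm (id : ℝ → ℝ)) (c.target ×ˢ J) := h1.prodMap contMDiffOn_id
  have h3 := hX.comp h2 (fun p hp => ⟨mem_univ _, hp.2⟩)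
  rw [← modelWithCornersSelf_prod, chartedSpaceSelf_prod] at h3
  exact contMDiffOn_iff_contDiffOn.1 h3

theorem contMDiff_slice {J : Set ℝ} {X : M → ℝ → Ambient n}
    (hX : ContMDiffOn ((𝓡 n).prod 𝓘(ℝ, ℝ)) 𝓘(ℝ, Ambient n) ∞
      (fun p : M × ℝ => X p.1 p.2) (univ ×ˢ J)) {t : ℝ} (ht : t ∈ J) :
    ContMDiff (𝓡 n) 𝓘(ℝ, Ambient n) ∞ fun x => X x t := by
  have h2 : ContMDiff (𝓡 n) ((𝓡 n).prod 𝓘(ℝ, ℝ)) ∞ fun x : M => (x, t) :=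
    contMDiff_id.prodMk contMDiff_const
  rw [← contMDiffOn_univ] at h2 ⊢
  exact hX.comp h2 fun x _ => ⟨mem_univ _, ht⟩

theorem sliceDeriv_chartRep [IsManifold (𝓡 n) ∞ M] {X : M → ℝ → Ambient n} {t : ℝ}
    (hX : ContMDiff (𝓡 n) 𝓘(ℝ, Ambient n) ∞ fun x => X x t) (x₀ : M)
    {u : EuclideanSpace ℝ (Fin n)}
    (hu : u ∈ (chartAt (EuclideanSpace ℝ (Fin n)) x₀).target) (d : EuclideanSpace ℝ (Fin n)) :
    sliceDeriv (chartRep (chartAt (EuclideanSpace ℝ (Fin n)) x₀) X) (u, t) d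
      = mvfderiv (𝓡 n) (fun x => X x t) ((chartAt (EuclideanSpace ℝ (Fin n)) x₀).symm u)
        (mfderiv (𝓡 n) (𝓡 n) (chartAt (EuclideanSpace ℝ (Fin n)) x₀).symm u d) := by
  have : IsManifold (𝓡 n) 1 M := IsManifold.of_le (n := ∞) (by simp)
  have h1 : MDifferentiableAt (𝓡 n) 𝓘(ℝ, Ambient n) (fun x => X x t)
      ((chartAt (EuclideanSpace ℝ (Fin n)) x₀).symm u) := hX.mdifferentiableAt (by simp)
  have h2 : MDifferentiableAt (𝓡 n) (𝓡 n) (chartAt (EuclideanSpace ℝ (Fin n)) x₀).symm u :=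
    (mdifferentiable_chart x₀).mdifferentiableAt_symm hu
  have h3 := mfderiv_comp u h1 h2
  have h4 : sliceDeriv (chartRep (chartAt (EuclideanSpace ℝ (Fin n)) x₀) X) (u, t)
      = mfderiv (𝓡 n) 𝓘(ℝ, Ambient n)
        ((fun x => X x t) ∘ (chartAt (EuclideanSpace ℝ (Fin n)) x₀).symm) u := by
    rw [mfderiv_eq_fderiv]; rfl
  rw [h4, h3]
  rfl

variable {f : (Fin n → ℝ) → ℝ} {Ψ : ℝ → ℝ} {T : EReal} {X ν : M → ℝ → Ambient n}

/-- The principal curvatures of a moving hypersurface. -/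
def curvatures (X ν : M → ℝ → Ambient n) (x : M) (t : ℝ) : Fin n → ℝ :=
  principalCurvatures (fun y => X y t) (fun y => ν y t) x

/-- The default value `0` is not in the positive cone when `n > 0`, so membership in the cone
certifies that the principal curvatures exist. -/
theorem IsEmbeddedSolution.isPrincipalCurvatures (hf : IsAdmissible f)
    (hX : IsEmbeddedSolution f Ψ T X ν) {t : ℝ} (ht : t ∈ timeInterval T) (x : M) :
    IsPrincipalCurvatures (fun y => X y t) (fun y => ν y t) x (curvatures X ν x t) := by
  have h1 := hX.curvature_mem t ht x
  unfold curvatures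
  unfold principalCurvatures at h1 ⊢
  split_ifs with h
  · exact h.choose_spec
  · rw [dif_neg h] at h1
    exact absurd (h1 ⟨0, hf.pos_dim⟩) (lt_irrefl _)

theorem IsEmbeddedSolution.isFlowChart [IsManifold (𝓡 n) ∞ M] (hf : IsAdmissible f)
    (hX : IsEmbeddedSolution f Ψ T X ν) (x₀ : M) :
    IsFlowChart (timeInterval T) X ν (curvatures X ν)
      (chartAt (EuclideanSpace ℝ (Fin n)) x₀) where
  smooth := contDiffOn_chartRep hX.smooth x₀
  smooth_normal := contDiffOn_chartRep hX.smooth_normal x₀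
  perp := by
    rintro ⟨u, t⟩ ⟨hu, ht⟩ d
    rw [sliceDeriv_chartRep (contMDiff_slice hX.smooth ht) x₀ hu]
    obtain ⟨Ω, -, -, -, h⟩ := hX.normal t ht
    exact (h _).2.1 _
  frame := by
    rintro ⟨u, t⟩ ⟨hu, ht⟩
    obtain ⟨-, e, he, hκ⟩ := hX.isPrincipalCurvatures hf ht
      ((chartAt (EuclideanSpace ℝ (Fin n)) x₀).symm u)
    have : IsManifold (𝓡 n) 1 M := IsManifold.of_le (n := ∞) (by simp)
    have hs := (mdifferentiable_chart (I := 𝓡 n) x₀).symm.mfderiv_surjective hu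
    obtain ⟨d, hd⟩ : ∃ d : Fin n → EuclideanSpace ℝ (Fin n), ∀ i, mfderiv (𝓡 n) (𝓡 n)
        (chartAt (EuclideanSpace ℝ (Fin n)) x₀).symm u (d i) = e i :=
      ⟨fun i => (hs (e i)).choose, fun i => (hs (e i)).choose_spec⟩
    have h1 : ∀ i, sliceDeriv (chartRep (chartAt (EuclideanSpace ℝ (Fin n)) x₀) X) (u, t) (d i)
        = mvfderiv (𝓡 n) (fun x => X x t)
          ((chartAt (EuclideanSpace ℝ (Fin n)) x₀).symm u) (e i) := fun i =>
      (sliceDeriv_chartRep (contMDiff_slice hX.smooth ht) x₀ hu (d i)).trans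
        (congrArg (mvfderiv (𝓡 n) (fun x => X x t)
          ((chartAt (EuclideanSpace ℝ (Fin n)) x₀).symm u)) (hd i))
    have h2 : ∀ i, sliceDeriv (chartRep (chartAt (EuclideanSpace ℝ (Fin n)) x₀) ν) (u, t) (d i)
        = mvfderiv (𝓡 n) (fun x => ν x t)
          ((chartAt (EuclideanSpace ℝ (Fin n)) x₀).symm u) (e i) := fun i =>
      (sliceDeriv_chartRep (contMDiff_slice hX.smooth_normal ht) x₀ hu (d i)).trans
        (congrArg (mvfderiv (𝓡 n) (fun x => ν x t)
          ((chartAt (EuclideanSpace ℝ (Fin n)) x₀).symm u)) (hd i))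
    refine ⟨d, ?_, fun i => ?_⟩
    · simpa only [h1] using he
    · rw [h1, h2]; exact hκ i

end Chart

/-! ### Geometry of the solution at a fixed time -/

section FixedTime

variable {n : ℕ} {M : Type*} [TopologicalSpace M] [ChartedSpace (EuclideanSpace ℝ (Fin n)) M]
  [IsManifold (𝓡 n) ∞ M]
  {f : (Fin n → ℝ) → ℝ} {Ψ : ℝ → ℝ} {T : EReal} {X ν : M → ℝ → Ambient n}

theorem chartRep_apply {c : OpenPartialHomeomorph M (EuclideanSpace ℝ (Fin n))} {x : M}
    (hx : x ∈ c.source) (X : M → ℝ → Ambient n) (t : ℝ) : chartRep c X (c x, t) = X x t := by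
  rw [chartRep, c.left_inv hx]

theorem IsEmbeddedSolution.eventually_chord_nonneg (hf : IsAdmissible f) (hT : 0 < T)
    (hX : IsEmbeddedSolution f Ψ T X ν) {t₀ : ℝ} (ht : t₀ ∈ timeInterval T) (x₀ : M)
    {α β γ : ℝ}
    (hpos : ∀ i, 0 < α + β * curvatures X ν x₀ t₀ i + γ * curvatures X ν x₀ t₀ i ^ 2) :
    ∀ᶠ q : M × M × ℝ in 𝓝 x₀ ×ˢ 𝓝 x₀ ×ˢ 𝓝[timeInterval T] t₀,
      0 ≤ α * ‖X q.1 q.2.2 - X q.2.1 q.2.2‖ ^ 2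
        + β * (2 * inner ℝ (X q.1 q.2.2 - X q.2.1 q.2.2) (ν q.1 q.2.2))
        + γ * ‖ν q.1 q.2.2 - ν q.2.1 q.2.2‖ ^ 2 := by
  have hC := hX.isFlowChart hf x₀
  set c := chartAt (EuclideanSpace ℝ (Fin n)) x₀ with hc
  have hx₀ : x₀ ∈ c.source := mem_chart_source _ _
  have hu : c x₀ ∈ c.target := c.map_source hx₀
  obtain ⟨e, he, hW⟩ := hC.frame (c x₀, t₀) ⟨hu, ht⟩
  dsimp only at hW
  rw [c.left_inv hx₀] at hW
  have h1 := CurvatureFlow.eventually_chord_nonneg (by simp) c.open_target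
    (uniqueDiffOn_timeInterval hT) hC.smooth hC.smooth_normal hC.perp hu ht he hW hpos
  have hcx : Tendsto c (𝓝 x₀) (𝓝 (c x₀)) := c.continuousAt hx₀
  have h2 : Tendsto (fun q : M × M × ℝ => (c q.1, c q.2.1, q.2.2))
      (𝓝 x₀ ×ˢ 𝓝 x₀ ×ˢ 𝓝[timeInterval T] t₀)
      (𝓝 (c x₀) ×ˢ 𝓝 (c x₀) ×ˢ 𝓝[timeInterval T] t₀) :=
    hcx.prodMap (hcx.prodMap tendsto_id)
  have hs : ∀ᶠ q : M × M × ℝ in 𝓝 x₀ ×ˢ 𝓝 x₀ ×ˢ 𝓝[timeInterval T] t₀,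
      q.1 ∈ c.source ∧ q.2.1 ∈ c.source := by
    have := c.open_source.mem_nhds hx₀
    have hm := (eventually_of_mem this fun _ h => h)
    exact (hm.prod_mk (hm.prod_inl _)).mono fun q hq => ⟨hq.1, hq.2⟩
  filter_upwards [h2.eventually h1, hs] with q hq hqs
  simpa only [chartRep_apply hqs.1, chartRep_apply hqs.2] using hq

theorem IsEmbeddedSolution.nonneg_of_chord_nonneg (hf : IsAdmissible f) (hT : 0 < T)
    (hX : IsEmbeddedSolution f Ψ T X ν) {t₀ : ℝ} (ht : t₀ ∈ timeInterval T) (x₀ : M)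
    {α β γ : ℝ}
    (hnn : ∀ y, 0 ≤ α * ‖X x₀ t₀ - X y t₀‖ ^ 2
        + β * (2 * inner ℝ (X x₀ t₀ - X y t₀) (ν x₀ t₀)) + γ * ‖ν x₀ t₀ - ν y t₀‖ ^ 2)
    (i : Fin n) : 0 ≤ α + β * curvatures X ν x₀ t₀ i + γ * curvatures X ν x₀ t₀ i ^ 2 := by
  have hC := hX.isFlowChart hf x₀
  set c := chartAt (EuclideanSpace ℝ (Fin n)) x₀ with hc
  have hx₀ : x₀ ∈ c.source := mem_chart_source _ _
  have hu : c x₀ ∈ c.target := c.map_source hx₀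
  obtain ⟨e, he, hW⟩ := hC.frame (c x₀, t₀) ⟨hu, ht⟩
  dsimp only at hW
  rw [c.left_inv hx₀] at hW
  refine nonneg_of_eventually_chord_nonneg c.open_target
    (uniqueDiffOn_timeInterval hT) hC.smooth hC.smooth_normal hC.perp hu ht he hW
    (Eventually.of_forall fun u => ?_) i
  rw [chartRep_apply hx₀, chartRep_apply hx₀]
  exact hnn (c.symm u)

theorem IsEmbeddedSolution.exists_eq_sub_smul (hf : IsAdmissible f)
    (hX : IsEmbeddedSolution f Ψ T X ν) {t : ℝ} (ht : t ∈ timeInterval T) {x : M} {q : Ambient n}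
    (hext : IsLocalExtr (fun y => ‖X y t - q‖ ^ 2) x) : ∃ s : ℝ, q = X x t - s • ν x t := by
  have hC := hX.isFlowChart hf x
  set c := chartAt (EuclideanSpace ℝ (Fin n)) x with hc
  have hx₀ : x ∈ c.source := mem_chart_source _ _
  have hu : c x ∈ c.target := c.map_source hx₀
  obtain ⟨e, he, -⟩ := hC.frame (c x, t) ⟨hu, ht⟩
  have hd := (hasFDerivAt_slice c.open_target hC.smooth hu ht).sub_const q |>.norm_sq
  have hcont : ContinuousAt c.symm (c x) := c.continuousAt_symm hu
  have hext' : IsLocalExtr (fun u => ‖chartRep c X (u, t) - q‖ ^ 2) (c x) := by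
    have hxx : IsLocalExtr (fun y => ‖X y t - q‖ ^ 2) (c.symm (c x)) := by rwa [c.left_inv hx₀]
    exact hxx.comp_tendsto (g := c.symm) hcont
  have h0 := hext'.hasFDerivAt_eq_zero hd
  have h1 : ∀ d, inner ℝ (sliceDeriv (chartRep c X) (c x, t) d) (X x t - q) = 0 := by
    intro d
    have := congrArg (fun L => L d) h0
    simp only [chartRep_apply hx₀] at this
    rw [real_inner_comm, inner_sub_left]
    simpa [inner_sub_left] using this
  have hperp := hC.perp (c x, t) ⟨hu, ht⟩
  rw [chartRep_apply hx₀] at hperp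
  obtain ⟨Ω, -, -, -, hΩ⟩ := hX.normal t ht
  have h2 := expand_frame he (hΩ x).1 (fun i => hperp (e i)) (X x t - q)
  simp only [h1, zero_smul, Finset.sum_const_zero, add_zero] at h2
  exact ⟨_, by rw [← h2, sub_sub_cancel]⟩

theorem IsEmbeddedSolution.exists_isBoundary (hf : IsAdmissible f)
    (hX : IsEmbeddedSolution f Ψ T X ν) {t : ℝ} (ht : t ∈ timeInterval T) :
    ∃ Ω, IsBoundary (fun x => X x t) (fun x => ν x t) Ω := by
  obtain ⟨Ω, hΩ, -, hfr, h⟩ := hX.normal t ht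
  exact ⟨Ω, (hX.embedding t ht).embedding, (contMDiff_slice hX.smooth_normal ht).continuous,
    fun x => (h x).1, hΩ, hfr, fun x => (h x).2.2, fun x q hq =>
      hX.exists_eq_sub_smul hf ht (Or.inl (Eventually.of_forall fun y =>
        pow_le_pow_left₀ (norm_nonneg _) (hq y) 2))⟩

/-- An orthonormal frame of positive length cannot arise from a constant map. This excludes the
empty infimum in the exscribed curvature. -/
theorem IsEmbeddedSolution.nontrivial [ConnectedSpace M] (hf : IsAdmissible f)
    (hX : IsEmbeddedSolution f Ψ T X ν) {t : ℝ} (ht : t ∈ timeInterval T) : Nontrivial M := by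
  by_contra h
  rw [not_nontrivial_iff_subsingleton] at h
  obtain ⟨x⟩ := (inferInstance : Nonempty M)
  have hC := hX.isFlowChart hf x
  set c := chartAt (EuclideanSpace ℝ (Fin n)) x with hc
  have hu : c x ∈ c.target := c.map_source (mem_chart_source _ _)
  obtain ⟨e, he, -⟩ := hC.frame (c x, t) ⟨hu, ht⟩
  have h1 : (fun u => chartRep c X (u, t)) = fun _ => X x t := by
    funext u
    rw [chartRep, Subsingleton.elim (c.symm u) x]
  have h2 := he.1 ⟨0, hf.pos_dim⟩
  simp [sliceDeriv, h1] at h2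

/-- At each time of the interval, the hypersurface lies between spheres tangent from inside and
outside at each of its points. -/
theorem IsEmbeddedSolution.exists_chord_bounds [CompactSpace M] [ConnectedSpace M]
    (hf : IsAdmissible f) (hT : 0 < T) (hX : IsEmbeddedSolution f Ψ T X ν) {t : ℝ}
    (ht : t ∈ timeInterval T) :
    (∃ c, 0 < c ∧ ∀ x y, c * ‖X x t - X y t‖ ^ 2 ≤ 2 * inner ℝ (X x t - X y t) (ν x t)) ∧
    ∃ C, 0 < C ∧ ∀ x y, 2 * inner ℝ (X x t - X y t) (ν x t) ≤ C * ‖X x t - X y t‖ ^ 2 := by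
  obtain ⟨Ω, hB⟩ := hX.exists_isBoundary hf ht
  have hpt : ∀ x : M, Tendsto (fun p : M × M => (p.1, p.2, t)) (𝓝 (x, x))
      (𝓝 x ×ˢ 𝓝 x ×ˢ 𝓝[timeInterval T] t) := fun x => by
    rw [nhds_prod_eq]
    exact tendsto_fst.prodMk (tendsto_snd.prodMk
      (tendsto_nhdsWithin_iff.2 ⟨tendsto_const_nhds, Eventually.of_forall fun _ => ht⟩))
  have hup : ∀ x, ∃ C, ∀ᶠ p in 𝓝 (x, x),
      2 * inner ℝ (X p.1 t - X p.2 t) (ν p.1 t) ≤ C * ‖X p.1 t - X p.2 t‖ ^ 2 := by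
    intro x
    obtain ⟨C, hC⟩ : ∃ C, ∀ i, curvatures X ν x t i < C := by
      have : ∀ᶠ C in atTop, ∀ i, curvatures X ν x t i < C :=
        eventually_all.2 fun i => eventually_gt_atTop _
      exact this.exists
    have := (hpt x).eventually (hX.eventually_chord_nonneg hf hT ht x (α := C) (β := -1) (γ := 0)
      (fun i => by linarith [hC i]))
    refine ⟨C, this.mono fun p hp => ?_⟩
    dsimp only at hp
    linarith
  have hlow : ∀ x, ∃ c, 0 < c ∧ ∀ᶠ p in 𝓝 (x, x),
      c * ‖X p.1 t - X p.2 t‖ ^ 2 ≤ 2 * inner ℝ (X p.1 t - X p.2 t) (ν p.1 t) := by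
    intro x
    obtain ⟨c, hc, hc0⟩ : ∃ c, (∀ i, c < curvatures X ν x t i) ∧ 0 < c := by
      have : ∀ᶠ c in 𝓝[>] (0 : ℝ), ∀ i, c < curvatures X ν x t i :=
        eventually_all.2 fun i =>
          mem_nhdsWithin_of_mem_nhds (gt_mem_nhds (hX.curvature_mem t ht x i))
      exact (this.and self_mem_nhdsWithin).exists
    have := (hpt x).eventually (hX.eventually_chord_nonneg hf hT ht x (α := -c) (β := 1) (γ := 0)
      (fun i => by linarith [hc i]))
    refine ⟨c, hc0, this.mono fun p hp => ?_⟩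
    dsimp only at hp
    linarith
  obtain ⟨C, hC0, hC⟩ := exists_upper_bound hB hup
  have hsupp := fun x => exists_local_support hB x (hlow x)
  have hconv := convex_interior hB (isPreconnected_interior hB hC0 hC) hsupp
  exact ⟨exists_lower_bound hB (fun x y => inner_pos_of_convex hB hconv hsupp) hlow, C, hC0, hC⟩

end FixedTime

/-! ### Regularity of the speed -/

section Speed

variable {n : ℕ} {M : Type*} [TopologicalSpace M] [ChartedSpace (EuclideanSpace ℝ (Fin n)) M]
  {f : (Fin n → ℝ) → ℝ} {Ψ : ℝ → ℝ} {T : EReal} {X ν : M → ℝ → Ambient n}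

theorem IsModulating.strictMonoOn (hΨ : IsModulating Ψ) : StrictMonoOn Ψ (Ioi 0) := by
  refine strictMonoOn_of_deriv_pos (convex_Ioi 0) hΨ.contDiff.continuousOn fun s hs => ?_
  rw [interior_Ioi] at hs
  exact hΨ.deriv_pos s hs

/-- The speed is built from ordered eigenvalues, so its regularity is not immediate; it is recovered
from that of `Ψ(F)`, here by monotonicity and below by the inverse function theorem. -/
theorem continuousWithinAt_of_strictMonoOn_comp {α : Type*} [TopologicalSpace α] {g : α → ℝ}
    {S : Set α} {a : α} (hΨ : StrictMonoOn Ψ (Ioi 0)) (hg : ∀ x ∈ S, 0 < g x) (ha : a ∈ S)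
    (hc : ContinuousWithinAt (fun x => Ψ (g x)) S a) : ContinuousWithinAt g S a := by
  refine tendsto_order.2 ⟨fun b hb => ?_, fun b hb => ?_⟩
  · rcases le_or_gt b 0 with h | h
    · filter_upwards [self_mem_nhdsWithin] with x hx using h.trans_lt (hg x hx)
    · filter_upwards [self_mem_nhdsWithin, hc.eventually (lt_mem_nhds (hΨ h (hg a ha) hb))]
        with x hx hx' using (hΨ.lt_iff_lt h (hg x hx)).1 hx'
  · have h : 0 < b := (hg a ha).trans hb
    filter_upwards [self_mem_nhdsWithin, hc.eventually (gt_mem_nhds (hΨ (hg a ha) h hb))]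
        with x hx hx' using (hΨ.lt_iff_lt (hg x hx) h).1 hx'

theorem contDiffAt_of_contDiffAt_comp {P : Type*} [NormedAddCommGroup P] [NormedSpace ℝ P]
    {g : P → ℝ} {p : P} (hΨ : IsModulating Ψ) (hp : 0 < g p) (hg : ContinuousAt g p)
    (hc : ContDiffAt ℝ 2 (fun x => Ψ (g x)) p) : ContDiffAt ℝ 2 g p := by
  have h1 : ContDiffAt ℝ 2 Ψ (g p) := hΨ.contDiff.contDiffAt (Ioi_mem_nhds hp)
  have h2 : HasDerivAt Ψ (deriv Ψ (g p)) (g p) := (h1.differentiableAt (by simp)).hasDerivAt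
  have h3 : HasFDerivAt Ψ ((ContinuousLinearEquiv.unitsEquivAut ℝ
      (Units.mk0 (deriv Ψ (g p)) (hΨ.deriv_pos _ hp).ne') : ℝ ≃L[ℝ] ℝ) : ℝ →L[ℝ] ℝ) (g p) := by
    refine h2.hasFDerivAt.congr_fderiv ?_
    ext
    simp
  have h4 := h1.to_localInverse h3 (by simp)
  have h5 : ∀ᶠ s in 𝓝 (g p), h1.localInverse h3 (by simp) (Ψ s) = s :=
    (h1.hasStrictFDerivAt' h3 (by simp)).eventually_left_inverse
  refine (h4.comp p hc).congr_of_eventuallyEq ?_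
  filter_upwards [hg.eventually h5] with x hx
  exact hx.symm

theorem speed_pos (hf : IsAdmissible f) (hX : IsEmbeddedSolution f Ψ T X ν) {t : ℝ}
    (ht : t ∈ timeInterval T) (x : M) : 0 < speed f X ν x t :=
  hf.positive _ (hX.curvature_mem t ht x)

variable [IsManifold (𝓡 n) ∞ M]

theorem fderivWithin_chartRep_time (hf : IsAdmissible f) (hT : 0 < T)
    (hX : IsEmbeddedSolution f Ψ T X ν) (x₀ : M) {p : EuclideanSpace ℝ (Fin n) × ℝ}
    (hp : p ∈ (chartAt (EuclideanSpace ℝ (Fin n)) x₀).target ×ˢ timeInterval T) :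
    fderivWithin ℝ (chartRep (chartAt (EuclideanSpace ℝ (Fin n)) x₀) X)
      ((chartAt (EuclideanSpace ℝ (Fin n)) x₀).target ×ˢ timeInterval T) p (0, 1)
      = -(Ψ (speed f X ν ((chartAt (EuclideanSpace ℝ (Fin n)) x₀).symm p.1) p.2)) •
        chartRep (chartAt (EuclideanSpace ℝ (Fin n)) x₀) ν p := by
  have hC := hX.isFlowChart hf x₀
  obtain ⟨u, t⟩ := p
  set c := chartAt (EuclideanSpace ℝ (Fin n)) x₀ with hc
  have h1 := ((hC.smooth.differentiableOn (by simp)) (u, t) hp).hasFDerivWithinAt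
  have h2 : HasDerivWithinAt (fun s : ℝ => (u, s)) ((0 : EuclideanSpace ℝ (Fin n)), (1 : ℝ))
      (timeInterval T) t := ((hasDerivAt_const t u).prodMk (hasDerivAt_id t)).hasDerivWithinAt
  have h3 := h1.comp_hasDerivWithinAt t h2 (fun s hs => mk_mem_prod hp.1 hs)
  exact ((uniqueDiffOn_timeInterval hT) t hp.2).eq_deriv _ h3 (hX.flow (c.symm u) t hp.2)

/-- The flow equation gives `Ψ(F) = -⟨∂ₜX, ν⟩`, and the right side is smooth. -/
theorem contDiffOn_speedRep (hf : IsAdmissible f) (hT : 0 < T)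
    (hX : IsEmbeddedSolution f Ψ T X ν) (x₀ : M) :
    ContDiffOn ℝ ∞ (fun p : EuclideanSpace ℝ (Fin n) × ℝ =>
      Ψ (speed f X ν ((chartAt (EuclideanSpace ℝ (Fin n)) x₀).symm p.1) p.2))
      ((chartAt (EuclideanSpace ℝ (Fin n)) x₀).target ×ˢ timeInterval T) := by
  have hC := hX.isFlowChart hf x₀
  have hmain := fun p hp => fderivWithin_chartRep_time hf hT hX x₀ (p := p) hp
  set c := chartAt (EuclideanSpace ℝ (Fin n)) x₀ with hc
  have h1 := hC.smooth.fderivWithin (m := ∞)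
    (c.open_target.uniqueDiffOn.prod (uniqueDiffOn_timeInterval hT)) (by simp)
  have h2 := (h1.clm_apply (contDiffOn_const (c := ((0 : EuclideanSpace ℝ (Fin n)), (1 : ℝ)))))
  refine ((h2.inner ℝ hC.smooth_normal).neg).congr fun p hp => ?_
  obtain ⟨Ω, -, -, -, hΩ⟩ := hX.normal p.2 hp.2
  rw [hmain p hp, inner_smul_left, real_inner_self_eq_norm_sq]
  have h3 : ‖chartRep c ν p‖ = 1 := (hΩ (c.symm p.1)).1
  rw [h3]
  simp

theorem continuousWithinAt_speed (hf : IsAdmissible f) (hΨ : IsModulating Ψ) (hT : 0 < T)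
    (hX : IsEmbeddedSolution f Ψ T X ν) {t : ℝ} (ht : t ∈ timeInterval T) (x : M) :
    Tendsto (fun q : M × ℝ => speed f X ν q.1 q.2) (𝓝 x ×ˢ 𝓝[timeInterval T] t)
      (𝓝 (speed f X ν x t)) := by
  have h1 := contDiffOn_speedRep hf hT hX x
  set c := chartAt (EuclideanSpace ℝ (Fin n)) x with hc
  have hx : x ∈ c.source := mem_chart_source _ _
  have hu : c x ∈ c.target := c.map_source hx
  have h2 : ContinuousWithinAt (fun p : EuclideanSpace ℝ (Fin n) × ℝ =>
      speed f X ν (c.symm p.1) p.2) (c.target ×ˢ timeInterval T) (c x, t) :=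
    continuousWithinAt_of_strictMonoOn_comp hΨ.strictMonoOn
      (fun p hp => speed_pos hf hX hp.2 _) ⟨hu, ht⟩ (h1.continuousOn _ ⟨hu, ht⟩)
  have h3 : Tendsto (fun p : EuclideanSpace ℝ (Fin n) × ℝ => speed f X ν (c.symm p.1) p.2)
      (𝓝 (c x) ×ˢ 𝓝[timeInterval T] t) (𝓝 (speed f X ν x t)) := by
    have := h2.tendsto
    rwa [nhdsWithin_prod_eq, c.open_target.nhdsWithin_eq hu, c.left_inv hx] at this
  have h4 : Tendsto (Prod.map c (id : ℝ → ℝ)) (𝓝 x ×ˢ 𝓝[timeInterval T] t)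
      (𝓝 (c x) ×ˢ 𝓝[timeInterval T] t) := (c.continuousAt hx).tendsto.prodMap tendsto_id
  refine (h3.comp h4).congr' ?_
  filter_upwards [(eventually_of_mem (c.open_source.mem_nhds hx) fun _ h => h).prod_inl _]
    with q hq
  simp [c.left_inv hq]

theorem contDiffAt_speedRep (hf : IsAdmissible f) (hΨ : IsModulating Ψ) (hT : 0 < T)
    (hX : IsEmbeddedSolution f Ψ T X ν) {t : ℝ} (ht : t ∈ timeInterval T) (h0 : 0 < t) (x : M) :
    ContDiffAt ℝ 2 (fun p : EuclideanSpace ℝ (Fin n) × ℝ =>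
      speed f X ν ((chartAt (EuclideanSpace ℝ (Fin n)) x).symm p.1) p.2)
      (chartAt (EuclideanSpace ℝ (Fin n)) x x, t) := by
  have h1 := contDiffOn_speedRep hf hT hX x
  set c := chartAt (EuclideanSpace ℝ (Fin n)) x with hc
  have hx : x ∈ c.source := mem_chart_source _ _
  have hu : c x ∈ c.target := c.map_source hx
  have hn : c.target ×ˢ timeInterval T ∈ 𝓝 (c x, t) :=
    prod_mem_nhds (c.open_target.mem_nhds hu) (mem_nhds_timeInterval ht h0)
  have h3 : ContDiffAt ℝ 2 (fun p : EuclideanSpace ℝ (Fin n) × ℝ =>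
      Ψ (speed f X ν (c.symm p.1) p.2)) (c x, t) := (h1.contDiffAt hn).of_le (by norm_cast)
  have h2 : ContinuousWithinAt (fun p : EuclideanSpace ℝ (Fin n) × ℝ =>
      speed f X ν (c.symm p.1) p.2) (c.target ×ˢ timeInterval T) (c x, t) :=
    continuousWithinAt_of_strictMonoOn_comp hΨ.strictMonoOn
      (fun p hp => speed_pos hf hX hp.2 _) ⟨hu, ht⟩ (h1.continuousOn _ ⟨hu, ht⟩)
  exact contDiffAt_of_contDiffAt_comp hΨ (speed_pos hf hX ht _) (h2.continuousAt hn) h3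

end Speed

/-! ### Inverting the Gauss map -/

section GaussMap

variable {n : ℕ}

/-- A patch of a strictly convex hypersurface moving with normal speed `Ψ (f κ)`. -/
structure IsFlowPatch (f : (Fin n → ℝ) → ℝ) (Ψ : ℝ → ℝ) (W : Set (EuclideanSpace ℝ (Fin n) × ℝ))
    (Y V : EuclideanSpace ℝ (Fin n) × ℝ → Ambient n)
    (κ : EuclideanSpace ℝ (Fin n) × ℝ → Fin n → ℝ) : Prop where
  isOpen : IsOpen W
  smooth : ContDiffOn ℝ ∞ Y W
  smooth_normal : ContDiffOn ℝ ∞ V W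
  norm_normal : ∀ p ∈ W, ‖V p‖ = 1
  perp : ∀ p ∈ W, ∀ d, inner ℝ (fderiv ℝ Y p (d, 0)) (V p) = 0
  time : ∀ p ∈ W, fderiv ℝ Y p (0, 1) = -(Ψ (f (κ p))) • V p
  mem : ∀ p ∈ W, κ p ∈ positiveCone n
  frame : ∀ p ∈ W, ∃ e : Fin n → EuclideanSpace ℝ (Fin n),
    (Orthonormal ℝ fun i => fderiv ℝ Y p (e i, 0)) ∧
    ∀ i, fderiv ℝ V p (e i, 0) = κ p i • fderiv ℝ Y p (e i, 0)

variable {f : (Fin n → ℝ) → ℝ} {Ψ : ℝ → ℝ} {W : Set (EuclideanSpace ℝ (Fin n) × ℝ)}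
  {Y V : EuclideanSpace ℝ (Fin n) × ℝ → Ambient n}
  {κ : EuclideanSpace ℝ (Fin n) × ℝ → Fin n → ℝ}

/-- Space-time points are determined by a multiple of the normal and the time. -/
def gaussMap (V : EuclideanSpace ℝ (Fin n) × ℝ → Ambient n)
    (q : (EuclideanSpace ℝ (Fin n) × ℝ) × ℝ) : Ambient n × ℝ := (q.1.2 • V (q.1.1, q.2), q.2)

theorem IsFlowPatch.contDiffAt (P : IsFlowPatch f Ψ W Y V κ) {p} (hp : p ∈ W) :
    ContDiffAt ℝ ∞ Y p := P.smooth.contDiffAt (P.isOpen.mem_nhds hp)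

theorem IsFlowPatch.contDiffAt_normal (P : IsFlowPatch f Ψ W Y V κ) {p} (hp : p ∈ W) :
    ContDiffAt ℝ ∞ V p := P.smooth_normal.contDiffAt (P.isOpen.mem_nhds hp)

theorem IsFlowPatch.contDiffAt_gaussMap (P : IsFlowPatch f Ψ W Y V κ)
    {u : EuclideanSpace ℝ (Fin n)} {t : ℝ} (hp : (u, t) ∈ W) :
    ContDiffAt ℝ ∞ (gaussMap V) ((u, 1), t) := by
  have h1 : ContDiffAt ℝ ∞ (fun q : (EuclideanSpace ℝ (Fin n) × ℝ) × ℝ => V (q.1.1, q.2))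
      ((u, 1), t) :=
    (P.contDiffAt_normal hp).comp (g := V)
      (f := fun q : (EuclideanSpace ℝ (Fin n) × ℝ) × ℝ => (q.1.1, q.2)) ((u, 1), t) (by fun_prop)
  have h2 : ContDiffAt ℝ ∞ (fun q : (EuclideanSpace ℝ (Fin n) × ℝ) × ℝ => q.1.2)
      ((u, 1), t) := by fun_prop
  exact (h2.smul h1).prodMk contDiffAt_snd

/-- Coordinates with respect to a frame of principal directions. -/
theorem IsFlowPatch.exists_coord (P : IsFlowPatch f Ψ W Y V κ) {p} (hp : p ∈ W) :
    ∃ E : Fin n → Ambient n, Orthonormal ℝ E ∧ (∀ i, inner ℝ (E i) (V p) = 0) ∧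
      ∀ d, inner ℝ (fderiv ℝ V p (d, 0)) (V p) = 0 ∧
        (∀ i, inner ℝ (fderiv ℝ V p (d, 0)) (E i) = κ p i * inner ℝ (fderiv ℝ Y p (d, 0)) (E i)) ∧
        ((∀ i, inner ℝ (fderiv ℝ Y p (d, 0)) (E i) = 0) → d = 0) := by
  obtain ⟨e, he, hV⟩ := P.frame p hp
  refine ⟨fun i => fderiv ℝ Y p (e i, 0), he, fun i => P.perp p hp _, fun d => ?_⟩
  set L := (fderiv ℝ Y p).comp (ContinuousLinearMap.inl ℝ (EuclideanSpace ℝ (Fin n)) ℝ) with hL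
  obtain ⟨a, rfl⟩ := exists_eq_sum_smul (L := L) (by simp) he d
  have hsum : ∀ A : EuclideanSpace ℝ (Fin n) × ℝ →L[ℝ] Ambient n,
      A (∑ i, a i • e i, 0) = ∑ i, a i • A (e i, 0) := fun A => by
    change (A.comp (ContinuousLinearMap.inl ℝ (EuclideanSpace ℝ (Fin n)) ℝ)) (∑ i, a i • e i) = _
    simp only [map_sum, map_smul]
    rfl
  have hY : ∀ i, inner ℝ (fderiv ℝ Y p (∑ i, a i • e i, 0)) (fderiv ℝ Y p (e i, 0)) = a i := by
    intro i
    rw [hsum, real_inner_comm]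
    exact he.inner_right_fintype a i
  refine ⟨?_, fun i => ?_, fun h0 => ?_⟩
  · rw [hsum, sum_inner]
    refine Finset.sum_eq_zero fun i _ => ?_
    rw [inner_smul_left, hV, inner_smul_left, P.perp p hp]
    simp
  · rw [hY, hsum]
    simp only [hV, smul_smul]
    rw [real_inner_comm]
    exact (he.inner_right_fintype (fun i => a i * κ p i) i).trans (mul_comm _ _)
  · refine Finset.sum_eq_zero fun i _ => ?_
    rw [← hY i, h0 i, zero_smul]

/-- The inverse function theorem for `(u, λ, t) ↦ (λ V(u,t), t)` at `λ = 1`. Injectivity of the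
differential is positivity of the principal curvatures, together with the normal component detecting
the change of `λ`. -/
theorem IsFlowPatch.exists_inverse (P : IsFlowPatch f Ψ W Y V κ)
    {u₀ : EuclideanSpace ℝ (Fin n)} {t₀ : ℝ} (hp : (u₀, t₀) ∈ W) :
    ∃ U : Ambient n × ℝ → EuclideanSpace ℝ (Fin n) × ℝ,
      ContDiffAt ℝ ∞ U (V (u₀, t₀), t₀) ∧ U (V (u₀, t₀), t₀) = (u₀, t₀) ∧
      (∀ p, (U p).2 = p.2) ∧ ∀ᶠ p in 𝓝 (V (u₀, t₀), t₀), p.1 = ‖p.1‖ • V (U p) := by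
  have hG := P.contDiffAt_gaussMap hp
  set q₀ : (EuclideanSpace ℝ (Fin n) × ℝ) × ℝ := ((u₀, 1), t₀) with hq₀
  have hVd := (P.contDiffAt_normal hp).differentiableAt (by simp)
  obtain ⟨D, hD, hDapp⟩ : ∃ D : (EuclideanSpace ℝ (Fin n) × ℝ) × ℝ →L[ℝ] Ambient n × ℝ,
      HasFDerivAt (gaussMap V) D q₀ ∧
      ∀ d m s, D ((d, m), s) = (fderiv ℝ V (u₀, t₀) (d, s) + m • V (u₀, t₀), s) := by
    refine ⟨_, hG.differentiableAt (by simp) |>.hasFDerivAt, fun d m s => ?_⟩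
    have h1 : HasFDerivAt (fun q : (EuclideanSpace ℝ (Fin n) × ℝ) × ℝ => (q.1.1, q.2))
        (((ContinuousLinearMap.fst ℝ _ _).comp (ContinuousLinearMap.fst ℝ _ _)).prod
          (ContinuousLinearMap.snd ℝ _ _)) q₀ := by
      exact (hasFDerivAt_fst.comp q₀ hasFDerivAt_fst).prodMk hasFDerivAt_snd
    have h2 : HasFDerivAt (fun q : (EuclideanSpace ℝ (Fin n) × ℝ) × ℝ => V (q.1.1, q.2)) _ q₀ :=
      hVd.hasFDerivAt.comp (f := fun q : (EuclideanSpace ℝ (Fin n) × ℝ) × ℝ => (q.1.1, q.2)) q₀ h1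
    have h3 : HasFDerivAt (fun q : (EuclideanSpace ℝ (Fin n) × ℝ) × ℝ => q.1.2)
        ((ContinuousLinearMap.snd ℝ _ _).comp (ContinuousLinearMap.fst ℝ _ _)) q₀ := by
      exact hasFDerivAt_snd.comp q₀ hasFDerivAt_fst
    have h4 := ((h3.smul h2).prodMk (hasFDerivAt_snd (𝕜 := ℝ) (p := q₀))).fderiv
    change fderiv ℝ (gaussMap V) q₀ = _ at h4
    rw [h4]
    simp [hq₀]
  obtain ⟨E, hE, hEV, hco⟩ := P.exists_coord hp
  have hinj : Function.Injective D := by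
    rw [injective_iff_map_eq_zero]
    rintro ⟨⟨d, m⟩, s⟩ h0
    rw [hDapp, Prod.mk_eq_zero] at h0
    obtain ⟨h0, rfl⟩ := h0
    obtain ⟨h1, h2, h3⟩ := hco d
    have h4 := congrArg (fun v => inner ℝ v (V (u₀, t₀))) h0
    simp only [inner_add_left, h1, inner_smul_left, real_inner_self_eq_norm_sq,
      P.norm_normal _ hp, inner_zero_left] at h4
    have hm : m = 0 := by simpa using h4
    subst hm
    rw [zero_smul, add_zero] at h0
    have hd : d = 0 := h3 fun i => by
      have := h2 i
      rw [h0, inner_zero_left] at this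
      rcases mul_eq_zero.1 this.symm with h | h
      · exact absurd h (P.mem _ hp i).ne'
      · exact h
    rw [hd]; rfl
  have hdim : Module.finrank ℝ ((EuclideanSpace ℝ (Fin n) × ℝ) × ℝ)
      = Module.finrank ℝ (Ambient n × ℝ) := by simp
  set D' := (LinearEquiv.ofInjectiveOfFinrankEq D.toLinearMap hinj hdim).toContinuousLinearEquiv
    with hD'
  have hDD : (D' : _ →L[ℝ] _) = D := ContinuousLinearMap.ext fun q => rfl
  have hD2 : HasFDerivAt (gaussMap V) (D' : _ →L[ℝ] _) q₀ := by rw [hDD]; exact hD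
  have hval : gaussMap V q₀ = (V (u₀, t₀), t₀) := by simp [gaussMap, hq₀]
  set σ := hG.localInverse hD2 (by simp) with hσ
  have hσs : ContDiffAt ℝ ∞ σ (V (u₀, t₀), t₀) := hval ▸ hG.to_localInverse hD2 (by simp)
  have hσ0 : σ (V (u₀, t₀), t₀) = q₀ := hval ▸ hG.localInverse_apply_image hD2 (by simp)
  have hσr : ∀ᶠ p in 𝓝 (V (u₀, t₀), t₀), gaussMap V (σ p) = p :=
    hval ▸ (hG.hasStrictFDerivAt' hD2 (by simp)).eventually_right_inverse
  refine ⟨fun p => ((σ p).1.1, p.2), by fun_prop, by simp [hσ0, hq₀], fun p => rfl, ?_⟩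
  have hUc : ContinuousAt (fun p => ((σ p).1.1, p.2)) (V (u₀, t₀), t₀) := by
    have := hσs.continuousAt
    fun_prop
  have hW : ∀ᶠ p in 𝓝 (V (u₀, t₀), t₀), ((σ p).1.1, p.2) ∈ W :=
    hUc.eventually (P.isOpen.mem_nhds (by simpa [hσ0, hq₀] using hp))
  have hl : ∀ᶠ p in 𝓝 (V (u₀, t₀), t₀), 0 < (σ p).1.2 := by
    have hc : ContinuousAt (fun p => (σ p).1.2) (V (u₀, t₀), t₀) := by
      have := hσs.continuousAt
      fun_prop
    exact hc.eventually (lt_mem_nhds (by simp [hσ0, hq₀]))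
  filter_upwards [hσr, hW, hl] with p h1 h2 h3
  rw [gaussMap, Prod.ext_iff] at h1
  obtain ⟨h1, h4⟩ := h1
  dsimp only at h1 h4
  rw [h4] at h1
  have h5 : ‖p.1‖ = (σ p).1.2 := by
    rw [← h1, norm_smul, P.norm_normal _ h2, mul_one, Real.norm_of_nonneg h3.le]
  rw [h5]
  exact h1.symm

end GaussMap

/-! ### The support function of a patch and its derivatives -/

section SupportFunction

variable {n : ℕ} {f : (Fin n → ℝ) → ℝ} {Ψ : ℝ → ℝ} {W : Set (EuclideanSpace ℝ (Fin n) × ℝ)}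
  {Y V : EuclideanSpace ℝ (Fin n) × ℝ → Ambient n}
  {κ : EuclideanSpace ℝ (Fin n) × ℝ → Fin n → ℝ}
  {U : Ambient n × ℝ → EuclideanSpace ℝ (Fin n) × ℝ} {z : Ambient n} {t₀ : ℝ}

/-- `U` is a local inverse of the normal direction, over time. -/
structure IsGaussInverse (W : Set (EuclideanSpace ℝ (Fin n) × ℝ))
    (V : EuclideanSpace ℝ (Fin n) × ℝ → Ambient n)
    (U : Ambient n × ℝ → EuclideanSpace ℝ (Fin n) × ℝ) (z : Ambient n) (t₀ : ℝ) : Prop where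
  norm_eq : ‖z‖ = 1
  smooth : ContDiffAt ℝ ∞ U (z, t₀)
  time : ∀ p, (U p).2 = p.2
  mem : U (z, t₀) ∈ W
  inverse : ∀ᶠ p in 𝓝 (z, t₀), p.1 = ‖p.1‖ • V (U p)

/-- The homogeneously extended support function. -/
def supportFn (Y : EuclideanSpace ℝ (Fin n) × ℝ → Ambient n)
    (U : Ambient n × ℝ → EuclideanSpace ℝ (Fin n) × ℝ) (p : Ambient n × ℝ) : ℝ :=
  inner ℝ (Y (U p)) p.1

namespace IsGaussInverse

theorem eventually_mem (P : IsFlowPatch f Ψ W Y V κ) (hU : IsGaussInverse W V U z t₀) :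
    ∀ᶠ p in 𝓝 (z, t₀), U p ∈ W :=
  hU.smooth.continuousAt.eventually (P.isOpen.mem_nhds hU.mem)

theorem eventually_ne_zero (hU : IsGaussInverse W V U z t₀) :
    ∀ᶠ p : Ambient n × ℝ in 𝓝 (z, t₀), p.1 ≠ 0 := by
  have hz : z ≠ 0 := by
    intro h
    have := hU.norm_eq
    rw [h, norm_zero] at this
    exact zero_ne_one this
  exact (continuous_fst.continuousAt (x := (z, t₀))).eventually (isOpen_ne.mem_nhds hz)

theorem eventually_differentiableAt (hU : IsGaussInverse W V U z t₀) :
    ∀ᶠ p in 𝓝 (z, t₀), DifferentiableAt ℝ U p :=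
  ((hU.smooth.of_le (m := 1) (by norm_cast)).eventually (by simp)).mono fun _ hp =>
    hp.differentiableAt (by simp)

theorem fderiv_snd (hU : IsGaussInverse W V U z t₀) {p : Ambient n × ℝ}
    (hp : DifferentiableAt ℝ U p) (a : Ambient n) (b : ℝ) : (fderiv ℝ U p (a, b)).2 = b := by
  have h1 : HasFDerivAt (fun p => (U p).2) ((ContinuousLinearMap.snd ℝ _ _).comp (fderiv ℝ U p)) p :=
    hasFDerivAt_snd.comp p hp.hasFDerivAt
  have h2 : HasFDerivAt (fun p => (U p).2) (ContinuousLinearMap.snd ℝ (Ambient n) ℝ) p := by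
    simp only [hU.time]
    exact hasFDerivAt_snd
  exact congrArg (fun L => L (a, b)) (h1.unique h2)

theorem fderiv_comp_position (P : IsFlowPatch f Ψ W Y V κ) (hU : IsGaussInverse W V U z t₀)
    {p : Ambient n × ℝ} (hp : DifferentiableAt ℝ U p) (hW : U p ∈ W) (a : Ambient n) (b : ℝ) :
    fderiv ℝ (fun p => Y (U p)) p (a, b)
      = fderiv ℝ Y (U p) ((fderiv ℝ U p (a, b)).1, 0) - (b * Ψ (f (κ (U p)))) • V (U p) := by
  have h1 := ((P.contDiffAt hW).differentiableAt (by simp)).hasFDerivAt.comp p hp.hasFDerivAt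
  have h2 : fderiv ℝ (fun p => Y (U p)) p = (fderiv ℝ Y (U p)).comp (fderiv ℝ U p) := h1.fderiv
  have h3 : fderiv ℝ U p (a, b) = ((fderiv ℝ U p (a, b)).1, 0)
      + b • ((0 : EuclideanSpace ℝ (Fin n)), (1 : ℝ)) := by
    ext1
    · simp
    · simp [hU.fderiv_snd hp]
  rw [h2, ContinuousLinearMap.comp_apply]
  conv_lhs => rw [h3]
  rw [map_add, map_smul, P.time _ hW]
  module

/-- The motion of the base point `U p` is tangential and is killed by the normal, so the spatial
gradient is the position vector and the time derivative is the normal speed. -/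
theorem fderiv_supportFn (P : IsFlowPatch f Ψ W Y V κ) (hU : IsGaussInverse W V U z t₀) :
    ∀ᶠ p in 𝓝 (z, t₀), ∀ a b, fderiv ℝ (supportFn Y U) p (a, b)
      = inner ℝ (Y (U p)) a - b * (‖p.1‖ * Ψ (f (κ (U p)))) := by
  filter_upwards [hU.eventually_differentiableAt, hU.eventually_mem P, hU.inverse]
    with p hp hW hinv a b
  have h1 : DifferentiableAt ℝ (fun p => Y (U p)) p :=
    ((P.contDiffAt hW).differentiableAt (by simp)).comp p hp
  have h2 := (h1.hasFDerivAt.inner ℝ (hasFDerivAt_fst (p := p))).fderiv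
  change fderiv ℝ (supportFn Y U) p = _ at h2
  rw [h2]
  simp only [ContinuousLinearMap.comp_apply, ContinuousLinearMap.prod_apply, fderivInnerCLM_apply,
    ContinuousLinearMap.coe_fst']
  rw [hU.fderiv_comp_position P hp hW, inner_sub_left, hinv, inner_smul_right, P.perp _ hW,
    inner_smul_right, inner_smul_left, real_inner_self_eq_norm_sq, P.norm_normal _ hW, norm_smul,
    P.norm_normal _ hW]
  simp
  ring

theorem frame_supportFn (P : IsFlowPatch f Ψ W Y V κ) (hU : IsGaussInverse W V U z t₀) :
    ∀ᶠ p in 𝓝 (z, t₀), ∃ e : Fin n → Ambient n, Orthonormal ℝ e ∧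
      (∀ i, inner ℝ (e i) p.1 = 0) ∧
      ∀ i a, hess (supportFn Y U) a (e i) p = (κ (U p) i)⁻¹ / ‖p.1‖ * inner ℝ (e i) a := by
  filter_upwards [hU.eventually_differentiableAt, hU.eventually_mem P, hU.inverse.eventually_nhds,
    hU.eventually_ne_zero, (hU.fderiv_supportFn P).eventually_nhds] with p hp hW hinv hne hfd
  obtain ⟨e, he, heV, hco⟩ := P.exists_coord hW
  have hn : ‖p.1‖ ≠ 0 := norm_ne_zero_iff.2 hne
  refine ⟨e, he, fun i => ?_, fun i a => ?_⟩
  · rw [hinv.self_of_nhds, inner_smul_right, heV, mul_zero]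
  have hYd : DifferentiableAt ℝ (fun p => Y (U p)) p :=
    ((P.contDiffAt hW).differentiableAt (by simp)).comp p hp
  have hVd' := ((P.contDiffAt_normal hW).differentiableAt (by simp)).hasFDerivAt.comp p
    hp.hasFDerivAt
  have h1 : dirDeriv (e i, 0) (supportFn Y U) =ᶠ[𝓝 p] fun p => inner ℝ (Y (U p)) (e i) :=
    hfd.mono fun q hq => by simp [dirDeriv, hq]
  set d := (fderiv ℝ U p (a, 0)).1 with hd
  have hUa : fderiv ℝ U p (a, 0) = (d, 0) := by
    ext1
    · rfl
    · exact hU.fderiv_snd hp a 0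
  have h2 : hess (supportFn Y U) a (e i) p = inner ℝ (fderiv ℝ Y (U p) (d, 0)) (e i) := by
    unfold hess
    rw [(dirDeriv_congr h1 (a, 0)).self_of_nhds]
    have h3 := (hYd.hasFDerivAt.inner ℝ (hasFDerivAt_const (e i) p)).fderiv
    unfold dirDeriv
    rw [h3]
    simp only [ContinuousLinearMap.comp_apply, ContinuousLinearMap.prod_apply, fderivInnerCLM_apply,
      zero_apply, inner_zero_right, zero_add]
    rw [hU.fderiv_comp_position P hp hW, ← hd, zero_mul, zero_smul, sub_zero]
  -- Differentiating the Gauss map identity relates the motion of the base point to `a`. The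
  -- derivative of the norm drops out because `e i` is orthogonal to the normal, and `κᵢ` is then
  -- divided out.
  have h4 : (fun q : Ambient n × ℝ => (inner ℝ q.1 (e i) : ℝ))
      =ᶠ[𝓝 p] fun q => ‖q.1‖ * inner ℝ (V (U q)) (e i) := by
    filter_upwards [hinv] with q hq
    conv_lhs => rw [hq]
    rw [inner_smul_left]; simp
  have h5 : HasFDerivAt (fun q : Ambient n × ℝ => (inner ℝ q.1 (e i) : ℝ)) _ p :=
    (hasFDerivAt_fst (p := p)).inner ℝ (hasFDerivAt_const (e i) p)
  have h6 : DifferentiableAt ℝ (fun q : Ambient n × ℝ => ‖q.1‖) p :=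
    differentiableAt_fst.norm ℝ hne
  have h7 : HasFDerivAt (fun q : Ambient n × ℝ => ‖q.1‖ * (inner ℝ (V (U q)) (e i) : ℝ)) _ p :=
    h6.hasFDerivAt.mul (hVd'.inner ℝ (hasFDerivAt_const (e i) p))
  have h8 := congrArg (fun L => L (a, (0 : ℝ))) (h5.unique (h7.congr_of_eventuallyEq h4))
  have hVi : inner ℝ (V (U p)) (e i) = (0 : ℝ) := by rw [real_inner_comm]; exact heV i
  simp only [ContinuousLinearMap.comp_apply, ContinuousLinearMap.prod_apply, fderivInnerCLM_apply,
    zero_apply, inner_zero_right, zero_add, ContinuousLinearMap.coe_fst', add_apply, smul_apply,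
    Function.comp_apply, hVi, hUa, smul_eq_mul, zero_mul, add_zero, (hco d).2.1 i] at h8
  rw [h2]
  rw [real_inner_comm a (e i), h8]
  have hk := (P.mem _ hW i).ne'
  field_simp

theorem isLocalSol (hf : IsAdmissible f) (P : IsFlowPatch f Ψ W Y V κ)
    (hU : IsGaussInverse W V U z t₀) (hF : ContDiffAt ℝ 2 (fun p => f (κ p)) (U (z, t₀))) :
    IsLocalSol f (fun s => -Ψ s⁻¹) (supportFn Y U) (fun p => (f (κ (U p)))⁻¹) z t₀ where
  norm_eq := hU.norm_eq
  smooth := ((P.contDiffAt hU.mem).comp _ hU.smooth).inner ℝ contDiffAt_fst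
  smooth' := by
    have h1 : ContDiffAt ℝ 2 (fun p => f (κ (U p))) (z, t₀) :=
      hF.comp _ (hU.smooth.of_le (by norm_cast))
    exact h1.inv (hf.positive _ (P.mem _ hU.mem)).ne'
  flow := (hU.fderiv_supportFn P).mono fun p hp => by simp [dirDeriv, hp]
  euler := (hU.fderiv_supportFn P).mono fun p hp => by simp [dirDeriv, hp, supportFn]
  frame := by
    filter_upwards [hU.frame_supportFn P, hU.eventually_mem P] with p ⟨e, h1, h2, h3⟩ hW
    exact ⟨e, fun i => (κ (U p) i)⁻¹, h1, h2, inv_mem_positiveCone (P.mem _ hW),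
      (dual_inv _).symm, h3⟩

end IsGaussInverse

end SupportFunction

/-! ### Local Gauss map parametrizations of the given solution -/

section LocalSolution

variable {n : ℕ} {M : Type*} [TopologicalSpace M] [ChartedSpace (EuclideanSpace ℝ (Fin n)) M]
  {f : (Fin n → ℝ) → ℝ} {Ψ : ℝ → ℝ} {T : EReal} {X ν : M → ℝ → Ambient n}

/-- `φ` is a local inverse of the Gauss map `ν (·, t)` near the normal `z` at time `t₀`, with
support function `h`. -/
structure IsGaussParam (J : Set ℝ) (X ν : M → ℝ → Ambient n) (h : Ambient n × ℝ → ℝ)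
    (φ : Ambient n × ℝ → M) (p : Ambient n × ℝ) : Prop where
  mem : p.2 ∈ J
  normal : p.1 = ‖p.1‖ • ν (φ p) p.2
  ne_zero : p.1 ≠ 0
  support : h p = inner ℝ (X (φ p) p.2) p.1
  dirDeriv_support : ∀ a, dirDeriv (a, 0) h p = inner ℝ (X (φ p) p.2) a
  frame : ∃ e : Fin n → Ambient n, Orthonormal ℝ e ∧ (∀ i, inner ℝ (e i) p.1 = 0) ∧
    ∀ i a, hess h a (e i) p = (curvatures X ν (φ p) p.2 i)⁻¹ / ‖p.1‖ * inner ℝ (e i) a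

variable [IsManifold (𝓡 n) ∞ M]

theorem IsEmbeddedSolution.isFlowPatch (hf : IsAdmissible f) (hT : 0 < T)
    (hX : IsEmbeddedSolution f Ψ T X ν) (x₀ : M) :
    IsFlowPatch f Ψ ((chartAt (EuclideanSpace ℝ (Fin n)) x₀).target ×ˢ interior (timeInterval T))
      (chartRep (chartAt (EuclideanSpace ℝ (Fin n)) x₀) X)
      (chartRep (chartAt (EuclideanSpace ℝ (Fin n)) x₀) ν)
      (fun p => curvatures X ν ((chartAt (EuclideanSpace ℝ (Fin n)) x₀).symm p.1) p.2) := by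
  have hC := hX.isFlowChart hf x₀
  have htime := fun p hp => fderivWithin_chartRep_time hf hT hX x₀ (p := p) hp
  set c := chartAt (EuclideanSpace ℝ (Fin n)) x₀ with hc
  have hsub : c.target ×ˢ interior (timeInterval T) ⊆ c.target ×ˢ timeInterval T :=
    prod_mono_right interior_subset
  have hnhds : ∀ p ∈ c.target ×ˢ interior (timeInterval T),
      c.target ×ˢ timeInterval T ∈ 𝓝 p := fun p hp =>
    mem_of_superset ((c.open_target.prod isOpen_interior).mem_nhds hp) hsub
  have hslice : ∀ {Y : EuclideanSpace ℝ (Fin n) × ℝ → Ambient n},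
      ContDiffOn ℝ ∞ Y (c.target ×ˢ timeInterval T) →
      ∀ p ∈ c.target ×ˢ interior (timeInterval T), ∀ d, fderiv ℝ Y p (d, 0) = sliceDeriv Y p d := by
    intro Y hY p hp d
    rw [sliceDeriv_eq c.open_target hY (hsub hp), fderivWithin_of_mem_nhds (hnhds p hp)]
    rfl
  refine ⟨c.open_target.prod isOpen_interior, hC.smooth.mono hsub, hC.smooth_normal.mono hsub,
    fun p hp => ?_, fun p hp d => ?_, fun p hp => ?_, fun p hp => ?_, fun p hp => ?_⟩
  · obtain ⟨Ω, -, -, -, hΩ⟩ := hX.normal p.2 (hsub hp).2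
    exact (hΩ (c.symm p.1)).1
  · rw [hslice hC.smooth p hp]
    exact hC.perp p (hsub hp) d
  · rw [← fderivWithin_of_mem_nhds (hnhds p hp)]
    exact htime p (hsub hp)
  · exact hX.curvature_mem p.2 (hsub hp).2 _
  · obtain ⟨e, he, hV⟩ := hC.frame p (hsub hp)
    refine ⟨e, ?_, fun i => ?_⟩
    · simpa only [hslice hC.smooth p hp] using he
    · rw [hslice hC.smooth p hp, hslice hC.smooth_normal p hp]
      exact hV i

theorem IsEmbeddedSolution.exists_isLocalSol (hf : IsAdmissible f) (hΨ : IsModulating Ψ)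
    (hT : 0 < T) (hX : IsEmbeddedSolution f Ψ T X ν) {t₀ : ℝ} (ht : t₀ ∈ timeInterval T)
    (h0 : 0 < t₀) (x₀ : M) :
    ∃ (h : Ambient n × ℝ → ℝ) (φ : Ambient n × ℝ → M), φ (ν x₀ t₀, t₀) = x₀ ∧
      IsLocalSol f (fun s => -Ψ s⁻¹) h (fun p => (speed f X ν (φ p) p.2)⁻¹) (ν x₀ t₀) t₀ ∧
      ∀ᶠ p in 𝓝 (ν x₀ t₀, t₀), IsGaussParam (timeInterval T) X ν h φ p := by
  have P := hX.isFlowPatch hf hT x₀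
  have hF := contDiffAt_speedRep hf hΨ hT hX ht h0 x₀
  set c := chartAt (EuclideanSpace ℝ (Fin n)) x₀ with hc
  have hx₀ : x₀ ∈ c.source := mem_chart_source _ _
  have hu : c x₀ ∈ c.target := c.map_source hx₀
  have hp : (c x₀, t₀) ∈ c.target ×ˢ interior (timeInterval T) :=
    ⟨hu, mem_interior_iff_mem_nhds.2 (mem_nhds_timeInterval ht h0)⟩
  obtain ⟨U, hUs, hU0, hUt, hUi⟩ := P.exists_inverse hp
  rw [chartRep_apply hx₀] at hUs hU0 hUi
  have hU : IsGaussInverse (c.target ×ˢ interior (timeInterval T)) (chartRep c ν) U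
      (ν x₀ t₀) t₀ := by
    refine ⟨?_, hUs, hUt, hU0 ▸ hp, hUi⟩
    obtain ⟨Ω, -, -, -, hΩ⟩ := hX.normal t₀ ht
    exact (hΩ x₀).1
  have hS := hU.isLocalSol hf P (by rw [hU0]; exact hF)
  refine ⟨supportFn (chartRep c X) U, fun p => c.symm (U p).1, ?_, ?_, ?_⟩
  · simp only [hU0]; exact c.left_inv hx₀
  · simp only [hUt] at hS
    exact hS
  · have h1 : ∀ᶠ p in 𝓝 (ν x₀ t₀, t₀), ∀ a, dirDeriv (a, 0) (supportFn (chartRep c X) U) p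
        = inner ℝ (chartRep c X (U p)) a :=
      (hU.fderiv_supportFn P).mono fun p hp a => by simp [dirDeriv, hp]
    filter_upwards [h1, hU.eventually_mem P, hU.inverse, hU.eventually_ne_zero,
      hU.frame_supportFn P] with p h1 h2 h3 h4 h5
    have hrep : ∀ Z, chartRep c Z (U p) = Z (c.symm (U p).1) p.2 := fun Z => by
      rw [chartRep, hUt]
    rw [hrep] at h3
    refine ⟨?_, h3, h4, ?_, fun a => ?_, ?_⟩
    · rw [← hUt p]; exact interior_subset h2.2
    · rw [supportFn, hrep]
    · rw [h1, hrep]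
    · rw [← hUt p]; simpa only [hUt p] using h5

end LocalSolution

/-! ### The enclosing sphere inequality -/

section Gap

variable {n : ℕ} {M : Type*}

/-- The distance from the enclosing sphere of radius `R`, tangent from outside at the point with
position `x` and normal `a`, to the parallel supporting hyperplane at the point with position `y`
and normal `b`. -/
def sphereGap (R : ℝ) (x a y b : Ambient n) : ℝ := R * (1 - inner ℝ a b) - inner ℝ (y - x) b

theorem two_mul_sphereGap (R : ℝ) (x y : Ambient n) {a b : Ambient n} (ha : ‖a‖ = 1)
    (hb : ‖b‖ = 1) : 2 * sphereGap R x a y b = R * ‖b - a‖ ^ 2 - 2 * inner ℝ (y - x) b := by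
  rw [sphereGap, norm_sub_sq_real, ha, hb, real_inner_comm]
  ring

theorem norm_sub_center_sq (R : ℝ) (x y : Ambient n) {a : Ambient n} (ha : ‖a‖ = 1) :
    ‖y - (x - R • a)‖ ^ 2 = ‖x - y‖ ^ 2 - R * (2 * inner ℝ (x - y) a) + R ^ 2 := by
  have e : y - (x - R • a) = -((x - y) - R • a) := by module
  rw [e, norm_neg, norm_sub_sq_real, inner_smul_right, norm_smul, ha, mul_one, Real.norm_eq_abs,
    sq_abs]
  ring

/-- The chord inequality says that `y` lies in the ball of radius `R` about `x - R a`, so its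
projection to any unit vector `b` from that centre is at most `R`. -/
theorem sphereGap_nonneg_of_chord {R : ℝ} (hR : 0 < R) {x y a b : Ambient n} (ha : ‖a‖ = 1)
    (hb : ‖b‖ = 1) (h : ‖x - y‖ ^ 2 ≤ R * (2 * inner ℝ (x - y) a)) :
    0 ≤ sphereGap R x a y b := by
  have h1 := norm_sub_center_sq R x y ha
  have h2 : ‖y - (x - R • a)‖ ≤ R := by
    refine abs_le_of_sq_le_sq' (by linarith) hR.le |>.2
  have h3 : inner ℝ (y - (x - R • a)) b ≤ R :=
    (real_inner_le_norm _ _).trans (by rw [hb, mul_one]; exact h2)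
  have e : y - (x - R • a) = (y - x) + R • a := by module
  rw [e, inner_add_left, inner_smul_left, RCLike.conj_to_real] at h3
  rw [sphereGap]
  linarith

/-- At the point `z` farthest from the centre `q` the outward normal is radial: `Y z = q + s N z`,
with `s > 0` by convexity. The gap at `z` is exactly `R - s`, so all points are within distance `R`.
Unlike the converse, this needs the gap for all `y`. -/
theorem chord_of_sphereGap_nonneg [TopologicalSpace M] [CompactSpace M] [Nontrivial M]
    {Y N : M → Ambient n} (hY : Continuous Y) (hN : ∀ x, ‖N x‖ = 1)
    (hpos : ∀ x y, x ≠ y → 0 < inner ℝ (Y x - Y y) (N x))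
    (hcrit : ∀ x q, (∀ y, ‖Y y - q‖ ≤ ‖Y x - q‖) → ∃ s : ℝ, q = Y x - s • N x)
    {R : ℝ} (x : M) (h : ∀ y, 0 ≤ sphereGap R (Y x) (N x) (Y y) (N y)) (y : M) :
    ‖Y x - Y y‖ ^ 2 ≤ R * (2 * inner ℝ (Y x - Y y) (N x)) := by
  set q := Y x - R • N x with hq
  obtain ⟨z, -, hz⟩ := (isCompact_univ (X := M)).exists_isMaxOn univ_nonempty
    (f := fun y => ‖Y y - q‖) (by fun_prop)
  have hz' : ∀ y, ‖Y y - q‖ ≤ ‖Y z - q‖ := fun y => hz (mem_univ y)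
  obtain ⟨s, hs⟩ := hcrit z q hz'
  have hzq : ‖Y z - q‖ ^ 2 = s ^ 2 := by
    rw [hs, sub_sub_cancel, norm_smul, hN, mul_one, Real.norm_eq_abs, sq_abs]
  obtain ⟨w, hw⟩ := exists_ne z
  have hs0 : 0 < s := by
    have h1 := norm_sub_center_sq s (Y z) (Y w) (hN z)
    rw [← hs] at h1
    have h2 := pow_le_pow_left₀ (norm_nonneg _) (hz' w) 2
    have h3 := hpos z w hw.symm
    have h4 : 0 < ‖Y z - Y w‖ ^ 2 := by
      have : Y z - Y w ≠ 0 := by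
        intro h0
        rw [h0, inner_zero_left] at h3
        exact lt_irrefl _ h3
      positivity
    by_contra! hneg
    nlinarith [mul_nonneg_of_nonpos_of_nonpos hneg (neg_nonpos.2 h3.le)]
  have hsR : s ≤ R := by
    have h1 := h z
    have e : Y z - Y x = s • N z - R • N x := by
      have : Y z - q = s • N z := by rw [hs]; module
      rw [hq] at this
      rw [← this]; module
    rw [sphereGap, e, inner_sub_left, inner_smul_left, inner_smul_left, real_inner_self_eq_norm_sq,
      hN] at h1
    simp only [RCLike.conj_to_real] at h1
    linarith
  have h1 := norm_sub_center_sq R (Y x) (Y y) (hN x)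
  rw [← hq] at h1
  have h2 := pow_le_pow_left₀ (norm_nonneg _) (hz' y) 2
  have h3 : s ^ 2 ≤ R ^ 2 := pow_le_pow_left₀ hs0.le hsR 2
  linarith

end Gap

/-! ### Enclosing spheres and the exscribed curvature along the flow -/

section Solution

variable {n : ℕ} {M : Type*} [TopologicalSpace M] [ChartedSpace (EuclideanSpace ℝ (Fin n)) M]
  {f : (Fin n → ℝ) → ℝ} {Ψ : ℝ → ℝ} {T : EReal} {X ν : M → ℝ → Ambient n}

/-- The gap to the enclosing sphere whose radius is `K` times the inverse speed. -/
def gap (f : (Fin n → ℝ) → ℝ) (X ν : M → ℝ → Ambient n) (K : ℝ) (x y : M) (t : ℝ) : ℝ :=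
  sphereGap (K * (speed f X ν x t)⁻¹) (X x t) (ν x t) (X y t) (ν y t)

theorem norm_normal (hX : IsEmbeddedSolution f Ψ T X ν) {t : ℝ} (ht : t ∈ timeInterval T) (x : M) :
    ‖ν x t‖ = 1 := by
  obtain ⟨Ω, -, -, -, hΩ⟩ := hX.normal t ht
  exact (hΩ x).1

variable [IsManifold (𝓡 n) ∞ M] [CompactSpace M] [ConnectedSpace M]

theorem inner_chord_pos (hf : IsAdmissible f) (hT : 0 < T) (hX : IsEmbeddedSolution f Ψ T X ν)
    {t : ℝ} (ht : t ∈ timeInterval T) (x y : M) (hxy : x ≠ y) :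
    0 < inner ℝ (X x t - X y t) (ν x t) := by
  obtain ⟨⟨c, hc, h⟩, -⟩ := hX.exists_chord_bounds hf hT ht
  have h1 := h x y
  have h2 : X x t - X y t ≠ 0 :=
    sub_ne_zero.2 fun h0 => hxy ((hX.embedding t ht).embedding.injective h0)
  have : 0 < c * ‖X x t - X y t‖ ^ 2 := by positivity
  linarith

theorem normal_ne (hf : IsAdmissible f) (hT : 0 < T) (hX : IsEmbeddedSolution f Ψ T X ν)
    {t : ℝ} (ht : t ∈ timeInterval T) {x y : M} (hxy : x ≠ y) : ν x t ≠ ν y t := by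
  intro h
  have h1 := inner_chord_pos hf hT hX ht x y hxy
  have h2 := inner_chord_pos hf hT hX ht y x hxy.symm
  rw [← neg_sub, inner_neg_left, ← h] at h2
  linarith

theorem gap_nonneg_iff (hf : IsAdmissible f) (hT : 0 < T) (hX : IsEmbeddedSolution f Ψ T X ν)
    {t : ℝ} (ht : t ∈ timeInterval T) {K : ℝ} (hK : 0 < K) (x : M) :
    (∀ y, 0 ≤ gap f X ν K x y t) ↔
      ∀ y, speed f X ν x t / K * ‖X x t - X y t‖ ^ 2 ≤ 2 * inner ℝ (X x t - X y t) (ν x t) := by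
  have hF := speed_pos hf hX ht x
  have hN := norm_normal hX ht
  have hiff : ∀ y, speed f X ν x t / K * ‖X x t - X y t‖ ^ 2 ≤ 2 * inner ℝ (X x t - X y t) (ν x t)
      ↔ ‖X x t - X y t‖ ^ 2
        ≤ K * (speed f X ν x t)⁻¹ * (2 * inner ℝ (X x t - X y t) (ν x t)) := fun y => by
    rw [div_mul_eq_mul_div, div_le_iff₀ hK, mul_comm K, mul_assoc (speed f X ν x t)⁻¹,
      inv_mul_eq_div, le_div_iff₀ hF, mul_comm (speed f X ν x t), mul_comm K]
  simp only [hiff]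
  have := hX.nontrivial hf ht
  refine ⟨fun h y => ?_, fun h y => ?_⟩
  · exact chord_of_sphereGap_nonneg (Y := fun x => X x t) (N := fun x => ν x t)
      (hX.embedding t ht).embedding.continuous hN (inner_chord_pos hf hT hX ht)
      (fun x q hq => hX.exists_eq_sub_smul hf ht (Or.inr (Eventually.of_forall fun y =>
        pow_le_pow_left₀ (norm_nonneg _) (hq y) 2))) x h y
  · exact sphereGap_nonneg_of_chord (by positivity) (hN x) (hN y) (h y)

theorem le_exscribed_iff (hf : IsAdmissible f) (hT : 0 < T) (hX : IsEmbeddedSolution f Ψ T X ν)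
    {t : ℝ} (ht : t ∈ timeInterval T) (x : M) (a : ℝ) :
    a ≤ exscribed X ν x t ↔
      ∀ y, a * ‖X x t - X y t‖ ^ 2 ≤ 2 * inner ℝ (X x t - X y t) (ν x t) := by
  have := hX.nontrivial hf ht
  obtain ⟨w, hw⟩ := exists_ne x
  have : Nonempty {y : M // y ≠ x} := ⟨⟨w, hw⟩⟩
  have hpos : ∀ y, y ≠ x → 0 < ‖X x t - X y t‖ ^ 2 := fun y hy => by
    have : X x t - X y t ≠ 0 :=
      sub_ne_zero.2 fun h0 => hy ((hX.embedding t ht).embedding.injective h0).symm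
    positivity
  have hiff : ∀ y : {y : M // y ≠ x},
      a ≤ ballCurvature (fun y => X y t) (fun y => ν y t) x y ↔
        a * ‖X x t - X y t‖ ^ 2 ≤ 2 * inner ℝ (X x t - X y t) (ν x t) := fun y => by
    rw [ballCurvature, le_div_iff₀ (hpos y y.2)]
  have hbdd : BddBelow (range fun y : {y : M // y ≠ x} =>
      ballCurvature (fun y => X y t) (fun y => ν y t) x y) := by
    refine ⟨0, ?_⟩
    rintro _ ⟨y, rfl⟩
    have := inner_chord_pos hf hT hX ht x y y.2.symm
    dsimp only [ballCurvature]
    positivity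
  rw [exscribed, exscribedCurvature, le_ciInf_iff hbdd]
  simp only [hiff]
  refine ⟨fun h y => ?_, fun h y => h y⟩
  by_cases hy : y = x
  · subst hy; simp
  · exact h ⟨y, hy⟩

theorem gap_nonneg_iff_exscribed (hf : IsAdmissible f) (hT : 0 < T)
    (hX : IsEmbeddedSolution f Ψ T X ν) {t : ℝ} (ht : t ∈ timeInterval T) {K : ℝ} (hK : 0 < K)
    (x : M) : (∀ y, 0 ≤ gap f X ν K x y t) ↔ K⁻¹ ≤ exscribed X ν x t / speed f X ν x t := by
  rw [gap_nonneg_iff hf hT hX ht hK, le_div_iff₀ (speed_pos hf hX ht x),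
    le_exscribed_iff hf hT hX ht, inv_mul_eq_div]

theorem le_curvature_of_gap_nonneg (hf : IsAdmissible f) (hT : 0 < T)
    (hX : IsEmbeddedSolution f Ψ T X ν) {t : ℝ} (ht : t ∈ timeInterval T) {K : ℝ} (hK : 0 < K)
    {x : M} (h : ∀ y, 0 ≤ gap f X ν K x y t) (i : Fin n) :
    speed f X ν x t ≤ K * curvatures X ν x t i := by
  have h1 := hX.nonneg_of_chord_nonneg hf hT ht x (α := -(speed f X ν x t / K)) (β := 1) (γ := 0)
    (fun y => by linarith [(gap_nonneg_iff hf hT hX ht hK x).1 h y]) i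
  have h2 : speed f X ν x t / K ≤ curvatures X ν x t i := by linarith
  rwa [div_le_iff₀' hK] at h2

/-- The ratio of exscribed curvature and speed has a positive lower bound at each time. -/
theorem exists_exscribed_div_speed_ge (hf : IsAdmissible f) (hΨ : IsModulating Ψ) (hT : 0 < T)
    (hX : IsEmbeddedSolution f Ψ T X ν) {t : ℝ} (ht : t ∈ timeInterval T) :
    ∃ m, 0 < m ∧ ∀ x, m ≤ exscribed X ν x t / speed f X ν x t := by
  obtain ⟨⟨c, hc, h⟩, -⟩ := hX.exists_chord_bounds hf hT ht
  have key : ∀ G : M → ℝ → ℝ, (∀ x, Tendsto (fun q : M × ℝ => G q.1 q.2)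
      (𝓝 x ×ˢ 𝓝[timeInterval T] t) (𝓝 (G x t))) → Continuous fun x => G x t := by
    intro G hG
    rw [continuous_iff_continuousAt]
    intro x
    have h2 : Tendsto (fun y : M => (y, t)) (𝓝 x) (𝓝 x ×ˢ 𝓝[timeInterval T] t) :=
      tendsto_id.prodMk
        (tendsto_nhdsWithin_iff.2 ⟨tendsto_const_nhds, Eventually.of_forall fun _ => ht⟩)
    exact (hG x).comp h2
  have hcont := key (speed f X ν) fun x => continuousWithinAt_speed hf hΨ hT hX ht x
  have hpos : ∀ x, 0 < (fun x => speed f X ν x t) x := speed_pos hf hX ht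
  have hex : ∀ x, c ≤ exscribed X ν x t := fun x => (le_exscribed_iff hf hT hX ht x c).2 (h x)
  suffices hs : ∀ F : M → ℝ, Continuous F → (∀ x, 0 < F x) →
      ∃ m, 0 < m ∧ ∀ x, m ≤ exscribed X ν x t / F x from hs _ hcont hpos
  intro F hF hF0
  obtain ⟨z, -, hz⟩ := (isCompact_univ (X := M)).exists_isMaxOn univ_nonempty hF.continuousOn
  have hFz := hF0 z
  exact ⟨c / F z, by positivity, fun x =>
    div_le_div₀ (hc.le.trans (hex x)) (hex x) (hF0 x) (hz (mem_univ x))⟩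

end Solution

/-! ### Preservation of the enclosing sphere inequality -/

section Preservation

variable {n : ℕ} {M : Type*} [TopologicalSpace M] [ChartedSpace (EuclideanSpace ℝ (Fin n)) M]
  {f : (Fin n → ℝ) → ℝ} {Ψ : ℝ → ℝ} {T : EReal} {X ν : M → ℝ → Ambient n}
  {h h' : Ambient n × ℝ → ℝ} {φ φ' : Ambient n × ℝ → M} {K : ℝ → ℝ}

theorem twoPoint_eq_gap {J : Set ℝ} {q : Ambient n × Ambient n × ℝ}
    (G : IsGaussParam J X ν h φ (q.1, q.2.2)) (G' : IsGaussParam J X ν h' φ' (q.2.1, q.2.2)) :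
    twoPoint K h (fun p => (speed f X ν (φ p) p.2)⁻¹) h' q
      = ‖q.2.1‖ * gap f X ν (K q.2.2) (φ (q.1, q.2.2)) (φ' (q.2.1, q.2.2)) q.2.2 := by
  have h1 : ‖q.1‖ ≠ 0 := norm_ne_zero_iff.2 G.ne_zero
  have h2 : inner ℝ q.1 q.2.1 * ‖q.1‖⁻¹
      = ‖q.2.1‖ * inner ℝ (ν (φ (q.1, q.2.2)) q.2.2) (ν (φ' (q.2.1, q.2.2)) q.2.2) := by
    have e1 := G.normal
    have e2 := G'.normal
    dsimp only at e1 e2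
    conv_lhs => rw [e1, e2]
    rw [inner_smul_left, inner_smul_right, norm_smul, norm_norm]
    simp only [RCLike.conj_to_real]
    have h3 : ‖ν (φ (q.1, q.2.2)) q.2.2‖ = 1 := by
      have := congrArg norm e1
      rw [norm_smul, norm_norm] at this
      exact mul_left_cancel₀ h1 (by rw [← this, mul_one])
    rw [h3]
    field_simp
  have h3 : ∀ v : Ambient n, inner ℝ v q.2.1
      = ‖q.2.1‖ * inner ℝ v (ν (φ' (q.2.1, q.2.2)) q.2.2) := fun v => by
    have e2 := G'.normal
    dsimp only at e2
    conv_lhs => rw [e2]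
    rw [inner_smul_right]
  rw [twoPoint, h2, G.dirDeriv_support, G'.support, gap, sphereGap]
  dsimp only
  rw [h3, h3, inner_sub_left]
  ring

theorem pinching_nonneg {J : Set ℝ} {p : Ambient n × ℝ} (G : IsGaussParam J X ν h φ p)
    (hh : ContDiffAt ℝ 2 h p) (hr : ∀ a, hess h a p.1 p = 0)
    (hle : ∀ i, (curvatures X ν (φ p) p.2 i)⁻¹ ≤ K p.2 * (speed f X ν (φ p) p.2)⁻¹)
    (a : Ambient n) : 0 ≤ pinching K h (fun p => (speed f X ν (φ p) p.2)⁻¹) a p := by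
  obtain ⟨e, he, hep, hfr⟩ := G.frame
  have hn : 0 < ‖p.1‖ := norm_pos_iff.2 G.ne_zero
  set z := ‖p.1‖⁻¹ • p.1 with hz
  have hz1 : ‖z‖ = 1 := by
    rw [hz, norm_smul, norm_inv, norm_norm, inv_mul_cancel₀ hn.ne']
  have hez : ∀ i, inner ℝ (e i) z = 0 := fun i => by rw [hz, inner_smul_right, hep, mul_zero]
  have h1 := inner_expand_frame he hz1 hez a a
  have h2 : inner ℝ z a = ‖p.1‖⁻¹ * inner ℝ a p.1 := by
    rw [hz, inner_smul_left, real_inner_comm]; simp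
  rw [real_inner_self_eq_norm_sq, h2] at h1
  have h3 : ∀ b, hess h a b p = ∑ i, inner ℝ (e i) b * hess h a (e i) p := by
    intro b
    rw [hess_symm hh]
    conv_lhs => rw [expand_frame he hz1 hez b]
    rw [hess_add_left hh, hess_sum_left hh, hess_smul_left hh,
      hess_symm hh z, hz, hess_smul_right hh, hr, mul_zero, mul_zero, zero_add]
    refine Finset.sum_congr rfl fun i _ => ?_
    rw [hess_smul_left hh, hess_symm hh]
  have h4 : (‖p.1‖ ^ 2 * ‖a‖ ^ 2 - inner ℝ a p.1 ^ 2) * (‖p.1‖⁻¹) ^ 3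
      = ‖p.1‖⁻¹ * ∑ i, inner ℝ (e i) a * inner ℝ (e i) a := by
    rw [h1]
    field_simp
    ring
  rw [pinching, h3, h4, ← mul_assoc, Finset.mul_sum, ← Finset.sum_sub_distrib]
  refine Finset.sum_nonneg fun i _ => ?_
  rw [hfr i a]
  have h5 : 0 ≤ (K p.2 * (speed f X ν (φ p) p.2)⁻¹ - (curvatures X ν (φ p) p.2 i)⁻¹)
      * (‖p.1‖⁻¹ * (inner ℝ (e i) a * inner ℝ (e i) a)) :=
    mul_nonneg (sub_nonneg.2 (hle i)) (mul_nonneg (by positivity) (mul_self_nonneg _))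
  refine h5.trans_eq ?_
  rw [div_eq_mul_inv]
  ring

theorem tendsto_uncurry {J : Set ℝ} {Z : M → ℝ → Ambient n}
    (hZ : ContMDiffOn ((𝓡 n).prod 𝓘(ℝ, ℝ)) 𝓘(ℝ, Ambient n) ∞
      (fun p : M × ℝ => Z p.1 p.2) (univ ×ˢ J)) {t : ℝ} (ht : t ∈ J) (x : M) :
    Tendsto (fun q : M × ℝ => Z q.1 q.2) (𝓝 x ×ˢ 𝓝[J] t) (𝓝 (Z x t)) := by
  have := (hZ.continuousOn (x, t) ⟨mem_univ _, ht⟩).tendsto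
  rwa [nhdsWithin_prod_eq, nhdsWithin_univ] at this

theorem tendsto_sphereGap {l : Filter ℝ} {t : ℝ} {F : M → ℝ → ℝ} {Y N : M → ℝ → Ambient n}
    {x y : M} (hK : Tendsto K l (𝓝 (K t)))
    (hF : Tendsto (fun q : M × ℝ => F q.1 q.2) (𝓝 x ×ˢ l) (𝓝 (F x t))) (hF0 : F x t ≠ 0)
    (hY : ∀ x, Tendsto (fun q : M × ℝ => Y q.1 q.2) (𝓝 x ×ˢ l) (𝓝 (Y x t)))
    (hN : ∀ x, Tendsto (fun q : M × ℝ => N q.1 q.2) (𝓝 x ×ˢ l) (𝓝 (N x t))) :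
    Tendsto (fun q : M × M × ℝ => sphereGap (K q.2.2 * (F q.1 q.2.2)⁻¹) (Y q.1 q.2.2)
      (N q.1 q.2.2) (Y q.2.1 q.2.2) (N q.2.1 q.2.2)) (𝓝 x ×ˢ 𝓝 y ×ˢ l)
      (𝓝 (sphereGap (K t * (F x t)⁻¹) (Y x t) (N x t) (Y y t) (N y t))) := by
  have p1 : Tendsto (fun q : M × M × ℝ => (q.1, q.2.2)) (𝓝 x ×ˢ 𝓝 y ×ˢ l) (𝓝 x ×ˢ l) :=
    tendsto_fst.prodMk (tendsto_snd.comp tendsto_snd)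
  have p2 : Tendsto (fun q : M × M × ℝ => q.2) (𝓝 x ×ˢ 𝓝 y ×ˢ l) (𝓝 y ×ˢ l) := tendsto_snd
  have p3 : Tendsto (fun q : M × M × ℝ => q.2.2) (𝓝 x ×ˢ 𝓝 y ×ˢ l) l :=
    tendsto_snd.comp tendsto_snd
  have k1 := hK.comp p3
  have k2 := (hF.comp p1).inv₀ hF0
  have k3 := (hY x).comp p1
  have k4 := (hN x).comp p1
  have k5 := (hY y).comp p2
  have k6 := (hN y).comp p2
  exact ((k1.mul k2).mul ((tendsto_const_nhds (x := (1 : ℝ))).sub (k4.inner k6))).sub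
    ((k5.sub k3).inner k6)

theorem continuousWithinAt_sphereGap {J S : Set ℝ} (hS : S ⊆ J) {t : ℝ} {F : M → ℝ → ℝ}
    {Y N : M → ℝ → Ambient n} {x y : M} (hK : ContinuousAt K t)
    (hF : Tendsto (fun q : M × ℝ => F q.1 q.2) (𝓝 x ×ˢ 𝓝[J] t) (𝓝 (F x t))) (hF0 : F x t ≠ 0)
    (hY : ∀ x, Tendsto (fun q : M × ℝ => Y q.1 q.2) (𝓝 x ×ˢ 𝓝[J] t) (𝓝 (Y x t)))
    (hN : ∀ x, Tendsto (fun q : M × ℝ => N q.1 q.2) (𝓝 x ×ˢ 𝓝[J] t) (𝓝 (N x t))) :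
    ContinuousWithinAt (fun s => sphereGap (K s * (F x s)⁻¹) (Y x s) (N x s) (Y y s) (N y s))
      S t := by
  have h1 := tendsto_sphereGap (x := x) (y := y) (hK.tendsto.mono_left nhdsWithin_le_nhds)
    hF hF0 hY hN
  have h2 : Tendsto (fun s : ℝ => (x, y, s)) (𝓝[S] t) (𝓝 x ×ˢ 𝓝 y ×ˢ 𝓝[J] t) :=
    tendsto_const_nhds.prodMk (tendsto_const_nhds.prodMk (tendsto_id'.2 (nhdsWithin_mono t hS)))
  exact h1.comp h2

theorem gap_mono (hf : IsAdmissible f) (hX : IsEmbeddedSolution f Ψ T X ν) {t : ℝ}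
    (ht : t ∈ timeInterval T) {K₁ K₂ : ℝ} {x y : M} (hxy : ν x t ≠ ν y t) (hK : K₁ < K₂) :
    gap f X ν K₁ x y t < gap f X ν K₂ x y t := by
  have h1 := inv_pos.2 (speed_pos hf hX ht x)
  have h2 := (inner_lt_one_iff_real_of_norm_eq_one (norm_normal hX ht x)
    (norm_normal hX ht y)).2 hxy
  have h3 : K₁ * (speed f X ν x t)⁻¹ < K₂ * (speed f X ν x t)⁻¹ := mul_lt_mul_of_pos_right hK h1
  rw [gap, gap, sphereGap, sphereGap]
  have := mul_lt_mul_of_pos_right h3 (sub_pos.2 h2)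
  linarith

variable [IsManifold (𝓡 n) ∞ M] [CompactSpace M] [ConnectedSpace M]

theorem inv_curvature_le_of_gap_nonneg (hf : IsAdmissible f) (hT : 0 < T)
    (hX : IsEmbeddedSolution f Ψ T X ν) {t : ℝ} (ht : t ∈ timeInterval T) {K : ℝ} (hK : 0 < K)
    {x : M} (h : ∀ y, 0 ≤ gap f X ν K x y t) (i : Fin n) :
    (curvatures X ν x t i)⁻¹ ≤ K * (speed f X ν x t)⁻¹ := by
  have h1 := le_curvature_of_gap_nonneg hf hT hX ht hK h i
  have h2 := speed_pos hf hX ht x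
  have h3 : 0 < curvatures X ν x t i := hX.curvature_mem t ht x i
  rw [inv_eq_one_div, div_le_iff₀ h3, mul_right_comm, ← div_eq_mul_inv, one_le_div h2]
  exact h1

/-- The step back from the support function computations: while `K` increases strictly, neither kind
of equality can occur at the final time. It needs `t > 0`, so that the solution is defined on both
sides of `t`. -/
theorem gap_strict (hf : IsAdmissible f) (hfc : IsInverseConcave f) (hΨ : IsModulating Ψ)
    (hT : 0 < T) (hX : IsEmbeddedSolution f Ψ T X ν) {t : ℝ} (ht : t ∈ timeInterval T)
    (h0 : 0 < t) {K' : ℝ} (hK : 0 < K t) (hKd : HasDerivAt K K' t) (hK' : 0 < K')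
    (hnn : ∀ᶠ s in 𝓝 t, s ≤ t → ∀ x y, 0 ≤ gap f X ν (K s) x y s) :
    (∀ x y, x ≠ y → 0 < gap f X ν (K t) x y t) ∧
      ∀ x i, speed f X ν x t < K t * curvatures X ν x t i := by
  have hΦ := hΨ.isDualModulating
  have hnnt := hnn.self_of_nhds le_rfl
  have hKpos : ∀ᶠ s in 𝓝 t, 0 < K s := hKd.continuousAt.eventually (lt_mem_nhds hK)
  have hpin : ∀ {z : Ambient n} {h : Ambient n × ℝ → ℝ} {φ : Ambient n × ℝ → M},
      IsLocalSol f (fun s => -Ψ s⁻¹) h (fun p => (speed f X ν (φ p) p.2)⁻¹) z t →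
      (∀ᶠ p in 𝓝 (z, t), IsGaussParam (timeInterval T) X ν h φ p) →
      ∀ᶠ p in 𝓝 (z, t), p.2 ≤ t → ∀ a,
        0 ≤ pinching K h (fun p => (speed f X ν (φ p) p.2)⁻¹) a p := by
    intro z h φ S G
    have hsnd : Tendsto (fun p : Ambient n × ℝ => p.2) (𝓝 (z, t)) (𝓝 t) :=
      continuous_snd.continuousAt
    filter_upwards [G, S.eventually_contDiffAt, S.hess_self_right, hsnd.eventually hnn,
      hsnd.eventually hKpos] with p hG hp hr hs hKp hpt
    exact pinching_nonneg hG hp hr fun i =>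
      inv_curvature_le_of_gap_nonneg hf hT hX hG.mem hKp (hs hpt (φ p)) i
  refine ⟨fun x y hxy => lt_of_le_of_ne (hnnt x y) fun hzero => ?_, fun x i =>
    lt_of_le_of_ne (le_curvature_of_gap_nonneg hf hT hX ht hK (hnnt x) i) fun heq => ?_⟩
  · obtain ⟨h, φ, hφ, S, G⟩ := hX.exists_isLocalSol hf hΨ hT ht h0 x
    obtain ⟨h', φ', hφ', S', G'⟩ := hX.exists_isLocalSol hf hΨ hT ht h0 y
    refine not_off_diagonal_zero hΦ hf hfc S S' (normal_ne hf hT hX ht hxy) hK hKd hK' ?_ ?_ ?_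
    · intro e μ E i
      have h1 := (hpin S G).self_of_nhds le_rfl (e i)
      have h2 : pinching K h (fun p => (speed f X ν (φ p) p.2)⁻¹) (e i) (ν x t, t)
          = K t * (speed f X ν (φ (ν x t, t)) t)⁻¹ - μ i := by
        simp [pinching, S.norm_eq, E.orthonormal.1, E.inner_eq_zero, E.hess_eq]
      rw [h2] at h1
      linarith
    · have t1 : Tendsto (fun q : Ambient n × Ambient n × ℝ => (q.1, q.2.2))
          (𝓝 (ν x t, ν y t, t)) (𝓝 (ν x t, t)) := by
        have : Continuous fun q : Ambient n × Ambient n × ℝ => (q.1, q.2.2) := by fun_prop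
        exact this.tendsto (ν x t, ν y t, t)
      have t2 : Tendsto (fun q : Ambient n × Ambient n × ℝ => (q.2.1, q.2.2))
          (𝓝 (ν x t, ν y t, t)) (𝓝 (ν y t, t)) := by
        have : Continuous fun q : Ambient n × Ambient n × ℝ => (q.2.1, q.2.2) := by fun_prop
        exact this.tendsto (ν x t, ν y t, t)
      have t3 : Tendsto (fun q : Ambient n × Ambient n × ℝ => q.2.2)
          (𝓝 (ν x t, ν y t, t)) (𝓝 t) := by
        have : Continuous fun q : Ambient n × Ambient n × ℝ => q.2.2 := by fun_prop
        exact this.tendsto (ν x t, ν y t, t)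
      filter_upwards [t1.eventually G, t2.eventually G', t3.eventually hnn] with q g1 g2 g3 hq
      rw [twoPoint_eq_gap g1 g2]
      exact mul_nonneg (norm_nonneg _) (g3 hq _ _)
    · rw [twoPoint_eq_gap G.self_of_nhds G'.self_of_nhds]
      dsimp only
      rw [hφ, hφ', ← hzero, mul_zero]
  · obtain ⟨h, φ, hφ, S, G⟩ := hX.exists_isLocalSol hf hΨ hT ht h0 x
    obtain ⟨e, he, hez, hfr⟩ := G.self_of_nhds.frame
    have E : IsEigenframe f h (fun p => (speed f X ν (φ p) p.2)⁻¹) (ν x t) t e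
        (fun i => (curvatures X ν x t i)⁻¹) := by
      refine ⟨he, hez, inv_mem_positiveCone (hX.curvature_mem t ht x), ?_, fun j a => ?_⟩
      · dsimp only
        rw [hφ, dual_inv]
        rfl
      · rw [hfr]
        dsimp only
        rw [hφ, S.norm_eq, div_one]
    refine not_diagonal_zero hΦ hf hfc S E hK hKd hK' (hpin S G) (k := i) ?_
    dsimp only
    have h3 : 0 < curvatures X ν x t i := hX.curvature_mem t ht x i
    rw [hφ, heq]
    field_simp

/-- Off the diagonal this is continuity. On the diagonal the gap vanishes, and strict pinching makes
it nonnegative on a full neighbourhood by the second order expansion; compactness of `M × M` makes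
the time uniform. -/
theorem eventually_gap_nonneg (hf : IsAdmissible f) (hΨ : IsModulating Ψ)
    (hT : 0 < T) (hX : IsEmbeddedSolution f Ψ T X ν) {t : ℝ} (ht : t ∈ timeInterval T)
    (hKc : ContinuousAt K t)
    (hoff : ∀ x y, x ≠ y → 0 < gap f X ν (K t) x y t)
    (hdiag : ∀ x i, speed f X ν x t < K t * curvatures X ν x t i) :
    ∀ᶠ s in 𝓝[timeInterval T] t, ∀ x y, 0 ≤ gap f X ν (K s) x y s := by
  have hKt : Tendsto K (𝓝[timeInterval T] t) (𝓝 (K t)) := hKc.tendsto.mono_left nhdsWithin_le_nhds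
  have hloc : ∀ x y, ∀ᶠ q : M × M × ℝ in 𝓝 x ×ˢ 𝓝 y ×ˢ 𝓝[timeInterval T] t,
      0 ≤ gap f X ν (K q.2.2) q.1 q.2.1 q.2.2 := by
    intro x y
    have hFx := speed_pos hf hX ht x
    have hFc := continuousWithinAt_speed hf hΨ hT hX ht x
    by_cases hxy : x = y
    · subst hxy
      obtain ⟨γ, hγ, hγK⟩ : ∃ γ, (∀ i, (curvatures X ν x t i)⁻¹ < γ) ∧
          γ < K t * (speed f X ν x t)⁻¹ := by
        have : ∀ᶠ γ in 𝓝[<] (K t * (speed f X ν x t)⁻¹), ∀ i, (curvatures X ν x t i)⁻¹ < γ := by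
          refine eventually_all.2 fun i => mem_nhdsWithin_of_mem_nhds (lt_mem_nhds ?_)
          have h3 : 0 < curvatures X ν x t i := hX.curvature_mem t ht x i
          rw [inv_eq_one_div, div_lt_iff₀ h3, mul_right_comm, ← div_eq_mul_inv, one_lt_div hFx]
          exact hdiag x i
        exact (this.and self_mem_nhdsWithin).exists
      have h1 := hX.eventually_chord_nonneg hf hT ht x (α := 0) (β := -1) (γ := γ) fun i => by
        have h3 : 0 < curvatures X ν x t i := hX.curvature_mem t ht x i
        have h4 := (inv_lt_iff_one_lt_mul₀ h3).1 (hγ i)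
        nlinarith
      -- The gap uses the normal at the second point, the chord expansion that at the first.
      have hswap : Tendsto (fun q : M × M × ℝ => (q.2.1, q.1, q.2.2))
          (𝓝 x ×ˢ 𝓝 x ×ˢ 𝓝[timeInterval T] t) (𝓝 x ×ˢ 𝓝 x ×ˢ 𝓝[timeInterval T] t) :=
        (tendsto_fst.comp tendsto_snd).prodMk
          (tendsto_fst.prodMk (tendsto_snd.comp tendsto_snd))
      have p1 : Tendsto (fun q : M × M × ℝ => (q.1, q.2.2))
          (𝓝 x ×ˢ 𝓝 x ×ˢ 𝓝[timeInterval T] t) (𝓝 x ×ˢ 𝓝[timeInterval T] t) :=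
        tendsto_fst.prodMk (tendsto_snd.comp tendsto_snd)
      have p2 : Tendsto (fun q : M × M × ℝ => q.2.2)
          (𝓝 x ×ˢ 𝓝 x ×ˢ 𝓝[timeInterval T] t) (𝓝[timeInterval T] t) :=
        tendsto_snd.comp tendsto_snd
      have h2 := ((hKt.comp p2).mul ((hFc.comp p1).inv₀ hFx.ne')).eventually (lt_mem_nhds hγK)
      have h3 := p2.eventually (self_mem_nhdsWithin (s := timeInterval T) (a := t))
      filter_upwards [hswap.eventually h1, h2, h3] with q h1 h2 h3
      have h4 := two_mul_sphereGap (K q.2.2 * (speed f X ν q.1 q.2.2)⁻¹) (X q.1 q.2.2)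
        (X q.2.1 q.2.2) (norm_normal hX h3 q.1) (norm_normal hX h3 q.2.1)
      have h5 : γ * ‖ν q.2.1 q.2.2 - ν q.1 q.2.2‖ ^ 2
          ≤ K q.2.2 * (speed f X ν q.1 q.2.2)⁻¹ * ‖ν q.2.1 q.2.2 - ν q.1 q.2.2‖ ^ 2 :=
        mul_le_mul_of_nonneg_right h2.le (sq_nonneg _)
      rw [gap]
      linarith
    · have h1 := tendsto_sphereGap (y := y) hKt hFc hFx.ne'
        (tendsto_uncurry hX.smooth ht) (tendsto_uncurry hX.smooth_normal ht)
      exact (h1.eventually (lt_mem_nhds (hoff x y hxy))).mono fun q hq => le_of_lt hq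
  have hcpt := (isCompact_univ (X := M × M)).eventually_forall_of_forall_eventually
    (x₀ := t) (P := fun s q => s ∈ timeInterval T → 0 ≤ gap f X ν (K s) q.1 q.2 s) (by
      rintro ⟨x, y⟩ -
      have h1 : Tendsto (fun z : ℝ × M × M => (z.2.1, z.2.2, z.1))
          (𝓝[timeInterval T ×ˢ univ] (t, (x, y))) (𝓝 x ×ˢ 𝓝 y ×ˢ 𝓝[timeInterval T] t) := by
        rw [nhdsWithin_prod_eq, nhdsWithin_univ, nhds_prod_eq]
        exact (tendsto_fst.comp tendsto_snd).prodMk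
          ((tendsto_snd.comp tendsto_snd).prodMk tendsto_fst)
      have h2 := eventually_nhdsWithin_iff.1 (h1.eventually (hloc x y))
      exact h2.mono fun z hz hzJ => hz ⟨hzJ, mem_univ _⟩)
  rw [eventually_nhdsWithin_iff]
  exact hcpt.mono fun s hs hsJ x y => hs (x, y) (mem_univ _) hsJ

/-- Continuous induction on `[t₁, t₂]`: the good set is closed, and at each good time strictness
pushes it further to the right. -/
theorem gap_nonneg_of_barrier (hf : IsAdmissible f) (hfc : IsInverseConcave f)
    (hΨ : IsModulating Ψ) (hT : 0 < T) (hX : IsEmbeddedSolution f Ψ T X ν) {t₁ t₂ : ℝ}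
    (ht₁ : t₁ ∈ timeInterval T) (ht₂ : t₂ ∈ timeInterval T) {K₀ ε : ℝ} (hK₀ : 0 < K₀)
    (hε : 0 < ε) (h : ∀ x y, 0 ≤ gap f X ν K₀ x y t₁) :
    ∀ t ∈ Icc t₁ t₂, ∀ x y, 0 ≤ gap f X ν (K₀ + ε * (1 + (t - t₁))) x y t := by
  set K : ℝ → ℝ := fun t => K₀ + ε * (1 + (t - t₁)) with hKdef
  have hJ : Icc t₁ t₂ ⊆ timeInterval T := (convex_timeInterval T).ordConnected.out ht₁ ht₂
  have hKd : ∀ t, HasDerivAt K ε t := fun t => by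
    have h1 := ((((hasDerivAt_id t).sub_const t₁).const_add 1).const_mul ε).const_add K₀
    exact h1.congr_deriv (by simp)
  have hKpos : ∀ t, t₁ ≤ t → K₀ < K t := fun t ht => by
    have : 0 < ε * (1 + (t - t₁)) := mul_pos hε (by linarith)
    simp only [hKdef]
    linarith
  set S : Set ℝ := {t | ∀ x y, 0 ≤ gap f X ν (K t) x y t} with hS
  have hclosed : IsClosed (S ∩ Icc t₁ t₂) := by
    have hset : S ∩ Icc t₁ t₂
        = ⋂ x, ⋂ y, Icc t₁ t₂ ∩ (fun t => gap f X ν (K t) x y t) ⁻¹' Ici 0 := by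
      obtain ⟨x₀⟩ := (inferInstance : Nonempty M)
      ext t
      simp only [mem_inter_iff, mem_iInter, mem_preimage, mem_Ici]
      exact ⟨fun h x y => ⟨h.2, h.1 x y⟩, fun h => ⟨fun x y => (h x y).2, (h x₀ x₀).1⟩⟩
    rw [hset]
    refine isClosed_iInter fun x => isClosed_iInter fun y =>
      ContinuousOn.preimage_isClosed_of_isClosed ?_ isClosed_Icc isClosed_Ici
    intro t ht
    exact continuousWithinAt_sphereGap (F := speed f X ν) hJ (hKd t).continuousAt
      (continuousWithinAt_speed hf hΨ hT hX (hJ ht) x) (speed_pos hf hX (hJ ht) x).ne'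
      (tendsto_uncurry hX.smooth (hJ ht)) (tendsto_uncurry hX.smooth_normal (hJ ht))
  have hstart : ∀ t ∈ Ico t₁ t₂, Icc t₁ t ⊆ S →
      (∀ x y, x ≠ y → 0 < gap f X ν (K t) x y t) ∧
        ∀ x i, speed f X ν x t < K t * curvatures X ν x t i := by
    intro t ht hsub
    have htJ : t ∈ timeInterval T := hJ ⟨ht.1, ht.2.le⟩
    -- At the initial time, possibly `0`, strictness comes from the jump `K(t₁) = K₀ + ε > K₀`;
    -- later it comes from `gap_strict`.
    rcases eq_or_lt_of_le ht.1 with rfl | hlt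
    · refine ⟨fun x y hxy => (h x y).trans_lt
        (gap_mono hf hX htJ (normal_ne hf hT hX htJ hxy) (hKpos _ le_rfl)), fun x i => ?_⟩
      exact (le_curvature_of_gap_nonneg hf hT hX htJ hK₀ (h x) i).trans_lt
        (mul_lt_mul_of_pos_right (hKpos _ le_rfl) (hX.curvature_mem _ htJ x i))
    · refine gap_strict hf hfc hΨ hT hX htJ (ht₁.1.trans_lt hlt) (hK₀.trans (hKpos t ht.1)) (hKd t)
        hε ?_
      filter_upwards [lt_mem_nhds hlt] with s hs hst
      exact hsub ⟨hs.le, hst⟩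
  refine hclosed.Icc_subset_of_forall_mem_nhdsGT_of_Icc_subset ?_ fun t ht hsub => ?_
  · intro x y
    by_cases hxy : x = y
    · subst hxy
      have hn := norm_normal hX ht₁ x
      simp [gap, sphereGap, hn]
    · exact (h x y).trans (gap_mono hf hX ht₁ (normal_ne hf hT hX ht₁ hxy) (hKpos _ le_rfl)).le
  · have htJ : t ∈ timeInterval T := hJ ⟨ht.1, ht.2.le⟩
    obtain ⟨h1, h2⟩ := hstart t ht hsub
    have h3 := eventually_gap_nonneg hf hΨ hT hX htJ (hKd t).continuousAt h1 h2
    have h4 : 𝓝[>] t ≤ 𝓝[timeInterval T] t := by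
      refine nhdsWithin_le_iff.2 ?_
      filter_upwards [Ioo_mem_nhdsGT ht.2] with s hs
      exact hJ ⟨ht.1.trans hs.1.le, hs.2.le⟩
    exact h4 h3

theorem gap_nonneg_of_le (hf : IsAdmissible f) (hfc : IsInverseConcave f)
    (hΨ : IsModulating Ψ) (hT : 0 < T) (hX : IsEmbeddedSolution f Ψ T X ν) {t₁ t₂ : ℝ}
    (ht₁ : t₁ ∈ timeInterval T) (ht₂ : t₂ ∈ timeInterval T) (hle : t₁ ≤ t₂) {K : ℝ} (hK : 0 < K)
    (h : ∀ x y, 0 ≤ gap f X ν K x y t₁) (x y : M) : 0 ≤ gap f X ν K x y t₂ := by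
  have h1 : Tendsto (fun ε : ℝ => gap f X ν (K + ε * (1 + (t₂ - t₁))) x y t₂) (𝓝[>] 0)
      (𝓝 (gap f X ν K x y t₂)) := by
    have hc : Continuous fun ε : ℝ => gap f X ν (K + ε * (1 + (t₂ - t₁))) x y t₂ := by
      unfold gap sphereGap
      fun_prop
    have := hc.tendsto 0
    rw [zero_mul, add_zero] at this
    exact this.mono_left nhdsWithin_le_nhds
  refine ge_of_tendsto h1 ?_
  filter_upwards [self_mem_nhdsWithin] with ε hε
  exact gap_nonneg_of_barrier hf hfc hΨ hT hX ht₁ ht₂ hK hε h t₂ ⟨hle, le_rfl⟩ x y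

end Preservation

/-! ### Return to the ratio of exscribed curvature and speed -/

section Ratio

variable {n : ℕ} {M : Type*} [TopologicalSpace M] [ChartedSpace (EuclideanSpace ℝ (Fin n)) M]
  [IsManifold (𝓡 n) ∞ M] [CompactSpace M] [ConnectedSpace M]
  {f : (Fin n → ℝ) → ℝ} {Ψ : ℝ → ℝ} {T : EReal} {X ν : M → ℝ → Ambient n}

theorem iInf_exscribed_div_speed (hf : IsAdmissible f) (hΨ : IsModulating Ψ) (hT : 0 < T)
    (hX : IsEmbeddedSolution f Ψ T X ν) {t : ℝ} (ht : t ∈ timeInterval T) :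
    0 < (⨅ z, exscribed X ν z t / speed f X ν z t) ∧
      ∀ x, (⨅ z, exscribed X ν z t / speed f X ν z t) ≤ exscribed X ν x t / speed f X ν x t := by
  obtain ⟨m, hm, h⟩ := exists_exscribed_div_speed_ge hf hΨ hT hX ht
  have hbdd : BddBelow (range fun z => exscribed X ν z t / speed f X ν z t) :=
    ⟨m, by rintro _ ⟨x, rfl⟩; exact h x⟩
  exact ⟨hm.trans_le (le_ciInf h), fun x => ciInf_le hbdd x⟩

theorem iInf_exscribed_div_speed_le (hf : IsAdmissible f) (hfc : IsInverseConcave f)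
    (hΨ : IsModulating Ψ) (hT : 0 < T) (hX : IsEmbeddedSolution f Ψ T X ν) {t₁ t₂ : ℝ}
    (ht₁ : t₁ ∈ timeInterval T) (ht₂ : t₂ ∈ timeInterval T) (hle : t₁ ≤ t₂) (x : M) :
    (⨅ z, exscribed X ν z t₁ / speed f X ν z t₁) ≤ exscribed X ν x t₂ / speed f X ν x t₂ := by
  obtain ⟨hpos, h⟩ := iInf_exscribed_div_speed hf hΨ hT hX ht₁
  set m := ⨅ z, exscribed X ν z t₁ / speed f X ν z t₁ with hm
  have h1 : ∀ x y, 0 ≤ gap f X ν m⁻¹ x y t₁ := fun x =>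
    (gap_nonneg_iff_exscribed hf hT hX ht₁ (inv_pos.2 hpos) x).2 (by rw [inv_inv]; exact h x)
  have h2 := (gap_nonneg_iff_exscribed hf hT hX ht₂ (inv_pos.2 hpos) x).1 fun y =>
    gap_nonneg_of_le hf hfc hΨ hT hX ht₁ ht₂ hle (inv_pos.2 hpos) h1 x y
  rwa [inv_inv] at h2

end Ratio

end CurvatureFlow

end

theorem mainTheorem2 {n : ℕ} {M : Type*} [TopologicalSpace M]
    [ChartedSpace (EuclideanSpace ℝ (Fin n)) M] [IsManifold (𝓡 n) ∞ M]
    [T2Space M] [CompactSpace M] [ConnectedSpace M]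
    (f : (Fin n → ℝ) → ℝ) (hf : CurvatureFlow.IsAdmissible f)
    (hfc : CurvatureFlow.IsInverseConcave f)
    (Ψ : ℝ → ℝ) (hΨ : CurvatureFlow.IsModulating Ψ)
    (T : EReal) (hT : 0 < T) (X ν : M → ℝ → CurvatureFlow.Ambient n)
    (hX : CurvatureFlow.IsEmbeddedSolution f Ψ T X ν) :
    0 < (⨅ z, CurvatureFlow.exscribed X ν z 0 / CurvatureFlow.speed f X ν z 0) ∧
    (∀ x, ∀ t ∈ CurvatureFlow.timeInterval T,
      (⨅ z, CurvatureFlow.exscribed X ν z 0 / CurvatureFlow.speed f X ν z 0) ≤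
        CurvatureFlow.exscribed X ν x t / CurvatureFlow.speed f X ν x t) ∧
    MonotoneOn (fun t => ⨅ z, CurvatureFlow.exscribed X ν z t / CurvatureFlow.speed f X ν z t)
      (CurvatureFlow.timeInterval T) := by
  have h0 : (0 : ℝ) ∈ CurvatureFlow.timeInterval T := ⟨le_rfl, by exact_mod_cast hT⟩
  refine ⟨(CurvatureFlow.iInf_exscribed_div_speed hf hΨ hT hX h0).1, fun x t ht => ?_,
    fun t₁ ht₁ t₂ ht₂ hle => ?_⟩
  · exact CurvatureFlow.iInf_exscribed_div_speed_le hf hfc hΨ hT hX h0 ht ht.1 x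
  · exact le_ciInf fun x =>
      CurvatureFlow.iInf_exscribed_div_speed_le hf hfc hΨ hT hX ht₁ ht₂ hle x
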